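/- **Theorem (dependence of the process zone on the radius of the peridynamic horizon).** *Setting.* Let $d\in\{2,3\}$ and let $\omega_n$ be the volume of the unit ball of $\mathbb{R}^n$. Let $f:[0,\infty)\to\mathbb{R}$ be smooth and concave, positive on $(0,\infty)$, with $\lim_{r\to0^+}f(r)/r=f'(0)>0$ and $\lim_{r\to\infty}f(r)=f_\infty<\infty$. Let $J\ge 0$ be measurable and bounded on $[0,1)$, with $J=0$ on $[1,\infty)$ and $m=\int_{|\xi|<1}|\xi|J(|\xi|)\,d\xi>0$. Let $D\subset\mathbb{R}^d$ be open and bounded and $a>2\epsilon>0$. Let $D_c=\{x\in D:\operatorname{dist}(x,\mathbb{R}^d\setminus D)\le a\}$, $D_s=D\setminus D_c$, and let $L^2_0(D;\mathbb{R}^d)$ be the space of $u\in L^2(D;\mathbb{R}^d)$ with $u=0$ a.e. on $D_c$, extended by $0$ outside $D$. Write $e=\frac{y-x}{|y-x|}$, $\mathcal{S}(y,x)=\frac{u(y)-u(x)}{|y-x|}\cdot e$, $\mathcal{W}^\epsilon(\mathcal{S},y-x)=\frac1\epsilon J(|y-x|/\epsilon)\frac{1}{|y-x|}f(|y-x|\mathcal{S}^2)$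 and $$\nabla PD^\epsilon(u)(x)=-\frac{2}{\epsilon^d\omega_d}\int_{|y-x|<\epsilon}\partial_{\mathcal{S}}\mathcal{W}^\epsilon(\mathcal{S},y-x)\,e\,dy .$$ Let $\rho,T>0$, $b\in C([0,T];L^2(D;\mathbb{R}^d))$, $u_0,v_0\in L^2_0(D;\mathbb{R}^d)$, and let $u^\epsilon\in C^2([0,T];L^2_0(D;\mathbb{R}^d))$ satisfy $\rho u^\epsilon_{tt}=-\nabla PD^\epsilon(u^\epsilon)+b$ a.e. in $D_s$ for every $t\in[0,T]$, $u^\epsilon(0)=u_0$ and $u^\epsilon_t(0)=v_0$. Let $u_0$ have finite energy in the sense of linear elastic fracture mechanics: there are a crack set $K\subset D$, Borel, of finite $(d-1)$-dimensional Hausdorff measure $|K|$ (normalized to be length, resp. area) and contained, up to a null set for that measure, in countably many $C^1$ hypersurfaces, and a strain field $\mathcal{E}u_0\in L^2(D;\mathbb{R}^{d\times d})$, such that the symmetrized distributional gradient of $u_0$ on $D$ is $\mathcal{E}u_0\,dx$ plus a matrix measure with an integrable density with respect to $(d-1)$-dimensional Hausdorff measure on $K$ (for $u_0\in SBD(D)$,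 $K$ may be the jump set). Put $$LEFM(u_0)=\int_D\left(2\mu|\mathcal{E}u_0|^2+\lambda\,|\operatorname{tr}\mathcal{E}u_0|^2\right)dx+\mathcal{G}_c|K|,$$ $$\mu=\lambda=\frac{f'(0)}{d+2}\int_0^1r^dJ(r)\,dr,\qquad \mathcal{G}_c=\frac{2\omega_{d-1}}{\omega_d}f_\infty\int_0^1r^dJ(r)\,dr,$$ $$C(t)=\left(\left(2LEFM(u_0)+\rho\|v_0\|_{L^2(D;\mathbb{R}^d)}^2+1\right)^{1/2}+\sqrt{\rho^{-1}}\int_0^t\|b(\tau)\|_{L^2(D;\mathbb{R}^d)}\,d\tau\right)^2-1 .$$ For $k>0$, $1/2\le\alpha<1$, $0<\theta\le1$ and $t\in[0,T]$, the process zone $PZ^\epsilon(k,\alpha,\theta,t)$ is the set of $x\in D$ with $$P\left(\left\{y:|y-x|<\epsilon,\ |\mathcal{S}^\epsilon(t,y,x)|>k|y-x|^{\alpha-1}\right\}\right)>\theta,\qquad P(B)=\frac{1}{\epsilon^dm}\int_B\frac{|y-x|}{\epsilon}J\!\left(\frac{|y-x|}{\epsilon}\right)dy,$$ where $\mathcal{S}^\epsilon(t,y,x)$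 is the strain of $u^\epsilon(t)$. *Statement.* Let $\beta=2\alpha-1\in[0,1)$. Define $r(\epsilon)$ for $\epsilon>0$ by $f(k^2\epsilon^\beta)=k^2\epsilon^\beta\,(f'(0)+r(\epsilon))$; it depends only on $f$, $k$, $\alpha$ and $\epsilon$. Then $f'(0)+r(\epsilon)>0$ for every $\epsilon>0$, $r(\epsilon)=O(\epsilon^\beta)$ as $\epsilon\to0^+$ (so $r(\epsilon)\to0$ if $\beta>0$), and for all data as above and all $t\in[0,T]$ $$\mathcal{L}^d\left(PZ^\epsilon(k,\alpha,\theta,t)\right)\le\frac{\epsilon^{1-\beta}}{\theta k^2\,(f'(0)+r(\epsilon))}\cdot\frac{\omega_d\,C(t)}{2m}\qquad\text{and}\qquad C(t)\le C(T),$$ so that the bound with $C(T)$ in place of $C(t)$ is uniform in $t\in[0,T]$. -/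

import Mathlib

open MeasureTheory Set Filter Topology
open scoped ENNReal ContDiff

noncomputable section

namespace CohesiveDynamics

/-- `ℝ^d` with its Euclidean norm. -/
abbrev Euc (d : ℕ) : Type := EuclideanSpace ℝ (Fin d)

/-- `ω_n`, the volume of the unit ball of `ℝ^n`. -/
def unitBallVolume (n : ℕ) : ℝ := volume.real (Metric.ball (0 : Euc n) 1)

/-- The potential function `f : [0, ∞) → ℝ` (values at negative arguments are irrelevant):
positive, smooth up to `0` and concave, with `f(r)/r → f'(0) > 0` as `r → 0⁺` and
`f(r) → finf` as `r → ∞`. -/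
structure IsCohesivePotential (f : ℝ → ℝ) (finf : ℝ) : Prop where
  smooth : ContDiffOn ℝ ∞ f (Ici 0)
  concave : ConcaveOn ℝ (Ici 0) f
  pos : ∀ r, 0 < r → 0 < f r
  slope_tendsto : Tendsto (fun r => f r / r) (𝓝[>] 0) (𝓝 (derivWithin f (Ici 0) 0))
  slope_pos : 0 < derivWithin f (Ici 0) 0
  tendsto_top : Tendsto f atTop (𝓝 finf)

/-- The influence function `J`, giving `J^ε(|y - x|) = J(|y - x| / ε)`. -/
structure IsInfluenceFunction (J : ℝ → ℝ) : Prop where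
  measurable : Measurable J
  nonneg : ∀ r, 0 ≤ r → 0 ≤ J r
  bounded : ∃ M : ℝ, ∀ r, 0 ≤ r → r < 1 → J r < M
  eq_zero : ∀ r, 1 ≤ r → J r = 0

/-- The normalization constant `m = ∫_{|ξ| < 1} |ξ| J(|ξ|) dξ`. -/
def influenceMoment (d : ℕ) (J : ℝ → ℝ) : ℝ :=
  ∫ ξ in Metric.ball (0 : Euc d) 1, ‖ξ‖ * J ‖ξ‖

/-! ### The equation of motion -/

/-- The linearized strain `S = ((u(y) - u(x)) / |y - x|) · e`, `e = (y - x) / |y - x|`. -/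
def strain {d : ℕ} (u : Euc d → Euc d) (y x : Euc d) : ℝ :=
  inner ℝ (‖y - x‖⁻¹ • (u y - u x)) (‖y - x‖⁻¹ • (y - x))

/-- The potential per unit length `𝒲^ε(S, y - x)` of a bond of length `r = |y - x|`. -/
def bondPotential (ε : ℝ) (J f : ℝ → ℝ) (r S : ℝ) : ℝ :=
  1 / ε * J (r / ε) * (1 / r * f (r * S ^ 2))

/-- The force per unit length `∂_S 𝒲^ε(S, y - x)`. -/
def bondForce (ε : ℝ) (J f : ℝ → ℝ) (r S : ℝ) : ℝ :=
  deriv (fun s => bondPotential ε J f r s) S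

/-- `∇PD^ε(u)(x) = -(2 / (ε^d ω_d)) ∫_{|y - x| < ε} ∂_S 𝒲^ε(S, y - x) e dy`. -/
def gradPD {d : ℕ} (ε : ℝ) (J f : ℝ → ℝ) (u : Euc d → Euc d) (x : Euc d) : Euc d :=
  -((2 / (ε ^ d * unitBallVolume d)) •
    ∫ y in Metric.ball x ε,
      bondForce ε J f ‖y - x‖ (strain u y x) • (‖y - x‖⁻¹ • (y - x)))

/-- `L²(D; ℝ^d)`. -/
abbrev L2 {d : ℕ} (D : Set (Euc d)) : Type :=
  Lp (Euc d) 2 (volume.restrict D)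

/-- A displacement in `L²(D; ℝ^d)` as a function on `ℝ^d`, extended by zero outside `D`. -/
def zeroExt {d : ℕ} {D : Set (Euc d)} (u : L2 D) : Euc d → Euc d :=
  D.indicator u

/-- The constraint set `D_c`: the boundary layer of `D` of thickness `a`. -/
def constraintSet {d : ℕ} (D : Set (Euc d)) (a : ℝ) : Set (Euc d) :=
  {x ∈ D | Metric.infDist x Dᶜ ≤ a}

/-- The interior part `D_s = D \ D_c`. -/
def interiorSet {d : ℕ} (D : Set (Euc d)) (a : ℝ) : Set (Euc d) :=
  D \ constraintSet D a

/-- `L²₀(D; ℝ^d)`: the square integrable displacements that vanish on `D_c`. -/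
def L20 {d : ℕ} (D : Set (Euc d)) (a : ℝ) : Set (L2 D) :=
  {u | ∀ᵐ x ∂(volume.restrict (constraintSet D a)), u x = 0}

/-- `u ∈ C²([0,T]; L²₀(D; ℝ^d))` solves `ρ u_tt = -∇PD^ε(u) + b` in `D_s`, with `u = 0` in `D_c`
and the initial conditions `u(0) = u₀`, `u_t(0) = v₀`. -/
structure IsCohesiveEvolution {d : ℕ} (ε : ℝ) (J f : ℝ → ℝ) (D : Set (Euc d)) (a ρ T : ℝ)
    (b : ℝ → L2 D) (u₀ v₀ : L2 D) (u : ℝ → L2 D) : Prop where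
  contDiff : ContDiffOn ℝ 2 u (Icc 0 T)
  mem : ∀ t ∈ Icc 0 T, u t ∈ L20 D a
  initial : u 0 = u₀
  initial_velocity : derivWithin u (Icc 0 T) 0 = v₀
  motion : ∀ t ∈ Icc 0 T, ∀ᵐ x ∂(volume.restrict (interiorSet D a)),
    ρ • (iteratedDerivWithin 2 u (Icc 0 T) t) x = -gradPD ε J f (zeroExt (u t)) x + b t x

/-! ### Linear elastic fracture mechanics -/

/-- `u₀` has finite energy in the sense of linear elastic fracture mechanics, with bulk strain `E`
and crack set `K`: the symmetrized distributional gradient of `u₀` on `D` is the sum of the square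
integrable density `E` and of a part carried by a set `K` of finite `(d-1)`-dimensional Hausdorff
measure, contained up to a null set in countably many `C¹` hypersurfaces. For `u₀` in `SBD(D)` one
may take the jump set for `K`, and then `G = (u⁺ - u⁻) ⊙ ν`; if `u₀` is piecewise smooth, `K` is its
system of cracks and `E = (∇u₀ + ∇u₀ᵀ) / 2` off `K`. -/
structure IsLEFMDisplacement {d : ℕ} (D : Set (Euc d)) (u₀ : Euc d → Euc d)
    (E : Euc d → Matrix (Fin d) (Fin d) ℝ) (K : Set (Euc d)) : Prop where
  crack_subset : K ⊆ D
  crack_measurable : MeasurableSet K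
  crack_finite : μHE[d - 1] K < ⊤
  crack_rectifiable : ∃ φ : ℕ → Euc (d - 1) → Euc d,
    (∀ n, ContDiff ℝ 1 (φ n)) ∧ μHE[d - 1] (K \ ⋃ n, range (φ n)) = 0
  strain_memLp : ∀ i j, MemLp (fun x => E x i j) 2 (volume.restrict D)
  strain_eq : ∃ G : Euc d → Matrix (Fin d) (Fin d) ℝ,
    (∀ i j, Integrable (fun x => G x i j) (μHE[d - 1].restrict K)) ∧
    ∀ φ : Euc d → ℝ, ContDiff ℝ ∞ φ → HasCompactSupport φ → tsupport φ ⊆ D → ∀ i j,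
      -∫ x in D, (u₀ x i * fderiv ℝ φ x (EuclideanSpace.single j 1)
          + u₀ x j * fderiv ℝ φ x (EuclideanSpace.single i 1)) / 2
        = (∫ x in D, E x i j * φ x) + ∫ x in K, G x i j * φ x ∂μHE[d - 1]

/-- The calibrated shear and Lamé moduli `μ = λ`: `(1/4) f'(0) ∫₀¹ r² J(r) dr` for `d = 2` and
`(1/5) f'(0) ∫₀¹ r³ J(r) dr` for `d = 3`. -/
def lameModulus (d : ℕ) (f J : ℝ → ℝ) : ℝ :=
  1 / ((d : ℝ) + 2) * derivWithin f (Ici 0) 0 * ∫ r in (0 : ℝ)..1, r ^ d * J r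

/-- The calibrated critical energy release rate
`𝒢_c = (2 ω_{d-1} / ω_d) f_∞ ∫₀¹ r^d J(r) dr`. -/
def energyReleaseRate (d : ℕ) (finf : ℝ) (J : ℝ → ℝ) : ℝ :=
  2 * unitBallVolume (d - 1) / unitBallVolume d * finf * ∫ r in (0 : ℝ)..1, r ^ d * J r

/-- `LEFM = ∫_D (2μ |E|² + λ |tr E|²) dx + 𝒢_c |K|`. -/
def LEFM {d : ℕ} (f : ℝ → ℝ) (finf : ℝ) (J : ℝ → ℝ) (D : Set (Euc d))
    (E : Euc d → Matrix (Fin d) (Fin d) ℝ) (K : Set (Euc d)) : ℝ :=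
  (∫ x in D, (2 * lameModulus d f J * (∑ i, ∑ j, E x i j ^ 2)
      + lameModulus d f J * (E x).trace ^ 2))
    + energyReleaseRate d finf J * μHE[d - 1].real K

/-- `C(t) = ((2 LEFM(u₀) + ρ ‖v₀‖² + 1)^{1/2} + ρ^{-1/2} ∫₀ᵗ ‖b(τ)‖ dτ)² - 1`, where `lefm` is the
value of `LEFM(u₀)` and the norms are those of `L²(D; ℝ^d)`. -/
def energyBound {d : ℕ} {D : Set (Euc d)} (lefm ρ : ℝ) (v₀ : L2 D) (b : ℝ → L2 D) (t : ℝ) : ℝ :=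
  (√(2 * lefm + ρ * ‖v₀‖ ^ 2 + 1) + √(ρ⁻¹) * ∫ τ in (0 : ℝ)..t, ‖b τ‖) ^ 2 - 1

/-! ### The process zone -/

/-- The weighted volume fraction
`P(B) = (1 / (ε^d m)) ∫_B (|y - x| / ε) J(|y - x| / ε) dy` of a subset `B` of the ball of radius `ε`
about `x`. -/
def volumeFraction {d : ℕ} (ε : ℝ) (J : ℝ → ℝ) (x : Euc d) (B : Set (Euc d)) : ℝ :=
  1 / (ε ^ d * influenceMoment d J) * ∫ y in B, ‖y - x‖ / ε * J (‖y - x‖ / ε)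

/-- The process zone of the displacement `u` at a fixed time: the centers `x ∈ D` of neighborhoods
in which the weighted fraction of points `y` with `|S(y, x)| > k |y - x|^{α - 1}` exceeds `θ`. -/
def processZone {d : ℕ} (ε : ℝ) (J : ℝ → ℝ) (D : Set (Euc d)) (k α θ : ℝ)
    (u : Euc d → Euc d) : Set (Euc d) :=
  {x ∈ D | θ < volumeFraction ε J x
    {y ∈ Metric.ball x ε | k * ‖y - x‖ ^ (α - 1) < |strain u y x|}}

end CohesiveDynamics

end

/-! The bound is a Chebyshev inequality for the peridynamic energy, combined with an energy balance
in time and a comparison of the initial energy with the fracture energy. The energy used is `1 / (ε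
^ (d + 1) * ω_d)` times the integral of `J(|ξ|/ε) f(|ξ| S²)` over all pairs of a bond vector `ξ` and
a base point `x`.

Chebyshev (`mul_volume_processZone_le`). A bond of length `r < ε` with `|S| > k r ^ (α - 1)` has `r
S² ≥ k² r ^ β`. Since `f` increases, `f(s)/s` decreases and `β ≤ 1`, it follows that `f(r S²) ≥
(r/ε) ^ β f(k² ε ^ β) ≥ (r/ε) f(k² ε ^ β)`. The factor `r/ε` times `J(r/ε)` is exactly the weight in
`P`, so at a point of the process zone the unnormalized energy density is at least `θ ε ^ d m f(k² ε
^ β)`.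

Energy in time (`two_mul_bondEnergy_le_energyBound`). The energy is Fréchet differentiable on `L²`
and `gradPD` represents its derivative, because reversing a bond preserves the measure on bonds.
Testing the equation of motion with the velocity gives the power balance, and an estimate for the
square root of the total energy gives `2 PD(t) ≤ C(t)`, provided that the initial energy is at most
`LEFM(u₀)`.

Initial energy (`rawEnergy_le_LEFM`). Concavity gives both `f(s) ≤ f'(0) s` and `f(s) ≤ f_∞`. For
fixed `ξ`, if the segment from `x` to `x + ξ` misses the crack, then `(u₀(x + ξ) - u₀(x)) · ξ` is
the integral of `E ξ · ξ` along it (`ae_difference_eq`, `exists_bulk_strain`). The linear bound,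
Jensen's inequality and the fourth moments of the sphere then produce the bulk term with its Lamé
moduli. If the segment meets the crack, the constant bound is used; the volume of such `x`, averaged
over `ξ`, is controlled by a Crofton-type inequality (`lintegral_volume_sweep_le`), whose constant
is the one in `𝒢_c`. None of this involves a limit, so it holds for each fixed `ε`. -/

noncomputable section

namespace CohesiveDynamics

/-! ### The potential function -/

namespace IsCohesivePotential

variable {f : ℝ → ℝ} {finf : ℝ}

theorem continuousOn (hf : IsCohesivePotential f finf) : ContinuousOn f (Ici 0) :=
  hf.smooth.continuousOn

theorem differentiableOn (hf : IsCohesivePotential f finf) : DifferentiableOn ℝ f (Ici 0) :=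
  hf.smooth.differentiableOn (by simp)

/-- Since `f(r)/r` has a finite limit, `f(r) = r (f(r)/r)` tends to zero, and continuity at the
endpoint identifies this limit with the value. -/
theorem map_zero (hf : IsCohesivePotential f finf) : f 0 = 0 := by
  have h1 : Tendsto f (𝓝[>] 0) (𝓝 (f 0)) :=
    ((hf.continuousOn 0 self_mem_Ici).mono Ioi_subset_Ici_self)
  have h2 : Tendsto (fun r => r * (f r / r)) (𝓝[>] 0)
      (𝓝 (0 * derivWithin f (Ici 0) 0)) :=
    (tendsto_nhdsWithin_of_tendsto_nhds tendsto_id).mul hf.slope_tendsto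
  rw [zero_mul] at h2
  refine tendsto_nhds_unique h1 (h2.congr' ?_)
  filter_upwards [self_mem_nhdsWithin] with r hr
  exact mul_div_cancel₀ _ (ne_of_gt hr)

theorem nonneg (hf : IsCohesivePotential f finf) {s : ℝ} (hs : 0 ≤ s) : 0 ≤ f s := by
  rcases hs.eq_or_lt with rfl | hs
  · exact hf.map_zero.ge
  · exact (hf.pos s hs).le

/-- A concave function that decreases once stays below a line of negative slope from there on, and
so would become negative. -/
theorem monotoneOn (hf : IsCohesivePotential f finf) : MonotoneOn f (Ici 0) := by
  intro s hs t ht hst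
  by_contra! hlt
  have hst' : s < t := lt_of_le_of_ne hst (by rintro rfl; exact lt_irrefl _ hlt)
  set c := slope f s t with hc
  have hc0 : c < 0 := by
    rw [hc, slope_def_field]
    exact div_neg_of_neg_of_pos (by linarith) (by linarith)
  have hlim : Tendsto (fun y => f s + c * (y - s)) atTop atBot := by
    refine tendsto_atBot_add_const_left _ _ ?_
    exact (tendsto_atTop_add_const_right _ (-s) tendsto_id).const_mul_atTop_of_neg hc0
  obtain ⟨y, hy1, hy2⟩ := ((hlim.eventually_lt_atBot 0).and (eventually_gt_atTop t)).exists
  have hys : s < y := hst'.trans hy2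
  have hs0 : (0 : ℝ) ≤ s := hs
  have h1 : slope f s y ≤ c :=
    hf.concave.antitoneOn_slope_gt hs ⟨ht, hst'⟩ ⟨mem_Ici.2 (hs0.trans hys.le), hys⟩ hy2.le
  rw [slope_def_field, div_le_iff₀ (by linarith)] at h1
  have := hf.nonneg (hs0.trans hys.le)
  linarith

theorem le_finf (hf : IsCohesivePotential f finf) {s : ℝ} (hs : 0 ≤ s) : f s ≤ finf := by
  refine ge_of_tendsto hf.tendsto_top ?_
  filter_upwards [eventually_ge_atTop s] with t ht
  exact hf.monotoneOn hs (mem_Ici.2 (hs.trans ht)) ht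

theorem finf_nonneg (hf : IsCohesivePotential f finf) : 0 ≤ finf :=
  (hf.nonneg le_rfl).trans (hf.le_finf le_rfl)

/-- `f(s)/s` is nonincreasing. -/
theorem mul_le_mul (hf : IsCohesivePotential f finf) {s t : ℝ} (hs : 0 ≤ s) (hst : s ≤ t) :
    s * f t ≤ t * f s := by
  rcases hs.eq_or_lt with rfl | hs
  · simp [hf.map_zero]
  have h := hf.concave.antitoneOn_slope_gt (self_mem_Ici (a := (0 : ℝ)))
    ⟨mem_Ici.2 hs.le, hs⟩ ⟨mem_Ici.2 (hs.le.trans hst), hs.trans_le hst⟩ hst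
  rw [slope_def_field, slope_def_field, hf.map_zero, sub_zero, sub_zero, sub_zero, sub_zero,
    div_le_div_iff₀ (hs.trans_le hst) hs] at h
  linarith

theorem le_mul (hf : IsCohesivePotential f finf) {s : ℝ} (hs : 0 ≤ s) :
    f s ≤ derivWithin f (Ici 0) 0 * s := by
  rcases hs.eq_or_lt with rfl | hs
  · simp [hf.map_zero]
  have h := hf.concave.slope_le_derivWithin (self_mem_Ici (a := (0 : ℝ)))
    (mem_Ici.2 hs.le) hs (hf.differentiableOn 0 self_mem_Ici)
  rwa [slope_def_field, hf.map_zero, sub_zero, sub_zero, div_le_iff₀ hs] at h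

/-- With `f(0) = 0`, the chord from the origin is at least as steep as the tangent at its far end.
Together with `f ≤ finf` this makes `s f'(s)` bounded, which is the source of the uniform force
bounds below. -/
theorem derivWithin_mul_le (hf : IsCohesivePotential f finf) {s : ℝ} (hs : 0 ≤ s) :
    derivWithin f (Ici 0) s * s ≤ f s := by
  rcases hs.eq_or_lt with rfl | hs
  · simp [hf.map_zero]
  have h := hf.concave.derivWithin_le_slope (self_mem_Ici (a := (0 : ℝ)))
    (mem_Ici.2 hs.le) hs (hf.differentiableOn s (mem_Ici.2 hs.le))
  rwa [slope_def_field, hf.map_zero, sub_zero, sub_zero, le_div_iff₀ hs] at h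

theorem derivWithin_nonneg (hf : IsCohesivePotential f finf) {s : ℝ} (hs : 0 ≤ s) :
    0 ≤ derivWithin f (Ici 0) s := by
  have h := hf.concave.slope_le_derivWithin (S := Ici 0) (x := s) (y := s + 1) hs
    (mem_Ici.2 (by linarith)) (by linarith) (hf.differentiableOn s hs)
  rw [slope_def_field] at h
  refine le_trans (div_nonneg (sub_nonneg.2 ?_) (by linarith)) h
  exact hf.monotoneOn hs (mem_Ici.2 (by linarith)) (by linarith)

theorem continuousOn_derivWithin (hf : IsCohesivePotential f finf) :
    ContinuousOn (derivWithin f (Ici 0)) (Ici 0) :=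
  hf.smooth.continuousOn_derivWithin (uniqueDiffOn_Ici 0) (by simp)

/-- The difference quotient of `f` at `0` deviates from `f'(0)` by `O(s)`. -/
theorem slope_sub_isBigO (hf : IsCohesivePotential f finf) :
    (fun s => f s / s - derivWithin f (Ici 0) 0) =O[𝓝[>] 0] (fun s : ℝ => s) := by
  have hd : DifferentiableWithinAt ℝ (derivWithin f (Ici 0)) (Ici 0) 0 := by
    have h2 : ContDiffOn ℝ 1 (derivWithin f (Ici 0)) (Ici 0) :=
      hf.smooth.derivWithin (uniqueDiffOn_Ici 0) (by norm_cast)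
    exact h2.differentiableOn (by simp) 0 self_mem_Ici
  have h3 := (hd.hasFDerivWithinAt.isBigO_sub).mono
    (nhdsWithin_mono (0 : ℝ) Ioi_subset_Ici_self)
  simp only [sub_zero] at h3
  -- By concavity `f'(s) ≤ f(s)/s ≤ f'(0)`, so the deviation is dominated by `f'(s) - f'(0)`, which
  -- is `O(s)` because `f'` is differentiable at `0`.
  refine Asymptotics.IsBigO.trans (Asymptotics.IsBigO.of_bound 1 ?_) h3
  filter_upwards [self_mem_nhdsWithin] with s hs
  have hs : 0 < s := hs
  have h4 := hf.derivWithin_mul_le hs.le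
  have h5 := hf.le_mul hs.le
  rw [← le_div_iff₀ hs] at h4
  rw [← div_le_iff₀ hs] at h5
  rw [one_mul, Real.norm_eq_abs, Real.norm_eq_abs, abs_of_nonpos (by linarith),
    abs_of_nonpos (by linarith)]
  linarith

/-- The derivative of `p ↦ f(p²)`. -/
theorem hasDerivAt_comp_sq (hf : IsCohesivePotential f finf) (p : ℝ) :
    HasDerivAt (fun p => f (p ^ 2)) (2 * p * derivWithin f (Ici 0) (p ^ 2)) p := by
  -- Only one-sided regularity of `f` is available at `0`, but squares never leave `[0, ∞)`, so the
  -- composition is differentiable on the whole line.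
  have h1 : HasDerivWithinAt f (derivWithin f (Ici 0) (p ^ 2)) (Ici 0) (p ^ 2) :=
    (hf.differentiableOn _ (mem_Ici.2 (sq_nonneg p))).hasDerivWithinAt
  have h2 : HasDerivWithinAt (fun p : ℝ => p ^ 2) (2 * p) univ p := by
    have := hasDerivAt_pow 2 p
    simp only [Nat.cast_ofNat, Nat.add_one_sub_one, pow_one] at this
    exact this.hasDerivWithinAt
  have h3 := HasDerivWithinAt.comp (h₂ := f) (h := fun p => p ^ 2) p h1 h2
    (fun q _ => mem_Ici.2 (sq_nonneg q))
  rw [hasDerivWithinAt_univ] at h3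
  exact h3.congr_deriv (mul_comm _ _)

theorem continuous_comp_sq (hf : IsCohesivePotential f finf) :
    Continuous (fun p => f (p ^ 2)) :=
  hf.continuousOn.comp_continuous (by fun_prop) fun p => mem_Ici.2 (sq_nonneg p)

theorem continuous_deriv_comp_sq (hf : IsCohesivePotential f finf) :
    Continuous (fun p : ℝ => 2 * p * derivWithin f (Ici 0) (p ^ 2)) :=
  (by fun_prop : Continuous fun p : ℝ => 2 * p).mul
    (hf.continuousOn_derivWithin.comp_continuous (by fun_prop) fun p => mem_Ici.2 (sq_nonneg p))

/-- From `s f'(s) ≤ finf` at `s = p²`, the derivative is at most `2 finf / |p|`. This decay makes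
the bond force uniformly continuous, which is what the uniform remainder estimate needs. -/
theorem tendsto_deriv_comp_sq (hf : IsCohesivePotential f finf) :
    Tendsto (fun p : ℝ => 2 * p * derivWithin f (Ici 0) (p ^ 2)) (cocompact ℝ) (𝓝 0) := by
  have hb : ∀ᶠ p : ℝ in cocompact ℝ,
      ‖2 * p * derivWithin f (Ici 0) (p ^ 2)‖ ≤ (2 * finf) * ‖p‖⁻¹ := by
    have : ∀ᶠ p : ℝ in cocompact ℝ, 0 < ‖p‖ :=
      tendsto_norm_cocompact_atTop.eventually_gt_atTop 0
    filter_upwards [this] with p hp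
    have h1 := hf.derivWithin_mul_le (sq_nonneg p)
    have h2 := hf.le_finf (sq_nonneg p)
    have h3 := hf.derivWithin_nonneg (sq_nonneg p)
    rw [← div_eq_mul_inv, le_div_iff₀ hp, norm_mul, norm_mul, Real.norm_of_nonneg h3,
      Real.norm_two, Real.norm_eq_abs]
    calc 2 * |p| * derivWithin f (Ici 0) (p ^ 2) * |p|
        = 2 * (derivWithin f (Ici 0) (p ^ 2) * |p| ^ 2) := by ring
      _ ≤ 2 * finf := by rw [sq_abs]; linarith
  refine squeeze_zero_norm' hb ?_
  rw [← mul_zero (2 * finf)]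
  exact (tendsto_inv_atTop_zero.comp tendsto_norm_cocompact_atTop).const_mul _

/-- Use `|p| ≤ 1 + p²`: the first summand is controlled by `f'(p²) ≤ f'(0)`, the second by `p²
f'(p²) ≤ finf`. -/
theorem exists_deriv_comp_sq_le (hf : IsCohesivePotential f finf) :
    ∃ M : ℝ, 0 ≤ M ∧ ∀ p : ℝ, |2 * p * derivWithin f (Ici 0) (p ^ 2)| ≤ M := by
  refine ⟨2 * (derivWithin f (Ici 0) 0 + finf), ?_, fun p => ?_⟩
  · have := hf.slope_pos.le
    have := hf.finf_nonneg
    positivity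
  have h1 := hf.derivWithin_mul_le (sq_nonneg p)
  have h2 := hf.le_finf (sq_nonneg p)
  have h3 := hf.derivWithin_nonneg (sq_nonneg p)
  have h4 : derivWithin f (Ici 0) (p ^ 2) ≤ derivWithin f (Ici 0) 0 :=
    hf.concave.antitoneOn_derivWithin hf.differentiableOn self_mem_Ici
      (mem_Ici.2 (sq_nonneg p)) (sq_nonneg p)
  rw [abs_mul, abs_mul, abs_of_nonneg h3, abs_two]
  have h5 : |p| ≤ 1 + p ^ 2 := by nlinarith [sq_abs p, sq_nonneg (|p| - 1), abs_nonneg p]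
  have h6 := mul_le_mul_of_nonneg_right h5 h3
  nlinarith

/-- First-order expansion of `p ↦ f(p²)` with a remainder uniform in `p`. -/
theorem exists_remainder_le (hf : IsCohesivePotential f finf) {η : ℝ} (hη : 0 < η) :
    ∃ C : ℝ, 0 ≤ C ∧ ∀ p q : ℝ,
      |f ((p + q) ^ 2) - f (p ^ 2) - 2 * p * derivWithin f (Ici 0) (p ^ 2) * q|
        ≤ η * |q| + C * q ^ 2 := by
  obtain ⟨M, hM0, hM⟩ := hf.exists_deriv_comp_sq_le
  set g : ℝ → ℝ := fun p => 2 * p * derivWithin f (Ici 0) (p ^ 2) with hg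
  have huc : UniformContinuous g :=
    hf.continuous_deriv_comp_sq.uniformContinuous_of_tendsto_cocompact hf.tendsto_deriv_comp_sq
  obtain ⟨δ, hδ, hδ'⟩ := Metric.uniformContinuous_iff.1 huc η hη
  refine ⟨2 * M / δ, by positivity, fun p q => ?_⟩
  rcases eq_or_ne q 0 with rfl | hq
  · simp
  have key : ∀ B : ℝ, (∀ x : ℝ, |x - p| ≤ |q| → |g x - g p| ≤ B) →
      |f ((p + q) ^ 2) - f (p ^ 2) - g p * q| ≤ B * |q| := by
    intro B hB
    have hd : ∀ x ∈ Metric.closedBall p |q|, HasDerivWithinAt (fun x => f (x ^ 2) - g p * x)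
        (g x - g p) (Metric.closedBall p |q|) x := by
      intro x _
      have h1 := (hf.hasDerivAt_comp_sq x).sub ((hasDerivAt_id x).const_mul (g p))
      rw [mul_one] at h1
      exact h1.hasDerivWithinAt
    have h := (convex_closedBall p |q|).norm_image_sub_le_of_norm_hasDerivWithin_le (C := B) hd
      (fun x hx => hB x (by simpa [Real.dist_eq] using hx))
      (Metric.mem_closedBall_self (abs_nonneg q)) (y := p + q) (by simp)
    simp only [Real.norm_eq_abs, add_sub_cancel_left] at h
    convert h using 2
    ring
  -- Small increments are handled by uniform continuity of the derivative. For large ones the bound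
  -- `2M` on its oscillation suffices, since `|q| ≤ q²/δ`.
  rcases lt_or_ge |q| δ with hlt | hge
  · refine (key η fun x hx => ?_).trans ?_
    · have := hδ' (a := x) (b := p) (by rw [Real.dist_eq]; exact hx.trans_lt hlt)
      rw [Real.dist_eq] at this
      exact this.le
    · have : 0 ≤ 2 * M / δ * q ^ 2 := by positivity
      linarith
  · refine (key (2 * M) fun x _ => ?_).trans ?_
    · have := abs_sub (g x) (g p)
      have := hM x
      have := hM p
      linarith
    · have h1 : 2 * M * |q| ≤ 2 * M / δ * q ^ 2 := by
        rw [← sq_abs, div_mul_eq_mul_div, le_div_iff₀ hδ, sq, mul_assoc]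
        gcongr
      have : 0 ≤ η * |q| := by positivity
      linarith

end IsCohesivePotential

/-- The deviation of `f(s)/s` from `f'(0)` at `s = k² ε^β`. -/
theorem exists_slope_deviation {f : ℝ → ℝ} {finf : ℝ} (hf : IsCohesivePotential f finf)
    {k β : ℝ} (hk : 0 < k) (hβ : 0 ≤ β) :
    ∃ r : ℝ → ℝ,
      (∀ ε, 0 < ε →
        f (k ^ 2 * ε ^ β) = k ^ 2 * ε ^ β * (derivWithin f (Ici 0) 0 + r ε) ∧
        0 < derivWithin f (Ici 0) 0 + r ε) ∧
      r =O[𝓝[>] 0] (fun ε : ℝ => ε ^ β) := by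
  refine ⟨fun ε => f (k ^ 2 * ε ^ β) / (k ^ 2 * ε ^ β) - derivWithin f (Ici 0) 0,
    fun ε hε => ?_, ?_⟩
  · have hs : 0 < k ^ 2 * ε ^ β := by positivity
    rw [add_sub_cancel]
    exact ⟨(mul_div_cancel₀ _ hs.ne').symm, div_pos (hf.pos _ hs) hs⟩
  -- For `β = 0` the deviation is constant in `ε` and `O(ε ^ β)` only means boundedness. For `β > 0`
  -- the argument `k² ε ^ β` tends to `0` and the expansion of `f` at `0` applies.
  · rcases hβ.eq_or_lt with rfl | hβ
    · simp only [Real.rpow_zero]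
      exact Asymptotics.isBigO_const_const _ one_ne_zero _
    · have ht : Tendsto (fun ε : ℝ => k ^ 2 * ε ^ β) (𝓝[>] 0) (𝓝[>] 0) := by
        refine tendsto_nhdsWithin_iff.2 ⟨?_, ?_⟩
        · have h1 : Tendsto (fun ε : ℝ => k ^ 2 * ε ^ β) (𝓝 0) (𝓝 (k ^ 2 * (0 : ℝ) ^ β)) :=
            ((Real.continuousAt_rpow_const 0 β (Or.inr hβ.le)).tendsto).const_mul _
          rw [Real.zero_rpow hβ.ne', mul_zero] at h1
          exact tendsto_nhdsWithin_of_tendsto_nhds h1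
        · filter_upwards [self_mem_nhdsWithin] with ε hε
          have : 0 < ε := hε
          exact mem_Ioi.2 (by positivity)
      have h := hf.slope_sub_isBigO.comp_tendsto ht
      exact h.trans (Asymptotics.isBigO_const_mul_self _ _ _)

/-! ### Moments of the unit sphere -/

section Polar

variable {E : Type*} [NormedAddCommGroup E] [NormedSpace ℝ E] [FiniteDimensional ℝ E]
  [MeasurableSpace E] [BorelSpace E] [Nontrivial E]

/-- Polar coordinates for the product of a radial and a homogeneous function. -/
theorem lintegral_radial_mul_homogeneous (μ : Measure E) [μ.IsAddHaarMeasure]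
    {g : ℝ → ℝ≥0∞} (hg : Measurable g) {q : E → ℝ≥0∞} (hq : Measurable q) {p : ℕ}
    (hqp : ∀ r : ℝ, 0 < r → ∀ x, q (r • x) = ENNReal.ofReal (r ^ p) * q x) :
    ∫⁻ x, g ‖x‖ * q x ∂μ = (∫⁻ s, q s ∂μ.toSphere) *
      ∫⁻ r in Ioi (0 : ℝ), ENNReal.ofReal (r ^ (Module.finrank ℝ E - 1 + p)) * g r := by
  have h1 : ∫⁻ x, g ‖x‖ * q x ∂μ = ∫⁻ x : ({(0 : E)}ᶜ : Set E), g ‖x.1‖ * q x.1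
      ∂(μ.comap Subtype.val) := by
    rw [lintegral_subtype_comap (measurableSet_singleton (0 : E)).compl (fun x => g ‖x‖ * q x),
      restrict_compl_singleton]
  have h2 : ∫⁻ x : ({(0 : E)}ᶜ : Set E), g ‖x.1‖ * q x.1 ∂(μ.comap Subtype.val)
      = ∫⁻ z : Metric.sphere (0 : E) 1 × Ioi (0 : ℝ),
          q z.1.1 * (ENNReal.ofReal (z.2.1 ^ p) * g z.2.1)
          ∂μ.toSphere.prod (Measure.volumeIoiPow (Module.finrank ℝ E - 1)) := by
    rw [← μ.measurePreserving_homeomorphUnitSphereProd.lintegral_comp_emb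
      (Homeomorph.measurableEmbedding _)]
    refine lintegral_congr fun x => ?_
    have hx : 0 < ‖x.1‖ := norm_pos_iff.2 x.2
    simp only [homeomorphUnitSphereProd_apply_snd_coe, homeomorphUnitSphereProd_apply_fst_coe]
    rw [← mul_assoc, mul_comm (q _), ← hqp _ hx, smul_inv_smul₀ hx.ne', mul_comm]
  rw [h1, h2, lintegral_prod_mul (f := fun s : Metric.sphere (0 : E) 1 => q s.1)
    (g := fun r : Ioi (0 : ℝ) => ENNReal.ofReal (r.1 ^ p) * g r.1)
    (hq.comp measurable_subtype_coe).aemeasurable (by fun_prop)]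
  congr 1
  rw [Measure.volumeIoiPow, lintegral_withDensity_eq_lintegral_mul _ (by fun_prop) (by fun_prop),
    ← lintegral_subtype_comap measurableSet_Ioi]
  refine lintegral_congr fun r => ?_
  have hr : (0 : ℝ) < r.1 := r.2
  rw [Pi.mul_apply, ← mul_assoc, ← ENNReal.ofReal_mul (by positivity), pow_add]

end Polar

/-! Gaussian moments with weight `exp(-π x²)`. -/

theorem integral_Ioi_pow_mul_gaussian (n : ℕ) :
    ∫ r in Ioi (0 : ℝ), r ^ n * Real.exp (-Real.pi * r ^ 2) =
      Real.pi ^ (-((n : ℝ) + 1) / 2) * (1 / 2) * Real.Gamma (((n : ℝ) + 1) / 2) := by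
  have h := integral_rpow_mul_exp_neg_mul_rpow (p := 2) (q := n) (b := Real.pi) two_pos
    (by have : (0 : ℝ) ≤ n := n.cast_nonneg
        linarith) Real.pi_pos
  simpa using h

theorem integrable_pow_mul_gaussian (n : ℕ) :
    Integrable (fun x : ℝ => x ^ n * Real.exp (-Real.pi * x ^ 2)) := by
  have h := integrable_rpow_mul_exp_neg_mul_sq Real.pi_pos (s := n)
    (by have : (0 : ℝ) ≤ n := n.cast_nonneg
        linarith)
  simpa using h

theorem integral_abs_mul_gaussian :
    ∫ x : ℝ, |x| * Real.exp (-Real.pi * x ^ 2) = 1 / Real.pi := by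
  have h := integral_comp_abs (f := fun x => x * Real.exp (-Real.pi * x ^ 2))
  simp only [sq_abs] at h
  have h1 := integral_Ioi_pow_mul_gaussian 1
  simp only [pow_one] at h1
  rw [h, h1]
  norm_num
  rw [Real.rpow_neg_one]
  ring

theorem integral_even_pow_mul_gaussian (n : ℕ) :
    ∫ x : ℝ, x ^ (2 * n) * Real.exp (-Real.pi * x ^ 2) =
      Real.pi ^ (-((2 * n : ℕ) + 1 : ℝ) / 2) * Real.Gamma (((2 * n : ℕ) + 1 : ℝ) / 2) := by
  have h := integral_comp_abs (f := fun x => x ^ (2 * n) * Real.exp (-Real.pi * x ^ 2))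
  simp only [sq_abs, pow_mul] at h
  simp only [← pow_mul] at h
  rw [h, integral_Ioi_pow_mul_gaussian]
  ring

theorem integral_odd_pow_mul_gaussian {n : ℕ} (hn : Odd n) :
    ∫ x : ℝ, x ^ n * Real.exp (-Real.pi * x ^ 2) = 0 := by
  have h := integral_neg_eq_self (fun x : ℝ => x ^ n * Real.exp (-Real.pi * x ^ 2)) volume
  simp only [hn.neg_pow, even_two.neg_pow, neg_mul, integral_neg] at h
  simp only [neg_mul]
  linarith

/-- The moments `E[Z^n]`, `n ≤ 4`, of a standard Gaussian. -/
def gaussMoment (n : ℕ) : ℕ :=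
  if n = 0 then 1 else if n = 2 then 1 else if n = 4 then 3 else 0

/-- The weight `exp(-π x²)` is already normalized and is the centered Gaussian density of variance
`1 / (2π)`, hence the powers of the standard deviation. -/
theorem integral_pow_mul_gaussian {n : ℕ} (hn : n ≤ 4) :
    ∫ x : ℝ, x ^ n * Real.exp (-Real.pi * x ^ 2) =
      √((2 * Real.pi)⁻¹) ^ n * gaussMoment n := by
  have hpi := Real.pi_pos
  have hs : √((2 * Real.pi)⁻¹) ^ 2 = (2 * Real.pi)⁻¹ := Real.sq_sqrt (by positivity)
  have hG : Real.Gamma (1 / 2) = √Real.pi := Real.Gamma_one_half_eq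
  have hP : Real.pi ^ (-(1 / 2) : ℝ) = (√Real.pi)⁻¹ := by
    rw [Real.rpow_neg hpi.le, Real.sqrt_eq_rpow]
  have hq : √Real.pi ≠ 0 := by positivity
  interval_cases n
  · have h := integral_even_pow_mul_gaussian 0
    simp only [mul_zero, Nat.cast_zero, zero_add, neg_div, hP, hG] at h
    rw [h, inv_mul_cancel₀ hq]
    simp [gaussMoment]
  · rw [integral_odd_pow_mul_gaussian (by decide)]
    simp [gaussMoment]
  · have h := integral_even_pow_mul_gaussian 1
    have e1 : (-((2 * 1 : ℕ) + 1 : ℝ) / 2) = -(1 / 2) + (-1) := by norm_num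
    have e2 : (((2 * 1 : ℕ) + 1 : ℝ) / 2) = 1 / 2 + 1 := by norm_num
    rw [e1, e2, Real.rpow_add hpi, Real.rpow_neg_one, hP, Real.Gamma_add_one (by norm_num), hG] at h
    rw [show (2 : ℕ) = 2 * 1 from rfl, h, show 2 * 1 = 2 from rfl, hs]
    simp only [gaussMoment]
    field_simp
    norm_num
  · rw [integral_odd_pow_mul_gaussian (by decide)]
    simp [gaussMoment]
  · have h := integral_even_pow_mul_gaussian 2
    have e1 : (-((2 * 2 : ℕ) + 1 : ℝ) / 2) = -(1 / 2) + (-1) + (-1) := by norm_num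
    have e2 : (((2 * 2 : ℕ) + 1 : ℝ) / 2) = 1 / 2 + 1 + 1 := by norm_num
    rw [e1, e2, Real.rpow_add hpi, Real.rpow_add hpi, Real.rpow_neg_one, hP,
      Real.Gamma_add_one (by norm_num), Real.Gamma_add_one (by norm_num), hG] at h
    rw [show (4 : ℕ) = 2 * 2 from rfl, h, pow_mul, hs]
    simp only [gaussMoment]
    field_simp
    norm_num

/-- The Gaussian integral of a product of functions of the coordinates. -/
theorem integral_prod_mul_gaussian {d : ℕ} (g : Fin d → ℝ → ℝ) :
    ∫ x : Euc d, (∏ i, g i (x i)) * Real.exp (-Real.pi * ‖x‖ ^ 2) =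
      ∏ i, ∫ t : ℝ, g i t * Real.exp (-Real.pi * t ^ 2) := by
  rw [← integral_fintype_prod_volume_eq_prod (fun i t => g i t * Real.exp (-Real.pi * t ^ 2)),
    ← (PiLp.volume_preserving_toLp (Fin d)).integral_comp
      (MeasurableEquiv.toLp 2 (Fin d → ℝ)).measurableEmbedding]
  refine integral_congr_ae (Eventually.of_forall fun x => ?_)
  simp only [EuclideanSpace.norm_sq_eq, Real.norm_eq_abs, sq_abs, Finset.prod_mul_distrib,
    ← Real.exp_sum, Finset.mul_sum]

theorem integrable_prod_mul_gaussian {d : ℕ} {g : Fin d → ℝ → ℝ}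
    (hg : ∀ i, Integrable (fun t : ℝ => g i t * Real.exp (-Real.pi * t ^ 2))) :
    Integrable (fun x : Euc d => (∏ i, g i (x i)) * Real.exp (-Real.pi * ‖x‖ ^ 2)) := by
  rw [← (PiLp.volume_preserving_toLp (Fin d)).integrable_comp_emb
      (MeasurableEquiv.toLp 2 (Fin d → ℝ)).measurableEmbedding]
  refine (Integrable.fintype_prod hg).congr (Eventually.of_forall fun x => ?_)
  simp only [Function.comp_apply, EuclideanSpace.norm_sq_eq, Real.norm_eq_abs, sq_abs,
    Finset.prod_mul_distrib, ← Real.exp_sum, Finset.mul_sum]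

theorem lintegral_Ioi_pow_mul_gaussian (n : ℕ) :
    ∫⁻ r in Ioi (0 : ℝ), ENNReal.ofReal (r ^ n) *
        ENNReal.ofReal (Real.exp (-Real.pi * r ^ 2)) =
      ENNReal.ofReal (Real.pi ^ (-((n : ℝ) + 1) / 2) * (1 / 2) *
        Real.Gamma (((n : ℝ) + 1) / 2)) := by
  rw [← integral_Ioi_pow_mul_gaussian, ofReal_integral_eq_lintegral_ofReal
    (integrable_pow_mul_gaussian n).integrableOn]
  · refine setLIntegral_congr_fun measurableSet_Ioi fun r hr => ?_
    have : (0 : ℝ) < r := hr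
    exact (ENNReal.ofReal_mul (by positivity)).symm
  · filter_upwards [ae_restrict_mem measurableSet_Ioi] with r hr
    have : (0 : ℝ) < r := hr
    show (0 : ℝ) ≤ _
    positivity

theorem unitBallVolume_eq (n : ℕ) :
    unitBallVolume n = √Real.pi ^ n / Real.Gamma (n / 2 + 1) := by
  rw [unitBallVolume, Measure.real]
  rcases n.eq_zero_or_pos with rfl | hn
  · simp [volume_euclideanSpace_eq_dirac]
  have : Nonempty (Fin n) := ⟨⟨0, hn⟩⟩
  have hG : 0 < Real.Gamma ((n : ℝ) / 2 + 1) := Real.Gamma_pos_of_pos (by positivity)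
  rw [EuclideanSpace.volume_ball, ENNReal.ofReal_one, one_pow, one_mul, Fintype.card_fin,
    ENNReal.toReal_ofReal (by positivity)]

theorem unitBallVolume_pos (n : ℕ) : 0 < unitBallVolume n := by
  have hG : 0 < Real.Gamma ((n : ℝ) / 2 + 1) := Real.Gamma_pos_of_pos (by positivity)
  rw [unitBallVolume_eq]
  positivity

theorem ENNReal_eq_ofReal_of_mul {a : ℝ≥0∞} {b c : ℝ} (hb : 0 ≤ b) (hc : 0 < c)
    (h : ENNReal.ofReal (b * c) = a * ENNReal.ofReal c) : a = ENNReal.ofReal b := by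
  rw [ENNReal.ofReal_mul hb] at h
  exact ((ENNReal.mul_left_inj (ENNReal.ofReal_pos.2 hc).ne' ENNReal.ofReal_ne_top).1 h).symm

/-- The Gaussian is rotation invariant, so in an orthonormal basis containing `N / ‖N‖` the integral
factors into a one-dimensional absolute moment and trivial factors. -/
theorem integral_abs_inner_mul_gaussian {d : ℕ} (N : Euc d) :
    Integrable (fun x : Euc d => |inner ℝ N x| * Real.exp (-Real.pi * ‖x‖ ^ 2)) ∧
    ∫ x : Euc d, |inner ℝ N x| * Real.exp (-Real.pi * ‖x‖ ^ 2) = ‖N‖ / Real.pi := by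
  rcases eq_or_ne N 0 with rfl | hN
  · simp
  have hd : 0 < d := by
    rcases d.eq_zero_or_pos with rfl | hd
    · exact absurd (Subsingleton.elim N 0) hN
    · exact hd
  set i₀ : Fin d := ⟨0, hd⟩
  have hN' : 0 < ‖N‖ := norm_pos_iff.2 hN
  obtain ⟨b, hb⟩ := Orthonormal.exists_orthonormalBasis_extension_of_card_eq (𝕜 := ℝ)
    (E := Euc d) (ι := Fin d) (by simp) (v := fun _ => ‖N‖⁻¹ • N) (s := {i₀}) (by
      refine ⟨fun i => ?_, fun i j hij => absurd (Subsingleton.elim i j) hij⟩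
      show ‖‖N‖⁻¹ • N‖ = 1
      rw [norm_smul, norm_inv, norm_norm, inv_mul_cancel₀ hN'.ne'])
  have hb0 : b i₀ = ‖N‖⁻¹ • N := hb i₀ rfl
  set g : Fin d → ℝ → ℝ := fun i t => if i = i₀ then |t| else 1 with hg
  have hprod : ∀ x : Euc d, ∏ i, g i (x i) = |x i₀| := by
    intro x
    rw [Finset.prod_eq_single i₀] <;> simp +contextual [hg]
  have hcomp : ∀ x : Euc d, |inner ℝ N x| * Real.exp (-Real.pi * ‖x‖ ^ 2) =
      ‖N‖ * ((fun y : Euc d => (∏ i, g i (y i)) * Real.exp (-Real.pi * ‖y‖ ^ 2)) (b.repr x)) := by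
    intro x
    show _ = ‖N‖ * ((∏ i, g i (b.repr x i)) * Real.exp (-Real.pi * ‖b.repr x‖ ^ 2))
    rw [hprod, b.repr_apply_apply, hb0, real_inner_smul_left, LinearIsometryEquiv.norm_map,
      abs_mul, abs_inv, abs_norm]
    field_simp
  have hint : ∀ i, Integrable (fun t : ℝ => g i t * Real.exp (-Real.pi * t ^ 2)) := by
    intro i
    by_cases hi : i = i₀
    · simp only [hg, hi, if_true]
      have h1 := (integrable_pow_mul_gaussian 1).norm
      simpa [Real.norm_eq_abs, abs_mul] using h1
    · simp only [hg, hi, if_false]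
      simpa using integrable_pow_mul_gaussian 0
  simp only [hcomp]
  refine ⟨((b.measurePreserving_repr.integrable_comp_emb
    b.repr.toHomeomorph.measurableEmbedding).2 (integrable_prod_mul_gaussian hint)).const_mul _, ?_⟩
  rw [integral_const_mul, b.measurePreserving_repr.integral_comp
    b.repr.toHomeomorph.measurableEmbedding
      (fun y : Euc d => (∏ i, g i (y i)) * Real.exp (-Real.pi * ‖y‖ ^ 2)),
    integral_prod_mul_gaussian, Finset.prod_eq_single i₀]
  · simp only [hg, if_true, integral_abs_mul_gaussian]
    ring
  · intro i _ hi
    simp only [hg, hi, if_false]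
    have := integral_pow_mul_gaussian (n := 0) (by norm_num)
    simpa [gaussMoment] using this
  · simp

/-- The mean of `|s · N|` over the unit sphere. -/
theorem lintegral_sphere_abs_inner {n : ℕ} (N : Euc (n + 1)) :
    ∫⁻ s : Metric.sphere (0 : Euc (n + 1)) 1, ENNReal.ofReal |inner ℝ N s.1|
      ∂(volume : Measure (Euc (n + 1))).toSphere =
    ENNReal.ofReal (2 * unitBallVolume n * ‖N‖) := by
  obtain ⟨h1, h2⟩ := integral_abs_inner_mul_gaussian N
  have hpi := Real.pi_pos
  have hG : 0 < Real.Gamma ((n : ℝ) / 2 + 1) := Real.Gamma_pos_of_pos (by positivity)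
  -- The spherical integral is found by evaluating a Gaussian integral twice, in Cartesian and in
  -- polar coordinates, and dividing by the radial factor.
  have h3 := lintegral_radial_mul_homogeneous (volume : Measure (Euc (n + 1)))
    (g := fun r => ENNReal.ofReal (Real.exp (-Real.pi * r ^ 2)))
    (q := fun x => ENNReal.ofReal |inner ℝ N x|) (p := 1) (by fun_prop)
    (by fun_prop) (fun r hr x => by
      rw [inner_smul_right, abs_mul, abs_of_pos hr, ENNReal.ofReal_mul hr.le, pow_one])
  rw [finrank_euclideanSpace_fin, lintegral_Ioi_pow_mul_gaussian] at h3
  refine ENNReal_eq_ofReal_of_mul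
    (by have := unitBallVolume_pos n
        positivity) ?_ (Eq.trans ?_ h3)
  · have : 0 < Real.Gamma (((n + 1 - 1 + 1 : ℕ) + 1 : ℝ) / 2) :=
      Real.Gamma_pos_of_pos (by positivity)
    positivity
  · have h4 : ∫⁻ x : Euc (n + 1), ENNReal.ofReal (Real.exp (-Real.pi * ‖x‖ ^ 2)) *
        ENNReal.ofReal |inner ℝ N x| = ENNReal.ofReal (‖N‖ / Real.pi) := by
      rw [← h2, ofReal_integral_eq_lintegral_ofReal h1
        (Eventually.of_forall fun x => by positivity)]
      refine lintegral_congr fun x => ?_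
      rw [ENNReal.ofReal_mul (abs_nonneg _), mul_comm]
    rw [h4]
    congr 1
    have e1 : (((n + 1 - 1 + 1 : ℕ) + 1 : ℝ) / 2) = (n : ℝ) / 2 + 1 := by
      push_cast [Nat.add_sub_cancel]
      ring
    have e2 : (-((n + 1 - 1 + 1 : ℕ) + 1 : ℝ) / 2) = -((n : ℝ) / 2) + (-1) := by
      push_cast [Nat.add_sub_cancel]
      ring
    have e3 : Real.pi ^ (-((n : ℝ) / 2)) = (√Real.pi ^ n)⁻¹ := by
      rw [Real.rpow_neg hpi.le, Real.sqrt_eq_rpow, ← Real.rpow_natCast, ← Real.rpow_mul hpi.le]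
      ring_nf
    rw [e1, e2, Real.rpow_add hpi, Real.rpow_neg_one, e3, unitBallVolume_eq]
    field_simp

/-- Wick's formula for the fourth moments of independent standard Gaussians. -/
theorem prod_gaussMoment {d : ℕ} (hd : d = 2 ∨ d = 3) (i j k l : Fin d) :
    ∏ n, gaussMoment ((if n = i then 1 else 0) + (if n = j then 1 else 0) +
      (if n = k then 1 else 0) + (if n = l then 1 else 0)) =
    (if i = j ∧ k = l then 1 else 0) + (if i = k ∧ j = l then 1 else 0) +
      (if i = l ∧ j = k then 1 else 0) := by
  rcases hd with rfl | rfl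
  · revert i j k l
    decide
  · revert i j k l
    decide

theorem integral_quartic_mul_gaussian {d : ℕ} (hd : d = 2 ∨ d = 3) (i j k l : Fin d) :
    Integrable (fun x : Euc d => (x i * x j * x k * x l) * Real.exp (-Real.pi * ‖x‖ ^ 2)) ∧
    ∫ x : Euc d, (x i * x j * x k * x l) * Real.exp (-Real.pi * ‖x‖ ^ 2) =
      (4 * Real.pi ^ 2)⁻¹ * ((if i = j ∧ k = l then 1 else 0) + (if i = k ∧ j = l then 1 else 0) +
      (if i = l ∧ j = k then 1 else 0)) := by
  -- The exponent of coordinate `n` is the number of indices among `i, j, k, l` equal to `n`; the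
  -- monomial then splits into one-dimensional moments.
  set c : Fin d → ℕ := fun n => (if n = i then 1 else 0) + (if n = j then 1 else 0) +
      (if n = k then 1 else 0) + (if n = l then 1 else 0) with hc
  have hprod : ∀ x : Euc d, x i * x j * x k * x l = ∏ n, x n ^ c n := by
    intro x
    simp only [hc, pow_add, Finset.prod_mul_distrib, pow_ite, pow_one, pow_zero,
      Finset.prod_ite_eq', Finset.mem_univ, if_true]
  have hc4 : ∀ n, c n ≤ 4 := by
    intro n
    simp only [hc]
    split_ifs <;> norm_num
  have hsum : ∑ n, c n = 4 := by
    simp [hc, Finset.sum_add_distrib]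
  simp only [hprod]
  refine ⟨integrable_prod_mul_gaussian fun n => integrable_pow_mul_gaussian _, ?_⟩
  rw [integral_prod_mul_gaussian fun n t => t ^ c n]
  simp only [fun n => integral_pow_mul_gaussian (hc4 n), Finset.prod_mul_distrib,
    Finset.prod_pow_eq_pow_sum, hsum]
  rw [← Nat.cast_prod, prod_gaussMoment hd i j k l]
  have hs : √((2 * Real.pi)⁻¹) ^ 4 = (4 * Real.pi ^ 2)⁻¹ := by
    rw [show (4 : ℕ) = 2 * 2 from rfl, pow_mul, Real.sq_sqrt (by positivity)]
    field_simp
    norm_num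
  rw [hs]
  push_cast
  rfl

/-- The fourth-order isotropic form `(tr A)² + |A|² + A : Aᵀ`. -/
def isotropicForm {d : ℕ} (A : Matrix (Fin d) (Fin d) ℝ) : ℝ :=
  A.trace ^ 2 + ∑ i, ∑ j, A i j ^ 2 + ∑ i, ∑ j, A i j * A j i

/-- The last two terms add up to half of `|A + Aᵀ|²`. -/
theorem isotropicForm_nonneg {d : ℕ} (A : Matrix (Fin d) (Fin d) ℝ) : 0 ≤ isotropicForm A := by
  have h1 : 2 * ∑ i, ∑ j, A i j ^ 2 + 2 * ∑ i, ∑ j, A i j * A j i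
      = ∑ i, ∑ j, (A i j + A j i) ^ 2 := by
    have h2 : ∑ i, ∑ j, A i j ^ 2 = ∑ i, ∑ j, A j i ^ 2 := Finset.sum_comm
    have h3 : ∑ i, ∑ j, (A i j + A j i) ^ 2 = ∑ i, ∑ j, A i j ^ 2 + ∑ i, ∑ j, A j i ^ 2
        + 2 * ∑ i, ∑ j, A i j * A j i := by
      simp only [Finset.mul_sum, ← Finset.sum_add_distrib]
      exact Finset.sum_congr rfl fun i _ => Finset.sum_congr rfl fun j _ => by ring
    rw [h3, ← h2]
    ring
  have h4 : 0 ≤ ∑ i, ∑ j, (A i j + A j i) ^ 2 :=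
    Finset.sum_nonneg fun i _ => Finset.sum_nonneg fun j _ => sq_nonneg _
  have := sq_nonneg A.trace
  unfold isotropicForm
  linarith

/-- By `2 A : Aᵀ ≤ |A|² + |Aᵀ|²`, with equality for symmetric `A`. The inequality spares any appeal
to symmetry of the strain field. -/
theorem isotropicForm_le {d : ℕ} (A : Matrix (Fin d) (Fin d) ℝ) :
    isotropicForm A ≤ 2 * ∑ i, ∑ j, A i j ^ 2 + A.trace ^ 2 := by
  have h2 : ∑ i, ∑ j, A i j ^ 2 = ∑ i, ∑ j, A j i ^ 2 := Finset.sum_comm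
  have h3 : ∑ i, ∑ j, A i j * A j i ≤ ∑ i, ∑ j, (A i j ^ 2 + A j i ^ 2) / 2 :=
    Finset.sum_le_sum fun i _ => Finset.sum_le_sum fun j _ => by
      nlinarith [sq_nonneg (A i j - A j i)]
  have h4 : ∑ i, ∑ j, (A i j ^ 2 + A j i ^ 2) / 2 = ∑ i, ∑ j, A i j ^ 2 := by
    simp only [← Finset.sum_div, Finset.sum_add_distrib]
    rw [← h2]
    ring
  unfold isotropicForm
  linarith

/-- The quadratic form `A x · x`. -/
def quadForm {d : ℕ} (A : Matrix (Fin d) (Fin d) ℝ) (x : Euc d) : ℝ :=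
  ∑ i, ∑ j, A i j * (x i * x j)

/-- Expanding the square gives quartic moments, and the three Wick pairings contribute `(tr A)²`,
`|A|²` and `A : Aᵀ`. -/
theorem integral_quadForm_sq_mul_gaussian {d : ℕ} (hd : d = 2 ∨ d = 3)
    (A : Matrix (Fin d) (Fin d) ℝ) :
    Integrable (fun x : Euc d => quadForm A x ^ 2 * Real.exp (-Real.pi * ‖x‖ ^ 2)) ∧
    ∫ x : Euc d, quadForm A x ^ 2 * Real.exp (-Real.pi * ‖x‖ ^ 2) =
      (4 * Real.pi ^ 2)⁻¹ * isotropicForm A := by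
  have hexp : ∀ x : Euc d, quadForm A x ^ 2 * Real.exp (-Real.pi * ‖x‖ ^ 2) =
      ∑ i, ∑ j, ∑ k, ∑ l, A i j * A k l *
        ((x i * x j * x k * x l) * Real.exp (-Real.pi * ‖x‖ ^ 2)) := by
    intro x
    simp only [quadForm, sq (∑ i, ∑ j, A i j * (x i * x j)), Finset.sum_mul, Finset.mul_sum]
    refine Finset.sum_congr rfl fun i _ => Finset.sum_congr rfl fun j _ =>
      Finset.sum_congr rfl fun k _ => Finset.sum_congr rfl fun l _ => by ring
  have hi := integral_quartic_mul_gaussian hd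
  simp only [hexp]
  refine ⟨integrable_finsetSum _ fun i _ => integrable_finsetSum _ fun j _ =>
    integrable_finsetSum _ fun k _ => integrable_finsetSum _ fun l _ =>
      (hi i j k l).1.const_mul _, ?_⟩
  rw [integral_finsetSum _ fun i _ => integrable_finsetSum _ fun j _ =>
    integrable_finsetSum _ fun k _ => integrable_finsetSum _ fun l _ =>
      (hi i j k l).1.const_mul _]
  have h2 : ∀ i, ∫ x : Euc d, ∑ j, ∑ k, ∑ l, A i j * A k l *
        ((x i * x j * x k * x l) * Real.exp (-Real.pi * ‖x‖ ^ 2)) =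
      ∑ j, ∑ k, ∑ l, A i j * A k l * ((4 * Real.pi ^ 2)⁻¹ *
        ((if i = j ∧ k = l then 1 else 0) + (if i = k ∧ j = l then 1 else 0) +
          (if i = l ∧ j = k then 1 else 0))) := by
    intro i
    rw [integral_finsetSum _ fun j _ => integrable_finsetSum _ fun k _ =>
      integrable_finsetSum _ fun l _ => (hi i j k l).1.const_mul _]
    refine Finset.sum_congr rfl fun j _ => ?_
    rw [integral_finsetSum _ fun k _ => integrable_finsetSum _ fun l _ =>
      (hi i j k l).1.const_mul _]
    refine Finset.sum_congr rfl fun k _ => ?_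
    rw [integral_finsetSum _ fun l _ => (hi i j k l).1.const_mul _]
    refine Finset.sum_congr rfl fun l _ => ?_
    rw [integral_const_mul, (hi i j k l).2]
  simp only [h2]
  simp only [mul_left_comm _ ((4 * Real.pi ^ 2)⁻¹), ← Finset.mul_sum]
  congr 1
  simp only [mul_add, Finset.sum_add_distrib, isotropicForm, ite_and, mul_ite, mul_one, mul_zero]
  simp [Matrix.trace, sq, Finset.sum_mul, Finset.mul_sum, Finset.sum_ite_irrel]
  exact Finset.sum_congr rfl fun i _ => Finset.sum_congr rfl fun j _ => mul_comm _ _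

/-- The mean of `(A s · s)²` over the unit sphere. -/
theorem lintegral_sphere_quadForm_sq {d : ℕ} (hd : d = 2 ∨ d = 3)
    (A : Matrix (Fin d) (Fin d) ℝ) :
    ∫⁻ s : Metric.sphere (0 : Euc d) 1, ENNReal.ofReal (quadForm A s.1 ^ 2)
      ∂(volume : Measure (Euc d)).toSphere =
    ENNReal.ofReal (unitBallVolume d / (d + 2) * isotropicForm A) := by
  obtain ⟨h1, h2⟩ := integral_quadForm_sq_mul_gaussian hd A
  have hpi := Real.pi_pos
  have hd0 : 0 < d := by omega
  have : Nonempty (Fin d) := ⟨⟨0, hd0⟩⟩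
  have hA := isotropicForm_nonneg A
  have hG : 0 < Real.Gamma ((d : ℝ) / 2 + 1) := Real.Gamma_pos_of_pos (by positivity)
  have h3 := lintegral_radial_mul_homogeneous (volume : Measure (Euc d))
    (g := fun r => ENNReal.ofReal (Real.exp (-Real.pi * r ^ 2)))
    (q := fun x => ENNReal.ofReal (quadForm A x ^ 2)) (p := 4) (by fun_prop)
    (by unfold quadForm; fun_prop) (fun r hr x => by
      rw [← ENNReal.ofReal_mul (by positivity)]
      congr 1
      have : quadForm A (r • x) = r ^ 2 * quadForm A x := by
        simp only [quadForm, Finset.mul_sum, PiLp.smul_apply, smul_eq_mul]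
        refine Finset.sum_congr rfl fun i _ => Finset.sum_congr rfl fun j _ => by ring
      rw [this]
      ring)
  rw [finrank_euclideanSpace_fin, lintegral_Ioi_pow_mul_gaussian] at h3
  refine ENNReal_eq_ofReal_of_mul
    (by have := unitBallVolume_pos d
        positivity) ?_ (Eq.trans ?_ h3)
  · have : 0 < Real.Gamma (((d - 1 + 4 : ℕ) + 1 : ℝ) / 2) :=
      Real.Gamma_pos_of_pos (by positivity)
    positivity
  · have h4 : ∫⁻ x : Euc d, ENNReal.ofReal (Real.exp (-Real.pi * ‖x‖ ^ 2)) *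
        ENNReal.ofReal (quadForm A x ^ 2) =
          ENNReal.ofReal ((4 * Real.pi ^ 2)⁻¹ * isotropicForm A) := by
      rw [← h2, ofReal_integral_eq_lintegral_ofReal h1
        (Eventually.of_forall fun x => by positivity)]
      refine lintegral_congr fun x => ?_
      rw [ENNReal.ofReal_mul (sq_nonneg _), mul_comm]
    rw [h4]
    congr 1
    have e0 : ((d - 1 + 4 : ℕ) : ℝ) = d + 3 := by
      rw [show d - 1 + 4 = d + 3 by omega]
      push_cast
      ring
    have e1 : (((d - 1 + 4 : ℕ) + 1 : ℝ) / 2) = (d : ℝ) / 2 + 1 + 1 := by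
      rw [e0]
      ring
    have e2 : (-((d - 1 + 4 : ℕ) + 1 : ℝ) / 2) = -((d : ℝ) / 2) + (-1) + (-1) := by
      rw [e0]
      ring
    have e3 : Real.pi ^ (-((d : ℝ) / 2)) = (√Real.pi ^ d)⁻¹ := by
      rw [Real.rpow_neg hpi.le, Real.sqrt_eq_rpow, ← Real.rpow_natCast, ← Real.rpow_mul hpi.le]
      ring_nf
    rw [e1, e2, Real.rpow_add hpi, Real.rpow_add hpi, Real.rpow_neg_one, e3, unitBallVolume_eq,
      Real.Gamma_add_one (s := (d : ℝ) / 2 + 1) (by positivity)]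
    generalize Real.Gamma ((d : ℝ) / 2 + 1) = G at hG
    field_simp
    ring

/-! Radial weights built from the influence function. -/

namespace IsInfluenceFunction

variable {J : ℝ → ℝ}

theorem exists_le (hJ : IsInfluenceFunction J) : ∃ M : ℝ, 0 < M ∧ ∀ r, 0 ≤ r → J r ≤ M := by
  obtain ⟨M, hM⟩ := hJ.bounded
  refine ⟨max M 1, lt_max_of_lt_right one_pos, fun r hr => ?_⟩
  rcases lt_or_ge r 1 with h | h
  · exact (hM r hr h).le.trans (le_max_left _ _)
  · rw [hJ.eq_zero r h]
    exact le_max_of_le_right zero_le_one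

theorem integrableOn_pow_mul (hJ : IsInfluenceFunction J) (n : ℕ) :
    IntegrableOn (fun r => r ^ n * J r) (Ioi 0) := by
  obtain ⟨M, hM0, hM⟩ := hJ.exists_le
  rw [← Ioc_union_Ioi_eq_Ioi zero_le_one]
  refine IntegrableOn.union ?_ ?_
  · refine Measure.integrableOn_of_bounded (M := M) (by simp) ?_ ?_
    · exact ((measurable_id.pow_const n).mul hJ.measurable).aestronglyMeasurable
    · filter_upwards [ae_restrict_mem measurableSet_Ioc] with r hr
      have h1 := hJ.nonneg r hr.1.le
      rw [norm_mul, norm_pow, Real.norm_of_nonneg hr.1.le, Real.norm_of_nonneg h1]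
      calc r ^ n * J r ≤ 1 * M :=
            mul_le_mul (pow_le_one₀ hr.1.le hr.2) (hM r hr.1.le) h1 zero_le_one
        _ = M := one_mul M
  · refine (integrableOn_zero (ε' := ℝ)).congr_fun (fun r hr => ?_) measurableSet_Ioi
    show 0 = r ^ n * J r
    rw [hJ.eq_zero r (le_of_lt hr), mul_zero]

theorem integral_Ioi_pow_mul (hJ : IsInfluenceFunction J) (n : ℕ) :
    ∫ r in Ioi (0 : ℝ), r ^ n * J r = ∫ r in (0 : ℝ)..1, r ^ n * J r := by
  rw [intervalIntegral.integral_of_le zero_le_one]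
  refine (setIntegral_eq_of_subset_of_forall_sdiff_eq_zero measurableSet_Ioi Ioc_subset_Ioi_self
    fun r hr => ?_)
  have h1 : 1 ≤ r := by
    by_contra! h
    exact hr.2 ⟨hr.1, h.le⟩
  rw [hJ.eq_zero r h1, mul_zero]

theorem moment_nonneg (hJ : IsInfluenceFunction J) (n : ℕ) :
    0 ≤ ∫ r in (0 : ℝ)..1, r ^ n * J r :=
  intervalIntegral.integral_nonneg zero_le_one fun r hr =>
    mul_nonneg (pow_nonneg hr.1 n) (hJ.nonneg r hr.1)

theorem lintegral_Ioi_pow_mul (hJ : IsInfluenceFunction J) (n : ℕ) {ε : ℝ} (hε : 0 < ε) :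
    ∫⁻ r in Ioi (0 : ℝ), ENNReal.ofReal (r ^ n) * ENNReal.ofReal (J (r / ε)) =
      ENNReal.ofReal (ε ^ (n + 1) * ∫ r in (0 : ℝ)..1, r ^ n * J r) := by
  have h0 : ∀ r : ℝ, r ^ n * J (r / ε) = ε ^ n * ((fun s => s ^ n * J s) (ε⁻¹ * r)) := by
    intro r
    simp only [mul_pow, inv_pow, div_eq_inv_mul]
    field_simp
  have h1 : IntegrableOn (fun r => r ^ n * J (r / ε)) (Ioi 0) := by
    simp only [h0]
    refine Integrable.const_mul ?_ _
    have h := hJ.integrableOn_pow_mul n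
    rw [← mul_zero ε⁻¹] at h
    exact (integrableOn_Ioi_comp_mul_left_iff _ _ (inv_pos.2 hε)).2 h
  have h2 : ∫ r in Ioi (0 : ℝ), r ^ n * J (r / ε) =
      ε ^ (n + 1) * ∫ r in (0 : ℝ)..1, r ^ n * J r := by
    simp only [h0]
    rw [integral_const_mul,
      integral_comp_mul_left_Ioi (fun s => s ^ n * J s) _ (inv_pos.2 hε), mul_zero, hJ.integral_Ioi_pow_mul, inv_inv, smul_eq_mul]
    ring
  rw [← h2, ofReal_integral_eq_lintegral_ofReal h1]
  · refine setLIntegral_congr_fun measurableSet_Ioi fun r hr => ?_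
    have : (0 : ℝ) < r := hr
    exact (ENNReal.ofReal_mul (by positivity)).symm
  · filter_upwards [ae_restrict_mem measurableSet_Ioi] with r hr
    have h3 : (0 : ℝ) < r := hr
    exact mul_nonneg (by positivity) (hJ.nonneg _ (by positivity))

/-- Averages the volume swept by a unit-time translate of a flat piece with area vector `N`; after
normalization its constant becomes the one in the energy release rate. -/
theorem lintegral_mul_abs_inner (hJ : IsInfluenceFunction J) {ε : ℝ} (hε : 0 < ε) {n : ℕ}
    (N : Euc (n + 1)) :
    ∫⁻ ξ : Euc (n + 1), ENNReal.ofReal (J (‖ξ‖ / ε)) * ENNReal.ofReal |inner ℝ N ξ| =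
      ENNReal.ofReal (2 * unitBallVolume n * ‖N‖ *
        (ε ^ (n + 2) * ∫ r in (0 : ℝ)..1, r ^ (n + 1) * J r)) := by
  have hJm := hJ.measurable
  rw [lintegral_radial_mul_homogeneous (volume : Measure (Euc (n + 1)))
    (g := fun r => ENNReal.ofReal (J (r / ε)))
    (q := fun x => ENNReal.ofReal |inner ℝ N x|) (p := 1) (by fun_prop)
    (by fun_prop) (fun r hr x => by
      rw [inner_smul_right, abs_mul, abs_of_pos hr, ENNReal.ofReal_mul hr.le, pow_one]),
    lintegral_sphere_abs_inner, finrank_euclideanSpace_fin, Nat.add_sub_cancel,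
    hJ.lintegral_Ioi_pow_mul _ hε, ← ENNReal.ofReal_mul]
  have := unitBallVolume_pos n
  positivity

/-- The weight `‖ξ‖⁻³` is the one in `bondDifference_sq`. In polar coordinates the powers `r ^ (d -
1)`, `r ^ 4` and `r ^ (-3)` combine to `r ^ d`, the moment in the Lamé moduli. -/
theorem lintegral_mul_quadForm_sq (hJ : IsInfluenceFunction J) {ε : ℝ} (hε : 0 < ε) {d : ℕ}
    (hd : d = 2 ∨ d = 3) (A : Matrix (Fin d) (Fin d) ℝ) :
    ∫⁻ ξ : Euc d, ENNReal.ofReal (J (‖ξ‖ / ε) / ‖ξ‖ ^ 3) * ENNReal.ofReal (quadForm A ξ ^ 2) =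
      ENNReal.ofReal (unitBallVolume d / (d + 2) * isotropicForm A *
        (ε ^ (d + 1) * ∫ r in (0 : ℝ)..1, r ^ d * J r)) := by
  have hJm := hJ.measurable
  have hd0 : 0 < d := by omega
  have : Nonempty (Fin d) := ⟨⟨0, hd0⟩⟩
  rw [lintegral_radial_mul_homogeneous (volume : Measure (Euc d))
    (g := fun r => ENNReal.ofReal (J (r / ε) / r ^ 3))
    (q := fun x => ENNReal.ofReal (quadForm A x ^ 2)) (p := 4) (by fun_prop)
    (by unfold quadForm; fun_prop) (fun r hr x => by
      rw [← ENNReal.ofReal_mul (by positivity)]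
      congr 1
      have : quadForm A (r • x) = r ^ 2 * quadForm A x := by
        simp only [quadForm, Finset.mul_sum, PiLp.smul_apply, smul_eq_mul]
        refine Finset.sum_congr rfl fun i _ => Finset.sum_congr rfl fun j _ => by ring
      rw [this]
      ring),
    lintegral_sphere_quadForm_sq hd, finrank_euclideanSpace_fin, ENNReal.ofReal_mul (p := _ * _) (by
      have := unitBallVolume_pos d
      have := isotropicForm_nonneg A
      positivity), ← hJ.lintegral_Ioi_pow_mul _ hε]
  congr 1
  refine setLIntegral_congr_fun measurableSet_Ioi fun r hr => ?_
  have hr : (0 : ℝ) < r := hr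
  show ENNReal.ofReal (r ^ (d - 1 + 4)) * ENNReal.ofReal (J (r / ε) / r ^ 3) = _
  rw [← ENNReal.ofReal_mul (by positivity), ← ENNReal.ofReal_mul (by positivity),
    show d - 1 + 4 = d + 3 by omega]
  congr 1
  field_simp
  ring

/-- The polar Jacobian leaves `r ^ (d - 2)`, which is harmless at the origin as soon as `2 ≤ d`. -/
theorem lintegral_div_norm_lt_top (hJ : IsInfluenceFunction J) {ε : ℝ} (hε : 0 < ε) {d : ℕ}
    (hd : 2 ≤ d) :
    ∫⁻ ξ : Euc d, ENNReal.ofReal (J (‖ξ‖ / ε) / ‖ξ‖) < ⊤ := by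
  have hJm := hJ.measurable
  have : Nonempty (Fin d) := ⟨⟨0, by omega⟩⟩
  have h := lintegral_radial_mul_homogeneous (volume : Measure (Euc d))
    (g := fun r => ENNReal.ofReal (J (r / ε) / r)) (q := fun _ => 1) (p := 0) (by fun_prop)
    (by fun_prop) (fun r hr x => by simp)
  simp only [mul_one, lintegral_const, one_mul, finrank_euclideanSpace_fin, add_zero] at h
  rw [h]
  refine ENNReal.mul_lt_top (measure_lt_top _ _) ?_
  have h2 := hJ.lintegral_Ioi_pow_mul (d - 2) hε
  refine lt_of_eq_of_lt ?_ (h2.trans_lt ENNReal.ofReal_lt_top)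
  refine setLIntegral_congr_fun measurableSet_Ioi fun r hr => ?_
  have hr : (0 : ℝ) < r := hr
  show ENNReal.ofReal (r ^ (d - 1)) * ENNReal.ofReal (J (r / ε) / r) = _
  rw [← ENNReal.ofReal_mul (by positivity), ← ENNReal.ofReal_mul (by positivity),
    show d - 1 = d - 2 + 1 by omega, pow_succ]
  congr 1
  field_simp

end IsInfluenceFunction

/-! ### Sweeping rectifiable sets along a segment -/

section Normal

variable {n : ℕ}

/-- The projection of `ℝ^{n+1}` onto its last `n` coordinates. -/
def tailCLM (n : ℕ) : Euc (n + 1) →L[ℝ] Euc n :=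
  (EuclideanSpace.equiv (Fin n) ℝ).symm.toContinuousLinearMap.comp
    (ContinuousLinearMap.pi fun j : Fin n => EuclideanSpace.proj (𝕜 := ℝ) j.succ)

@[simp]
theorem tailCLM_apply (x : Euc (n + 1)) (j : Fin n) : tailCLM n x j = x j.succ := rfl

theorem norm_tailCLM_le (x : Euc (n + 1)) : ‖tailCLM n x‖ ≤ ‖x‖ := by
  rw [← abs_of_nonneg (norm_nonneg (tailCLM n x)), ← abs_of_nonneg (norm_nonneg x), ← sq_le_sq,
    EuclideanSpace.norm_sq_eq, EuclideanSpace.norm_sq_eq, Fin.sum_univ_succ]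
  simp only [tailCLM_apply]
  linarith [sq_nonneg ‖x 0‖]

/-- The linear map `x ↦ L(x₁, …, x_n) + x₀ ξ`. -/
def sweepCLM (L : Euc n →L[ℝ] Euc (n + 1)) (ξ : Euc (n + 1)) : Euc (n + 1) →L[ℝ] Euc (n + 1) :=
  L.comp (tailCLM n) + (EuclideanSpace.proj (𝕜 := ℝ) (0 : Fin (n + 1))).smulRight ξ

theorem sweepCLM_apply (L : Euc n →L[ℝ] Euc (n + 1)) (ξ x : Euc (n + 1)) :
    sweepCLM L ξ x = L (tailCLM n x) + x 0 • ξ := rfl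

/-- The matrix of `L`. -/
def colMatrix {m : ℕ} (L : Euc n →L[ℝ] Euc m) : Matrix (Fin m) (Fin n) ℝ :=
  Matrix.of fun i j => L (EuclideanSpace.single j 1) i

/-- The generalized cross product of the columns of `L`. -/
def crossNormal (L : Euc n →L[ℝ] Euc (n + 1)) : Euc (n + 1) :=
  WithLp.toLp 2 fun i => (-1) ^ (i : ℕ) * ((colMatrix L).submatrix i.succAbove id).det

theorem det_eq_det_colMatrix (A : Euc n →L[ℝ] Euc n) : A.det = (colMatrix A).det := by
  rw [ContinuousLinearMap.det, ← LinearMap.det_toMatrix (EuclideanSpace.basisFun (Fin n) ℝ).toBasis]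
  congr 1

/-- Laplace expansion along the column `ξ`: the cofactors are the components of the cross product.
-/
theorem det_sweepCLM (L : Euc n →L[ℝ] Euc (n + 1)) (ξ : Euc (n + 1)) :
    (sweepCLM L ξ).det = inner ℝ (crossNormal L) ξ := by
  have h0 : tailCLM n (EuclideanSpace.single 0 1) = 0 := by
    ext j
    simp
  have h1 : ∀ j : Fin n, tailCLM n (EuclideanSpace.single j.succ 1) =
      EuclideanSpace.single j 1 := by
    intro j
    ext i
    simp
  rw [det_eq_det_colMatrix, Matrix.det_succ_column_zero, PiLp.inner_apply]
  refine Finset.sum_congr rfl fun i _ => ?_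
  have h2 : colMatrix (sweepCLM L ξ) i 0 = ξ i := by
    simp [colMatrix, sweepCLM_apply, h0]
  have h4 : ∀ b : Fin n, (EuclideanSpace.single b.succ (1 : ℝ) : Euc (n + 1)) 0 = 0 := by
    intro b
    simp
  have h3 : (colMatrix (sweepCLM L ξ)).submatrix i.succAbove Fin.succ =
      (colMatrix L).submatrix i.succAbove id := by
    ext a b
    simp only [Matrix.submatrix_apply, colMatrix, Matrix.of_apply, sweepCLM_apply, h1, h4,
      zero_smul, add_zero, id_eq]
  rw [h2, h3]
  simp only [crossNormal, RCLike.inner_apply, conj_trivial]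
  ring

theorem continuous_crossNormal : Continuous (crossNormal (n := n)) := by
  unfold crossNormal
  refine (PiLp.continuous_toLp 2 _).comp (continuous_pi fun i => continuous_const.mul ?_)
  refine Continuous.matrix_det ?_
  refine continuous_matrix fun a b => ?_
  simp only [Matrix.submatrix_apply, colMatrix, Matrix.of_apply]
  fun_prop

/-- There is a `1`-Lipschitz linear projection along a given unit vector. -/
theorem exists_projection {ν : Euc (n + 1)} (hν : ‖ν‖ = 1) :
    ∃ P : Euc (n + 1) →L[ℝ] Euc n, LipschitzWith 1 P ∧ P ν = 0 ∧ Function.Surjective P ∧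
      ∀ L : Euc n →L[ℝ] Euc (n + 1), |(P.comp L).det| = |inner ℝ (crossNormal L) ν| := by
  obtain ⟨b, hb⟩ := Orthonormal.exists_orthonormalBasis_extension_of_card_eq (𝕜 := ℝ)
    (E := Euc (n + 1)) (ι := Fin (n + 1)) (by simp) (v := fun _ => ν) (s := {0})
    ⟨fun i => hν, fun i j hij => absurd (Subsingleton.elim i j) hij⟩
  have hb0 : b 0 = ν := hb 0 rfl
  set R : Euc (n + 1) ≃ₗᵢ[ℝ] Euc (n + 1) := b.repr with hR
  have hRν : R ν = EuclideanSpace.single 0 1 := by rw [← hb0, hR, b.repr_self]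
  have hsurj : Function.Surjective (tailCLM n) := fun y =>
    ⟨WithLp.toLp 2 (Fin.cons 0 y), by ext j; simp⟩
  refine ⟨(tailCLM n).comp (R.toContinuousLinearEquiv : Euc (n + 1) →L[ℝ] Euc (n + 1)),
    ?_, ?_, hsurj.comp R.surjective, fun L => ?_⟩
  · refine LipschitzWith.of_dist_le_mul fun x y => ?_
    rw [NNReal.coe_one, one_mul, dist_eq_norm, ← map_sub, dist_eq_norm]
    exact (norm_tailCLM_le _).trans (R.norm_map _).le
  · show tailCLM n (R ν) = 0
    rw [hRν]
    ext j
    simp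
  -- Rotate `ν` to the first basis vector. Determinants keep their absolute value, and the first
  -- component of the rotated cross product is the minor that remains after dropping the first row,
  -- that is the determinant of `P.comp L`.
  · set RL : Euc n →L[ℝ] Euc (n + 1) :=
      (R.toContinuousLinearEquiv : Euc (n + 1) →L[ℝ] Euc (n + 1)).comp L
    have h1 : (R.toContinuousLinearEquiv : Euc (n + 1) →L[ℝ] Euc (n + 1)).comp (sweepCLM L ν) =
        sweepCLM RL (EuclideanSpace.single 0 1) := by
      ext1 x
      show R (sweepCLM L ν x) = sweepCLM RL (EuclideanSpace.single 0 1) x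
      rw [sweepCLM_apply, map_add, map_smul, hRν]
      rfl
    have h2 : |((R.toContinuousLinearEquiv : Euc (n + 1) →L[ℝ] Euc (n + 1)).comp
        (sweepCLM L ν)).det| = |(sweepCLM L ν).det| := by
      have h3 : |LinearMap.det (R.toLinearEquiv : Euc (n + 1) →ₗ[ℝ] Euc (n + 1))| = 1 := by
        rw [← LinearMap.normDet_eq_abs_det]
        exact R.toLinearIsometry.normDet_eq_one
      have h4 : ((R.toContinuousLinearEquiv : Euc (n + 1) →L[ℝ] Euc (n + 1)).comp
          (sweepCLM L ν)).det =
          LinearMap.det (R.toLinearEquiv : Euc (n + 1) →ₗ[ℝ] Euc (n + 1)) * (sweepCLM L ν).det :=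
        LinearMap.det_comp _ _
      rw [h4, abs_mul, h3, one_mul]
    rw [← det_sweepCLM, ← h2, h1, det_sweepCLM, EuclideanSpace.inner_single_right,
      det_eq_det_colMatrix]
    simp only [crossNormal, conj_trivial, one_mul, Fin.val_zero, pow_zero, Fin.succAbove_zero]
    rfl

/-- The set of points `x` for which the segment from `x` to `x + ξ` meets `K`. -/
def sweep {E : Type*} [AddCommGroup E] [Module ℝ E] (K : Set E) (ξ : E) : Set E :=
  {x | ∃ s ∈ Icc (0 : ℝ) 1, x + s • ξ ∈ K}

theorem volume_tail_preimage_prod (A : Set (Euc n)) (hA : MeasurableSet A)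
    {g : Euc n → ℝ≥0∞} (hg : Measurable g) (I : Set ℝ) (hI : MeasurableSet I) :
    ∫⁻ x in {x : Euc (n + 1) | x 0 ∈ I ∧ tailCLM n x ∈ A}, g (tailCLM n x) =
      volume I * ∫⁻ a in A, g a := by
  have hS : MeasurableSet {x : Euc (n + 1) | x 0 ∈ I ∧ tailCLM n x ∈ A} :=
    (((by fun_prop : Continuous fun x : Euc (n + 1) => x 0).measurable) hI).inter
      ((tailCLM n).continuous.measurable hA)
  have e1 : MeasurePreserving (fun x : Euc (n + 1) =>
      MeasurableEquiv.piFinSuccAbove (fun _ : Fin (n + 1) => ℝ) 0 (WithLp.ofLp x)) :=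
    (volume_preserving_piFinSuccAbove (fun _ : Fin (n + 1) => ℝ) 0).comp
      (PiLp.volume_preserving_ofLp (Fin (n + 1)))
  have e2 : MeasurePreserving (fun x : Euc (n + 1) => (x 0, tailCLM n x)) := by
    have e3 : MeasurePreserving (Prod.map (id : ℝ → ℝ) (WithLp.toLp 2 : (Fin n → ℝ) → Euc n))
        (volume.prod volume) (volume.prod volume) :=
      (MeasurePreserving.id volume).prod (PiLp.volume_preserving_toLp (Fin n))
    exact e3.comp e1
  rw [← lintegral_indicator hS]
  have h1 : ∀ x : Euc (n + 1), {x : Euc (n + 1) | x 0 ∈ I ∧ tailCLM n x ∈ A}.indicator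
      (fun x => g (tailCLM n x)) x =
      (fun z : ℝ × Euc n => I.indicator (fun _ => (1 : ℝ≥0∞)) z.1 * A.indicator g z.2)
        (x 0, tailCLM n x) := by
    intro x
    by_cases hx1 : x 0 ∈ I <;> by_cases hx2 : tailCLM n x ∈ A <;> simp [indicator, hx1, hx2]
  simp only [h1]
  have hm : Measurable (I.indicator (fun _ => (1 : ℝ≥0∞))) := measurable_const.indicator hI
  rw [e2.lintegral_comp (f := fun z : ℝ × Euc n =>
      I.indicator (fun _ => (1 : ℝ≥0∞)) z.1 * A.indicator g z.2)
      ((hm.comp measurable_fst).mul ((hg.indicator hA).comp measurable_snd))]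
  rw [Measure.volume_eq_prod, lintegral_prod_mul hm.aemeasurable (hg.indicator hA).aemeasurable,
    lintegral_indicator hI, lintegral_indicator hA]
  simp

/-- The volume swept by a parametrized surface. -/
theorem volume_sweep_image_le {φ : Euc n → Euc (n + 1)} (hφ : ContDiff ℝ 1 φ) {A : Set (Euc n)}
    (hA : MeasurableSet A) (ξ : Euc (n + 1)) :
    volume (sweep (φ '' A) ξ) ≤
      ∫⁻ a in A, ENNReal.ofReal |inner ℝ (crossNormal (fderiv ℝ φ a)) ξ| := by
  set S : Set (Euc (n + 1)) := {x | x 0 ∈ Icc (0 : ℝ) 1 ∧ tailCLM n x ∈ A} with hSdef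
  have hS : MeasurableSet S :=
    (((by fun_prop : Continuous fun x : Euc (n + 1) => x 0).measurable) measurableSet_Icc).inter
      ((tailCLM n).continuous.measurable hA)
  -- The relation `x + s ξ = φ(a)` reads `x = φ(a) - s ξ`, so the sweep lies in the image of `[0,1]
  -- × A`. The Jacobian of this map is the normal component of `ξ`, and an upper bound for the image
  -- volume needs no injectivity.
  have hsub : sweep (φ '' A) ξ ⊆ (fun x : Euc (n + 1) => φ (tailCLM n x) + x 0 • (-ξ)) '' S := by
    rintro x ⟨s, hs, a, ha, hax⟩
    have htail : tailCLM n (WithLp.toLp 2 (Fin.cons s a)) = a := by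
      ext j
      simp
    refine ⟨WithLp.toLp 2 (Fin.cons s a), ⟨hs, ?_⟩, ?_⟩
    · rw [htail]
      exact ha
    · simp only [htail, Fin.cons_zero]
      rw [hax]
      simp
  have hd : ∀ x ∈ S, HasFDerivWithinAt (fun x : Euc (n + 1) => φ (tailCLM n x) + x 0 • (-ξ))
      (sweepCLM (fderiv ℝ φ (tailCLM n x)) (-ξ)) S x := by
    intro x _
    have h1 : HasFDerivAt φ (fderiv ℝ φ (tailCLM n x)) (tailCLM n x) :=
      (hφ.differentiable one_ne_zero _).hasFDerivAt
    have h2 := h1.comp x (tailCLM n).hasFDerivAt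
    have h3 := ((EuclideanSpace.proj (𝕜 := ℝ) (0 : Fin (n + 1))).smulRight (-ξ)).hasFDerivAt
      (x := x)
    exact (h2.add h3).hasFDerivWithinAt
  have hcont : Continuous fun a => inner ℝ (crossNormal (fderiv ℝ φ a)) ξ :=
    (continuous_crossNormal.comp (hφ.continuous_fderiv one_ne_zero)).inner continuous_const
  calc volume (sweep (φ '' A) ξ) ≤ _ := measure_mono hsub
    _ ≤ ∫⁻ x in S, ENNReal.ofReal |(sweepCLM (fderiv ℝ φ (tailCLM n x)) (-ξ)).det| :=
        addHaar_image_le_lintegral_abs_det_fderiv _ hS hd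
    _ = ∫⁻ x in S, (fun a => ENNReal.ofReal |inner ℝ (crossNormal (fderiv ℝ φ a)) ξ|)
          (tailCLM n x) := by
        simp only [det_sweepCLM, inner_neg_right, abs_neg]
    _ = _ := by
        rw [hSdef, volume_tail_preimage_prod A hA
          (g := fun a => ENNReal.ofReal |inner ℝ (crossNormal (fderiv ℝ φ a)) ξ|)
          hcont.abs.measurable.ennreal_ofReal (Icc (0 : ℝ) 1) measurableSet_Icc]
        simp

theorem euclideanHausdorffMeasure_image_le {X Y : Type*} [EMetricSpace X] [MeasurableSpace X]
    [BorelSpace X] [EMetricSpace Y] [MeasurableSpace Y] [BorelSpace Y] {P : X → Y}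
    (hP : LipschitzWith 1 P) (m : ℕ) (s : Set X) : μHE[m] (P '' s) ≤ μHE[m] s := by
  rw [Measure.euclideanHausdorffMeasure_def, Measure.euclideanHausdorffMeasure_def,
    Measure.smul_apply, Measure.smul_apply]
  have h := hP.hausdorffMeasure_image_le (d := (m : ℝ)) m.cast_nonneg s
  simp only [ENNReal.coe_one, ENNReal.one_rpow, one_mul] at h
  gcongr

/-- A null set for the `n`-dimensional Hausdorff measure sweeps a null set. -/
theorem volume_sweep_eq_zero {K : Set (Euc (n + 1))} (hK : μHE[n] K = 0) {ξ : Euc (n + 1)}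
    (hξ : ξ ≠ 0) : volume (sweep K ξ) = 0 := by
  have hξ' : 0 < ‖ξ‖ := norm_pos_iff.2 hξ
  obtain ⟨P, hP, hPν, hsurj, -⟩ := exists_projection (ν := ‖ξ‖⁻¹ • ξ)
    (by rw [norm_smul, norm_inv, norm_norm, inv_mul_cancel₀ hξ'.ne'])
  have hPξ : P ξ = 0 := by
    rw [map_smul, smul_eq_zero] at hPν
    exact hPν.resolve_left (inv_ne_zero hξ'.ne')
  -- Projecting along `ξ` collapses each segment to a point, so the sweep lies in the cylinder over
  -- the projected set, which is still null because the projection is 1-Lipschitz.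
  have h1 : volume (P '' K) = 0 := by
    rw [← EuclideanSpace.euclideanHausdorffMeasure_eq_volume]
    exact le_antisymm ((euclideanHausdorffMeasure_image_le hP n K).trans hK.le) zero_le
  obtain ⟨Z, hZ, hZm, hZ0⟩ := exists_measurable_superset_of_null h1
  have h2 : ∀ᵐ y : Euc n, y ∈ Zᶜ := measure_eq_zero_iff_ae_notMem.1 hZ0
  have h3 : ∀ᵐ x : Euc (n + 1), P x ∈ Zᶜ :=
    (ae_comp_linearMap_mem_iff (P : Euc (n + 1) →ₗ[ℝ] Euc n) volume volume hsurj hZm.compl).2 h2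
  refine measure_mono_null ?_ (ae_iff.1 h3)
  rintro x ⟨s, -, hs⟩
  have h4 : P x ∈ Z := by
    refine hZ ⟨_, hs, ?_⟩
    rw [map_add, map_smul, hPξ, smul_zero, add_zero]
  simpa using h4

/-- Near a regular point, a parametrization is injective and its area is at most the Hausdorff
measure of its image, up to a factor close to `1`. -/
theorem exists_area_le {φ : Euc n → Euc (n + 1)} (hφ : ContDiff ℝ 1 φ) {a₀ : Euc n}
    (h₀ : crossNormal (fderiv ℝ φ a₀) ≠ 0) {q : ℝ} (hq : q < 1) :
    ∃ U : Set (Euc n), IsOpen U ∧ a₀ ∈ U ∧ InjOn φ U ∧ ∀ A ⊆ U, MeasurableSet A →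
      ENNReal.ofReal q * ∫⁻ a in A, ENNReal.ofReal ‖crossNormal (fderiv ℝ φ a)‖ ≤
        μHE[n] (φ '' A) := by
  set N : Euc n → Euc (n + 1) := fun a => crossNormal (fderiv ℝ φ a) with hN
  have hNc : Continuous N := continuous_crossNormal.comp (hφ.continuous_fderiv one_ne_zero)
  have hN0 : 0 < ‖N a₀‖ := norm_pos_iff.2 h₀
  set ν : Euc (n + 1) := ‖N a₀‖⁻¹ • N a₀ with hν
  obtain ⟨P, hP, -, -, hdet⟩ := exists_projection (ν := ν)
    (by rw [norm_smul, norm_inv, norm_norm, inv_mul_cancel₀ hN0.ne'])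
  have hNν : inner ℝ (N a₀) ν = ‖N a₀‖ := by
    rw [hν, inner_smul_right, real_inner_self_eq_norm_sq]
    field_simp
  have hd0 : (P.comp (fderiv ℝ φ a₀)).det ≠ 0 := by
    rw [← abs_pos, hdet]
    show 0 < |inner ℝ (N a₀) ν|
    rw [hNν, abs_of_pos hN0]
    exact hN0
  -- Projecting along the normal at `a₀` makes the surface locally a graph: `P ∘ φ` is a local
  -- diffeomorphism, which gives injectivity of `φ` nearby.
  have hst : HasStrictFDerivAt (fun a => P (φ a))
      (((P.comp (fderiv ℝ φ a₀)).toContinuousLinearEquivOfDetNeZero hd0 : Euc n ≃L[ℝ] Euc n) :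
        Euc n →L[ℝ] Euc n) a₀ := by
    rw [ContinuousLinearMap.coe_toContinuousLinearEquivOfDetNeZero]
    exact P.hasStrictFDerivAt.comp a₀ (hφ.contDiffAt.hasStrictFDerivAt one_ne_zero)
  set e := hst.toOpenPartialHomeomorph with he
  -- Near `a₀` the normal has turned so little that the Jacobian of `P ∘ φ` is at least `q ‖N a‖`.
  -- The change of variables formula and the 1-Lipschitz bound on `P` then yield the area estimate.
  have hopen : IsOpen {a | q * ‖N a‖ < inner ℝ (N a) ν} :=
    isOpen_lt (by fun_prop) (by fun_prop)
  refine ⟨e.source ∩ {a | q * ‖N a‖ < inner ℝ (N a) ν}, e.open_source.inter hopen,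
    ⟨hst.mem_toOpenPartialHomeomorph_source, ?_⟩, ?_, ?_⟩
  · show q * ‖N a₀‖ < inner ℝ (N a₀) ν
    rw [hNν]
    exact mul_lt_of_lt_one_left hN0 hq
  · intro a ha a' ha' haa
    exact e.injOn ha.1 ha'.1 (congrArg P haa)
  · intro A hA hAm
    have hinj : InjOn (fun a => P (φ a)) A := fun a ha a' ha' haa =>
      e.injOn (hA ha).1 (hA ha').1 haa
    have hd : ∀ a ∈ A, HasFDerivWithinAt (fun a => P (φ a)) (P.comp (fderiv ℝ φ a)) A a :=
      fun a _ => (P.hasFDerivAt.comp a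
        (hφ.differentiable one_ne_zero a).hasFDerivAt).hasFDerivWithinAt
    calc ENNReal.ofReal q * ∫⁻ a in A, ENNReal.ofReal ‖N a‖
        = ∫⁻ a in A, ENNReal.ofReal q * ENNReal.ofReal ‖N a‖ :=
          (lintegral_const_mul _ (by fun_prop)).symm
      _ ≤ ∫⁻ a in A, ENNReal.ofReal |(P.comp (fderiv ℝ φ a)).det| := by
          refine setLIntegral_mono' hAm fun a ha => ?_
          rw [hdet, ← ENNReal.ofReal_mul' (norm_nonneg _)]
          exact ENNReal.ofReal_le_ofReal ((hA ha).2.le.trans (le_abs_self _))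
      _ = volume ((fun a => P (φ a)) '' A) :=
          lintegral_abs_det_fderiv_eq_addHaar_image _ hAm hd hinj
      _ = μHE[n] (P '' (φ '' A)) := by
          rw [image_image, EuclideanSpace.euclideanHausdorffMeasure_eq_volume]
      _ ≤ μHE[n] (φ '' A) := euclideanHausdorffMeasure_image_le hP n _

/-- The regular points of a `C¹` map are covered by countably many open sets on which
`exists_area_le` holds. -/
theorem exists_regular_cover {φ : Euc n → Euc (n + 1)} (hφ : ContDiff ℝ 1 φ) {q : ℝ} (hq : q < 1) :
    ∃ U : ℕ → Set (Euc n), {a | crossNormal (fderiv ℝ φ a) ≠ 0} ⊆ ⋃ i, U i ∧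
      ∀ i, IsOpen (U i) ∧ InjOn φ (U i) ∧ ∀ A ⊆ U i, MeasurableSet A →
        ENNReal.ofReal q * ∫⁻ a in A, ENNReal.ofReal ‖crossNormal (fderiv ℝ φ a)‖ ≤
          μHE[n] (φ '' A) := by
  set S : Set (Euc n) := {a | crossNormal (fderiv ℝ φ a) ≠ 0} with hS
  -- A countable family of centers can be enumerated by `ℕ` only if it is nonempty.
  rcases S.eq_empty_or_nonempty with hS0 | hSn
  · refine ⟨fun _ => ∅, by simp [hS0], fun i => ⟨isOpen_empty, by simp, fun A hA _ => ?_⟩⟩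
    rw [subset_empty_iff] at hA
    simp [hA]
  choose! U hU using fun a (ha : a ∈ S) => exists_area_le hφ ha hq
  obtain ⟨t, htS, htc, ht⟩ := TopologicalSpace.countable_cover_nhdsWithin
    (f := U) (s := S) fun a ha => mem_nhdsWithin_of_mem_nhds ((hU a ha).1.mem_nhds (hU a ha).2.1)
  have htn : t.Nonempty := by
    by_contra h
    rw [not_nonempty_iff_eq_empty] at h
    obtain ⟨a, ha⟩ := hSn
    simpa [h] using ht ha
  obtain ⟨c, rfl⟩ := htc.exists_eq_range htn
  refine ⟨fun i => U (c i), ?_, fun i => ?_⟩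
  · simpa using ht
  · have := hU (c i) (htS (mem_range_self i))
    exact ⟨this.1, this.2.2⟩

theorem sweep_mono {E : Type*} [AddCommGroup E] [Module ℝ E] {K K' : Set E} (h : K ⊆ K') (ξ : E) :
    sweep K ξ ⊆ sweep K' ξ :=
  fun _ ⟨s, hs, hx⟩ => ⟨s, hs, h hx⟩

theorem sweep_iUnion {E ι : Type*} [AddCommGroup E] [Module ℝ E] (K : ι → Set E) (ξ : E) :
    sweep (⋃ i, K i) ξ = ⋃ i, sweep (K i) ξ := by
  ext x
  simp only [sweep, mem_iUnion, mem_ofPred_eq]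
  exact ⟨fun ⟨s, hs, i, hi⟩ => ⟨i, s, hs, hi⟩, fun ⟨i, s, hs, hi⟩ => ⟨s, hs, i, hi⟩⟩

/-- A Crofton-type inequality: the weighted mean volume swept by a rectifiable set is bounded by its
Hausdorff measure. -/
theorem lintegral_volume_sweep_le {w : Euc (n + 1) → ℝ≥0∞} (hw : Measurable w) {c : ℝ≥0∞}
    (hwc : ∀ N : Euc (n + 1), ∫⁻ ξ, w ξ * ENNReal.ofReal |inner ℝ N ξ| ≤ c * ENNReal.ofReal ‖N‖)
    {K : Set (Euc (n + 1))} (hK : MeasurableSet K) {φ : ℕ → Euc n → Euc (n + 1)}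
    (hφ : ∀ m, ContDiff ℝ 1 (φ m)) (hKφ : μHE[n] (K \ ⋃ m, range (φ m)) = 0) :
    ∫⁻ ξ, w ξ * volume (sweep K ξ) ≤ c * μHE[n] K := by
  -- The local area estimate loses a factor `q < 1`, which is arbitrary and is removed here.
  refine ENNReal.le_of_forall_lt_one_mul_le fun q' hq' => ?_
  have hqtop : q' ≠ ⊤ := (hq'.trans ENNReal.one_lt_top).ne
  set q : ℝ := q'.toReal with hqdef
  have hqq : q' = ENNReal.ofReal q := (ENNReal.ofReal_toReal hqtop).symm
  have hq : q < 1 := by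
    have := (ENNReal.toReal_lt_toReal hqtop ENNReal.one_ne_top).2 hq'
    simpa using this
  rw [hqq]
  choose U hUcov hU using fun m => exists_regular_cover (hφ m) hq
  set V : ℕ → Set (Euc (n + 1)) := fun p => φ p.unpair.1 '' U p.unpair.1 p.unpair.2 with hV
  have hVm : ∀ p, MeasurableSet (V p) := fun p =>
    (hU _ _).1.measurableSet.image_of_continuousOn_injOn (hφ _).continuous.continuousOn (hU _ _).2.1
  -- The chart images overlap, also between different surfaces. Making them disjoint ensures that no
  -- part of `K` is counted twice when the Hausdorff measures are added.
  set Kp : ℕ → Set (Euc (n + 1)) := fun p => K ∩ disjointed V p with hKp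
  have hKpm : ∀ p, MeasurableSet (Kp p) := fun p => hK.inter (MeasurableSet.disjointed hVm p)
  set A : ℕ → Set (Euc n) := fun p => U p.unpair.1 p.unpair.2 ∩ φ p.unpair.1 ⁻¹' Kp p with hA
  have hAm : ∀ p, MeasurableSet (A p) := fun p =>
    (hU _ _).1.measurableSet.inter ((hφ _).continuous.measurable (hKpm p))
  have hAK : ∀ p, φ p.unpair.1 '' A p = Kp p := by
    intro p
    rw [hA, image_inter_preimage]
    exact inter_eq_self_of_subset_right (inter_subset_right.trans (disjointed_subset V p))
  -- At critical parameters the sweeping Jacobian vanishes for every `ξ`, so their image sweeps a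
  -- null set.
  set Z : ℕ → Set (Euc n) := fun m => {a | crossNormal (fderiv ℝ (φ m) a) = 0} with hZ
  have hNc : ∀ m, Continuous fun a => crossNormal (fderiv ℝ (φ m) a) := fun m =>
    continuous_crossNormal.comp ((hφ m).continuous_fderiv one_ne_zero)
  have hZm : ∀ m, MeasurableSet (Z m) := fun m =>
    (isClosed_eq (hNc m) continuous_const).measurableSet
  have hcover : K ⊆ (K \ ⋃ m, range (φ m)) ∪ ((⋃ m, φ m '' Z m) ∪ ⋃ p, Kp p) := by
    intro x hx
    by_cases h1 : x ∈ ⋃ m, range (φ m)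
    · right
      obtain ⟨m, a, rfl⟩ := mem_iUnion.1 h1
      by_cases h2 : crossNormal (fderiv ℝ (φ m) a) = 0
      · exact Or.inl (mem_iUnion.2 ⟨m, a, h2, rfl⟩)
      · right
        obtain ⟨i, hi⟩ := mem_iUnion.1 (hUcov m h2)
        have h3 : φ m a ∈ ⋃ p, V p :=
          mem_iUnion.2 ⟨Nat.pair m i, by
            simp only [hV, Nat.unpair_pair]
            exact ⟨a, hi, rfl⟩⟩
        rw [← iUnion_disjointed] at h3
        obtain ⟨p, hp⟩ := mem_iUnion.1 h3
        exact mem_iUnion.2 ⟨p, hx, hp⟩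
    · exact Or.inl ⟨hx, h1⟩
  have hsum : ∑' p, μHE[n] (Kp p) ≤ μHE[n] K := by
    rw [← measure_iUnion (fun i j hij => ((disjoint_disjointed V) hij).mono inter_subset_right
      inter_subset_right) hKpm]
    exact measure_mono (iUnion_subset fun p => inter_subset_left)
  have hpt : ∀ᵐ ξ : Euc (n + 1), w ξ * volume (sweep K ξ) ≤
      ∑' p, ∫⁻ a in A p, w ξ *
        ENNReal.ofReal |inner ℝ (crossNormal (fderiv ℝ (φ p.unpair.1) a)) ξ| := by
    filter_upwards [Measure.ae_ne volume (0 : Euc (n + 1))] with ξ hξ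
    have h1 : volume (sweep K ξ) ≤ ∑' p, ∫⁻ a in A p,
        ENNReal.ofReal |inner ℝ (crossNormal (fderiv ℝ (φ p.unpair.1) a)) ξ| := by
      calc volume (sweep K ξ)
          ≤ volume (sweep (K \ ⋃ m, range (φ m)) ξ ∪
              ((⋃ m, sweep (φ m '' Z m) ξ) ∪ ⋃ p, sweep (Kp p) ξ)) := by
            refine measure_mono ((sweep_mono hcover ξ).trans ?_)
            rintro x ⟨s, hs, hx⟩
            rw [← sweep_iUnion, ← sweep_iUnion]
            rcases hx with hx | hx | hx
            · exact Or.inl ⟨s, hs, hx⟩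
            · exact Or.inr (Or.inl ⟨s, hs, hx⟩)
            · exact Or.inr (Or.inr ⟨s, hs, hx⟩)
        _ ≤ 0 + (0 + ∑' p, volume (sweep (Kp p) ξ)) := by
            refine (measure_union_le _ _).trans (add_le_add (volume_sweep_eq_zero hKφ hξ).le
              ((measure_union_le _ _).trans (add_le_add ?_ (measure_iUnion_le _))))
            refine (measure_iUnion_null fun m => ?_).le
            refine le_antisymm ((volume_sweep_image_le (hφ m) (hZm m) ξ).trans ?_) zero_le
            refine (setLIntegral_congr_fun (hZm m) (g := fun _ => 0) fun a ha => ?_).trans_le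
              (by simp)
            have ha : crossNormal (fderiv ℝ (φ m) a) = 0 := ha
            simp [ha]
        _ ≤ _ := by
            rw [zero_add, zero_add]
            refine ENNReal.tsum_le_tsum fun p => ?_
            rw [← hAK p]
            exact volume_sweep_image_le (hφ _) (hAm p) ξ
    refine (mul_le_mul_right h1 (w ξ)).trans_eq ?_
    rw [← ENNReal.tsum_mul_left]
    refine tsum_congr fun p => ?_
    rw [lintegral_const_mul]
    exact ((hNc p.unpair.1).inner continuous_const).abs.measurable.ennreal_ofReal
  have hmeas : ∀ p : ℕ, Measurable fun z : Euc (n + 1) × Euc n => w z.1 *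
        ENNReal.ofReal |inner ℝ (crossNormal (fderiv ℝ (φ p.unpair.1) z.2)) z.1| := by
    intro p
    exact (hw.comp measurable_fst).mul
      (((hNc p.unpair.1).comp continuous_snd).inner continuous_fst).abs.measurable.ennreal_ofReal
  calc ENNReal.ofReal q * ∫⁻ ξ, w ξ * volume (sweep K ξ)
      ≤ ENNReal.ofReal q * ∫⁻ ξ, ∑' p, ∫⁻ a in A p, w ξ *
        ENNReal.ofReal |inner ℝ (crossNormal (fderiv ℝ (φ p.unpair.1) a)) ξ| := by
        exact mul_le_mul_right (lintegral_mono_ae hpt) _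
    _ = ENNReal.ofReal q * ∑' p, ∫⁻ a in A p, ∫⁻ ξ, w ξ *
        ENNReal.ofReal |inner ℝ (crossNormal (fderiv ℝ (φ p.unpair.1) a)) ξ| := by
        -- Integrating in `ξ` first, with the surface point fixed, is what allows `hwc` to be
        -- applied to a single normal vector.
        rw [lintegral_tsum fun p => ((hmeas p).lintegral_prod_right').aemeasurable]
        congr 1
        refine tsum_congr fun p => ?_
        exact lintegral_lintegral_swap (hmeas p).aemeasurable
    _ ≤ ENNReal.ofReal q * ∑' p, ∫⁻ a in A p, c *
        ENNReal.ofReal ‖crossNormal (fderiv ℝ (φ p.unpair.1) a)‖ := by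
        gcongr with p
        exact hwc _
    _ = c * ∑' p, ENNReal.ofReal q * ∫⁻ a in A p,
        ENNReal.ofReal ‖crossNormal (fderiv ℝ (φ p.unpair.1) a)‖ := by
        rw [ENNReal.tsum_mul_left, mul_left_comm, ← ENNReal.tsum_mul_left (a := c)]
        congr 1
        refine tsum_congr fun p => ?_
        rw [lintegral_const_mul]
        exact (hNc p.unpair.1).norm.measurable.ennreal_ofReal
    _ ≤ c * ∑' p, μHE[n] (Kp p) := by
        gcongr with p
        rw [← hAK p]
        exact (hU _ _).2.2 _ inter_subset_left (hAm p)
    _ ≤ c * μHE[n] K := by gcongr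

end Normal

/-! ### Finite differences of functions whose derivative along a direction is a measure -/

section LineAverage

variable {E : Type*} [NormedAddCommGroup E] [NormedSpace ℝ E]

/-- The average of `ψ` over the segment from `x - ξ` to `x`. -/
def lineAverage (ξ : E) (ψ : E → ℝ) (x : E) : ℝ :=
  ∫ s in (0 : ℝ)..1, ψ (x - s • ξ)

theorem hasCompactSupport_lineAverage (ξ : E) {ψ : E → ℝ}
    (hψc : HasCompactSupport ψ) : HasCompactSupport (lineAverage ξ ψ) := by
  have hK : IsCompact ((fun z : E × ℝ => z.1 + z.2 • ξ) '' (tsupport ψ ×ˢ Icc (0 : ℝ) 1)) :=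
    (IsCompact.prod hψc isCompact_Icc).image (by fun_prop)
  refine HasCompactSupport.intro hK fun x hx => ?_
  rw [lineAverage, intervalIntegral.integral_of_le zero_le_one]
  refine setIntegral_eq_zero_of_forall_eq_zero fun s hs => ?_
  refine image_eq_zero_of_notMem_tsupport fun hs' => hx ?_
  exact ⟨(x - s • ξ, s), ⟨hs', hs.1.le, hs.2⟩, by simp⟩

end LineAverage

section TestFunctions

variable {E : Type*} [NormedAddCommGroup E] [NormedSpace ℝ E] [FiniteDimensional ℝ E]

/-- Smooth compactly supported cutoff functions. -/
theorem exists_cutoff {C U : Set E} (hC : IsCompact C) (hU : IsOpen U) (hCU : C ⊆ U) :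
    ∃ χ : E → ℝ, ContDiff ℝ ∞ χ ∧ HasCompactSupport χ ∧ tsupport χ ⊆ U ∧
      (∀ x, 0 ≤ χ x ∧ χ x ≤ 1) ∧ ∀ x ∈ C, ∀ᶠ y in 𝓝 x, χ y = 1 := by
  obtain ⟨δ, hδ, hδU⟩ := hC.exists_cthickening_subset_open hU hCU
  obtain ⟨χ, h1, h2, h3, h4⟩ := exists_contMDiff_support_eq_eq_one_iff (n := (⊤ : ℕ∞))
    (modelWithCornersSelf ℝ E) (s := Metric.thickening δ C) (t := Metric.cthickening (δ / 2) C)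
    Metric.isOpen_thickening Metric.isClosed_cthickening
    (Metric.cthickening_subset_thickening' hδ (by linarith) C)
  have hts : tsupport χ ⊆ Metric.cthickening δ C := by
    rw [tsupport, h3]
    exact Metric.closure_thickening_subset_cthickening δ C
  refine ⟨χ, contMDiff_iff_contDiff.1 h1, ?_, hts.trans hδU, fun x => h2 (mem_range_self x),
    fun x hx => ?_⟩
  · exact hC.cthickening.of_isClosed_subset (isClosed_tsupport χ) hts
  · have : Metric.thickening (δ / 2) C ∈ 𝓝 x :=
      Metric.isOpen_thickening.mem_nhds (Metric.self_subset_thickening (by linarith) C hx)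
    filter_upwards [this] with y hy
    exact (h4 y).1 (Metric.thickening_subset_cthickening _ _ hy)

variable [MeasurableSpace E] [BorelSpace E]

/-- Finite measures are determined by their integrals against smooth compactly supported
functions. -/
theorem measure_ext_of_integral_contDiff {μ ν : Measure E} [IsFiniteMeasure μ] [IsFiniteMeasure ν]
    (h : ∀ ψ : E → ℝ, ContDiff ℝ ∞ ψ → HasCompactSupport ψ → ∫ x, ψ x ∂μ = ∫ x, ψ x ∂ν) :
    μ = ν := by
  have hopen : ∀ U : Set E, IsOpen U → μ U = ν U := by
    intro U hU
    -- The indicator of an open set is the pointwise limit of cutoffs equal to one on an increasing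
    -- compact exhaustion. Open sets form a `π`-system generating the Borel sets, so agreement on
    -- them is enough.
    obtain ⟨F, hFc, hFU, hFun, hFm⟩ := hU.exists_iUnion_isClosed
    have hC : ∀ n : ℕ, IsCompact (F n ∩ Metric.closedBall 0 n) := fun n =>
      (isCompact_closedBall (0 : E) (n : ℝ)).inter_left (hFc n)
    choose χ hχ1 hχ2 hχ3 hχ4 hχ5 using fun n : ℕ =>
      exists_cutoff (hC n) hU (inter_subset_left.trans (hFU n))
    have hlim : ∀ x, Tendsto (fun n => χ n x) atTop (𝓝 (U.indicator (fun _ => (1 : ℝ)) x)) := by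
      intro x
      by_cases hx : x ∈ U
      · rw [indicator_of_mem hx]
        obtain ⟨m, hm⟩ := mem_iUnion.1 (hFun ▸ hx : x ∈ ⋃ n, F n)
        refine tendsto_const_nhds.congr' ?_
        filter_upwards [eventually_ge_atTop m, eventually_ge_atTop ⌈‖x‖⌉₊] with n hn hn'
        refine ((hχ5 n x ⟨hFm hn hm, ?_⟩).self_of_nhds).symm
        rw [mem_closedBall_zero_iff]
        exact (Nat.le_ceil _).trans (Nat.cast_le.2 hn')
      · rw [indicator_of_notMem hx]
        refine tendsto_const_nhds.congr fun n => ?_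
        exact (image_eq_zero_of_notMem_tsupport fun h' => hx (hχ3 n h')).symm
    have key : ∀ (κ : Measure E) [IsFiniteMeasure κ],
        Tendsto (fun n => ∫ x, χ n x ∂κ) atTop (𝓝 (κ.real U)) := by
      intro κ _
      have h1 := tendsto_integral_of_dominated_convergence (μ := κ) (fun _ => (1 : ℝ))
        (F := χ) (f := U.indicator fun _ => (1 : ℝ))
        (fun n => (hχ1 n).continuous.aestronglyMeasurable) (integrable_const _)
        (fun n => Eventually.of_forall fun x => by
          rw [Real.norm_of_nonneg (hχ4 n x).1]
          exact (hχ4 n x).2)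
        (Eventually.of_forall hlim)
      rwa [integral_indicator hU.measurableSet, setIntegral_const, smul_eq_mul, mul_one] at h1
    have h2 := tendsto_nhds_unique (key μ)
      ((key ν).congr fun n => (h _ (hχ1 n) (hχ2 n)).symm)
    rw [← ofReal_measureReal, ← ofReal_measureReal, h2]
  refine ext_of_generate_finite {U : Set E | IsOpen U} ?_ ?_ (fun U hU => hopen U hU)
    (hopen _ isOpen_univ)
  · exact BorelSpace.measurable_eq
  · exact fun s hs t ht _ => IsOpen.inter hs ht

/-- Written as a convolution with the uniform measure on the segment from `0` to `ξ`, the average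
visibly inherits smoothness. -/
theorem lineAverage_eq_convolution (ξ : E) {ψ : E → ℝ} (hψ : Continuous ψ) :
    lineAverage ξ ψ = convolution (fun _ : E => (1 : ℝ)) ψ (ContinuousLinearMap.mul ℝ ℝ)
      ((volume.restrict (Ioc (0 : ℝ) 1)).map (fun s => s • ξ)) := by
  ext x
  rw [convolution, integral_map (by fun_prop) (by fun_prop), lineAverage,
    intervalIntegral.integral_of_le zero_le_one]
  simp

theorem contDiff_lineAverage (ξ : E) {ψ : E → ℝ} (hψ : ContDiff ℝ ∞ ψ)
    (hψc : HasCompactSupport ψ) : ContDiff ℝ ∞ (lineAverage ξ ψ) := by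
  rw [lineAverage_eq_convolution ξ hψ.continuous]
  exact hψc.contDiff_convolution_right _ (locallyIntegrable_const 1) hψ

/-- Along `ξ` the average is an integral over the moving window `[τ - 1, τ]`, so the fundamental
theorem of calculus applies at both ends. Averaged test functions thus turn a distributional
derivative along `ξ` into a finite difference. -/
theorem fderiv_lineAverage (ξ : E) {ψ : E → ℝ} (hψ : ContDiff ℝ ∞ ψ)
    (hψc : HasCompactSupport ψ) (x : E) :
    fderiv ℝ (lineAverage ξ ψ) x ξ = ψ x - ψ (x - ξ) := by
  have hd : DifferentiableAt ℝ (lineAverage ξ ψ) x :=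
    (contDiff_lineAverage ξ hψ hψc).differentiable (by simp) x
  have h1 : HasDerivAt (fun τ : ℝ => lineAverage ξ ψ (x + τ • ξ))
      (fderiv ℝ (lineAverage ξ ψ) x ξ) 0 := by
    have h2 : HasDerivAt (fun τ : ℝ => x + τ • ξ) ξ 0 := by
      simpa using ((hasDerivAt_id (0 : ℝ)).smul_const ξ).const_add x
    have h3 : HasFDerivAt (lineAverage ξ ψ) (fderiv ℝ (lineAverage ξ ψ) x)
        (x + (0 : ℝ) • ξ) := by
      simpa using hd.hasFDerivAt
    exact h3.comp_hasDerivAt 0 h2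
  have hc : Continuous fun σ : ℝ => ψ (x + σ • ξ) := hψ.continuous.comp (by fun_prop)
  have h4 : (fun τ : ℝ => lineAverage ξ ψ (x + τ • ξ)) =
      fun τ => (∫ σ in (0 : ℝ)..τ, ψ (x + σ • ξ)) - ∫ σ in (0 : ℝ)..(τ - 1), ψ (x + σ • ξ) := by
    ext τ
    rw [intervalIntegral.integral_interval_sub_left (hc.intervalIntegrable _ _)
      (hc.intervalIntegrable _ _), lineAverage]
    have h5 := intervalIntegral.integral_comp_sub_left (a := 0) (b := 1)
      (fun σ : ℝ => ψ (x + σ • ξ)) τ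
    rw [sub_zero] at h5
    rw [← h5]
    refine intervalIntegral.integral_congr fun s _ => ?_
    show ψ (x + τ • ξ - s • ξ) = ψ (x + (τ - s) • ξ)
    rw [sub_smul, add_sub_assoc]
  rw [h4] at h1
  have h6 : HasDerivAt (fun τ : ℝ => ∫ σ in (0 : ℝ)..τ, ψ (x + σ • ξ)) (ψ x) 0 := by
    have := intervalIntegral.integral_hasDerivAt_right (hc.intervalIntegrable 0 0)
      (hc.stronglyMeasurableAtFilter _ _) hc.continuousAt
    simpa using this
  have h7 : HasDerivAt (fun τ : ℝ => ∫ σ in (0 : ℝ)..(τ - 1), ψ (x + σ • ξ)) (ψ (x - ξ)) 0 := by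
    have h8 := intervalIntegral.integral_hasDerivAt_right (hc.intervalIntegrable 0 ((0 : ℝ) - 1))
      (hc.stronglyMeasurableAtFilter _ _) hc.continuousAt
    have h9 := HasDerivAt.comp (h₂ := fun τ : ℝ => ∫ σ in (0 : ℝ)..τ, ψ (x + σ • ξ))
      (h := fun τ : ℝ => τ - 1) 0 h8 ((hasDerivAt_id (0 : ℝ)).sub_const 1)
    simpa [Function.comp_def, sub_eq_add_neg] using h9
  exact h1.unique (h6.sub h7)

end TestFunctions

section Difference

variable {d : ℕ}

/-- Integration against a measure spread along the segment from `-ξ` to `0`. -/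
theorem integral_map_sub_smul (ξ : Euc d) {κ : Measure (Euc d)} [IsFiniteMeasure κ] {ψ : Euc d → ℝ}
    (hψ : Continuous ψ) (hψc : HasCompactSupport ψ) :
    ∫ x, ψ x ∂(((volume.restrict (Ioc (0 : ℝ) 1)).prod κ).map (fun z => z.2 - z.1 • ξ)) =
      ∫ p, lineAverage ξ ψ p ∂κ := by
  obtain ⟨M, hM⟩ := hψc.exists_bound_of_continuous hψ
  rw [integral_map (by fun_prop) hψ.aestronglyMeasurable, integral_prod_symm]
  · refine integral_congr_ae (Eventually.of_forall fun p => ?_)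
    simp only [lineAverage]
    rw [intervalIntegral.integral_of_le zero_le_one]
  · exact Integrable.of_bound (C := M) (Continuous.aestronglyMeasurable (by fun_prop))
      (Eventually.of_forall fun z => hM _)

theorem map_sub_smul_apply_eq_zero (ξ : Euc d) {κ : Measure (Euc d)} [IsFiniteMeasure κ]
    {B : Set (Euc d)} (hB : MeasurableSet B)
    (hκB : ∀ᵐ p ∂κ, ∀ s ∈ Icc (0 : ℝ) 1, p - s • ξ ∈ B) :
    (((volume.restrict (Ioc (0 : ℝ) 1)).prod κ).map (fun z => z.2 - z.1 • ξ)) Bᶜ = 0 := by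
  have hm : Measurable fun z : ℝ × Euc d => z.2 - z.1 • ξ := by fun_prop
  rw [Measure.map_apply hm hB.compl, Measure.measure_prod_null (hm hB.compl)]
  filter_upwards [ae_restrict_mem measurableSet_Ioc] with s hs
  refine measure_mono_null (fun p hp => ?_) (ae_iff.1 hκB)
  intro h
  exact hp (h s ⟨hs.1.le, hs.2⟩)

/-- The shear `(s, x) ↦ (s, x + s ξ)` preserves the product measure. -/
theorem integrable_shift (ξ : Euc d) {h : Euc d → ℝ} (hh : Integrable h) :
    Integrable (fun z : ℝ × Euc d => h (z.2 + z.1 • ξ))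
      ((volume.restrict (Ioc (0 : ℝ) 1)).prod volume) := by
  have hmp : MeasurePreserving (fun z : ℝ × Euc d => (z.1, z.2 + z.1 • ξ))
      ((volume.restrict (Ioc (0 : ℝ) 1)).prod volume)
      ((volume.restrict (Ioc (0 : ℝ) 1)).prod volume) :=
    (MeasurePreserving.id _).skew_product (g := fun s x => x + s • ξ) (by fun_prop)
      (Eventually.of_forall fun s => (measurePreserving_add_right volume (s • ξ)).map_eq)
  have h1 := hh.comp_snd (volume.restrict (Ioc (0 : ℝ) 1))
  exact (hmp.integrable_comp h1.aestronglyMeasurable).2 h1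

theorem integrable_shiftAverage (ξ : Euc d) {h : Euc d → ℝ} (hh : Integrable h) :
    Integrable (fun x => ∫ s in (0 : ℝ)..1, h (x + s • ξ)) := by
  simp only [intervalIntegral.integral_of_le zero_le_one]
  exact (integrable_shift ξ hh).integral_prod_right

/-- Forward averaging of `h` is the adjoint of backward averaging of `ψ`, by Fubini and translation
invariance. -/
theorem integral_shiftAverage_mul (ξ : Euc d) {h ψ : Euc d → ℝ} (hh : Integrable h)
    (hψ : Continuous ψ) (hψc : HasCompactSupport ψ) :
    ∫ x, (∫ s in (0 : ℝ)..1, h (x + s • ξ)) * ψ x = ∫ x, h x * lineAverage ξ ψ x := by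
  obtain ⟨M, hM⟩ := hψc.exists_bound_of_continuous hψ
  simp only [lineAverage, intervalIntegral.integral_of_le zero_le_one, ← integral_mul_const,
    ← integral_const_mul]
  rw [← integral_integral_swap (f := fun (s : ℝ) (x : Euc d) => h (x + s • ξ) * ψ x),
    ← integral_integral_swap (f := fun (s : ℝ) (x : Euc d) => h x * ψ (x - s • ξ))]
  · refine integral_congr_ae (Eventually.of_forall fun s => ?_)
    have := integral_sub_right_eq_self (μ := volume)
      (fun x : Euc d => h (x + s • ξ) * ψ x) (s • ξ)
    simpa using this.symm
  · exact (hh.comp_snd _).mul_bdd (c := M)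
      (Continuous.aestronglyMeasurable (by fun_prop)) (Eventually.of_forall fun z => hM _)
  · exact (integrable_shift ξ hh).mul_bdd (c := M)
      (Continuous.aestronglyMeasurable (by fun_prop)) (Eventually.of_forall fun z => hM _)

/-- If the derivative of `w` in the direction `ξ` is the sum of an integrable density `h` and of a
finite measure, then the difference `w(x + ξ) - w(x)` is the integral of `h` over the segment from
`x` to `x + ξ`, for almost every `x` whose segment misses a set carrying the measure. -/
theorem ae_difference_eq (ξ : Euc d) {w h : Euc d → ℝ} (hw : Integrable w) (hh : Integrable h)
    {κ : Measure (Euc d)} [IsFiniteMeasure κ] {g : Euc d → ℝ} (hg : Integrable g κ)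
    {B : Set (Euc d)} (hB : MeasurableSet B)
    (hκB : ∀ᵐ p ∂κ, ∀ s ∈ Icc (0 : ℝ) 1, p - s • ξ ∈ B)
    (hdist : ∀ φ : Euc d → ℝ, ContDiff ℝ ∞ φ → HasCompactSupport φ →
      -∫ x, w x * fderiv ℝ φ x ξ = (∫ x, h x * φ x) + ∫ p, g p * φ p ∂κ) :
    ∀ᵐ x, x ∉ B → w (x + ξ) - w x = ∫ s in (0 : ℝ)..1, h (x + s • ξ) := by
  set F : Euc d → ℝ := fun x => w (x + ξ) - w x - ∫ s in (0 : ℝ)..1, h (x + s • ξ) with hF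
  have hFi : Integrable F := ((hw.comp_add_right ξ).sub hw).sub (integrable_shiftAverage ξ hh)
  have hFψ : ∀ ψ : Euc d → ℝ, ContDiff ℝ ∞ ψ → HasCompactSupport ψ →
      ∫ x, F x * ψ x = ∫ p, g p * lineAverage ξ ψ p ∂κ := by
    intro ψ hψ hψc
    obtain ⟨M, hM⟩ := hψc.exists_bound_of_continuous hψ.continuous
    have hmul : ∀ {v : Euc d → ℝ}, Integrable v → Integrable fun x => v x * ψ x := fun hv =>
      hv.mul_bdd (c := M) hψ.continuous.aestronglyMeasurable (Eventually.of_forall hM)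
    have hmul' : Integrable fun x => w x * ψ (x - ξ) :=
      hw.mul_bdd (c := M) (Continuous.aestronglyMeasurable (by
        have := hψ.continuous
        fun_prop)) (Eventually.of_forall fun x => hM _)
    have h1 := hdist _ (contDiff_lineAverage ξ hψ hψc) (hasCompactSupport_lineAverage ξ hψc)
    simp only [fderiv_lineAverage ξ hψ hψc, mul_sub] at h1
    rw [integral_sub (hmul hw) hmul', ← integral_shiftAverage_mul ξ hh hψ.continuous hψc] at h1
    have h2 : ∫ x, w (x + ξ) * ψ x = ∫ x, w x * ψ (x - ξ) := by
      have := integral_sub_right_eq_self (μ := volume) (fun x : Euc d => w (x + ξ) * ψ x) ξ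
      simpa using this.symm
    have h3 : Integrable fun x => w (x + ξ) * ψ x - w x * ψ x :=
      (hmul (hw.comp_add_right ξ)).sub (hmul hw)
    simp only [hF, sub_mul]
    rw [integral_sub h3 (hmul (integrable_shiftAverage ξ hh)), integral_sub (hmul (hw.comp_add_right ξ)) (hmul hw),
      h2]
    linarith
  have hfin1 : IsFiniteMeasure (volume.withDensity fun x => ENNReal.ofReal (F x)) :=
    isFiniteMeasure_withDensity_ofReal hFi.2
  have hfin2 : IsFiniteMeasure (volume.withDensity fun x => ENNReal.ofReal (-F x)) :=
    isFiniteMeasure_withDensity_ofReal hFi.neg.2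
  have hfin3 : IsFiniteMeasure (κ.withDensity fun x => ENNReal.ofReal (g x)) :=
    isFiniteMeasure_withDensity_ofReal hg.2
  have hfin4 : IsFiniteMeasure (κ.withDensity fun x => ENNReal.ofReal (-g x)) :=
    isFiniteMeasure_withDensity_ofReal hg.neg.2
  -- The positive and negative parts of `g κ`, each spread along the segment from `-ξ` to `0`, so
  -- that uniqueness for positive finite measures can be used.
  set m₁ := ((volume.restrict (Ioc (0 : ℝ) 1)).prod
    (κ.withDensity fun x => ENNReal.ofReal (g x))).map (fun z => z.2 - z.1 • ξ) with hm₁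
  set m₂ := ((volume.restrict (Ioc (0 : ℝ) 1)).prod
    (κ.withDensity fun x => ENNReal.ofReal (-g x))).map (fun z => z.2 - z.1 • ξ) with hm₂
  have hint : ∀ {ν : Measure (Euc d)} {v ψ : Euc d → ℝ}, Integrable v ν → Continuous ψ →
      HasCompactSupport ψ → Integrable (fun x => (ENNReal.ofReal (v x)).toReal * ψ x) ν ∧
      ∫ x, ψ x ∂(ν.withDensity fun x => ENNReal.ofReal (v x)) =
        ∫ x, (ENNReal.ofReal (v x)).toReal * ψ x ∂ν := by
    intro ν v ψ hv hψ hψc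
    obtain ⟨M, hM⟩ := hψc.exists_bound_of_continuous hψ
    refine ⟨?_, ?_⟩
    · have h1 : Integrable (fun x => (ENNReal.ofReal (v x)).toReal) ν := by
        simp only [ENNReal.toReal_ofReal']
        exact hv.pos_part
      exact h1.mul_bdd (c := M) hψ.aestronglyMeasurable (Eventually.of_forall hM)
    · rw [integral_withDensity_eq_integral_toReal_smul₀ hv.aemeasurable.ennreal_ofReal
        (Eventually.of_forall fun x => ENNReal.ofReal_lt_top)]
      rfl
  have hpos : ∀ t : ℝ, (ENNReal.ofReal t).toReal - (ENNReal.ofReal (-t)).toReal = t := by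
    intro t
    rw [ENNReal.toReal_ofReal', ENNReal.toReal_ofReal', max_zero_sub_eq_self]
  have hdiff : ∀ {ν : Measure (Euc d)} {v ψ : Euc d → ℝ}, Integrable v ν → Continuous ψ →
      HasCompactSupport ψ →
      ∫ x, ψ x ∂(ν.withDensity fun x => ENNReal.ofReal (v x)) -
        ∫ x, ψ x ∂(ν.withDensity fun x => ENNReal.ofReal (-v x)) = ∫ x, v x * ψ x ∂ν := by
    intro ν v ψ hv hψ hψc
    have h1 := hint hv hψ hψc
    have h2 := hint hv.neg hψ hψc
    simp only [Pi.neg_apply] at h2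
    rw [h1.2, h2.2, ← integral_sub h1.1 h2.1]
    simp only [← sub_mul, hpos]
  have heq : (volume.withDensity fun x => ENNReal.ofReal (F x)) + m₂ =
      (volume.withDensity fun x => ENNReal.ofReal (-F x)) + m₁ := by
    refine measure_ext_of_integral_contDiff fun ψ hψ hψc => ?_
    have hbdd : ∀ (ν : Measure (Euc d)) [IsFiniteMeasure ν], Integrable ψ ν := by
      intro ν _
      exact hψ.continuous.integrable_of_hasCompactSupport hψc
    rw [integral_add_measure (hbdd _) (hbdd _), integral_add_measure (hbdd _) (hbdd _), hm₁, hm₂,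
      integral_map_sub_smul ξ hψ.continuous hψc, integral_map_sub_smul ξ hψ.continuous hψc]
    have h1 := hdiff hFi hψ.continuous hψc
    have h2 := hdiff hg (contDiff_lineAverage ξ hψ hψc).continuous
      (hasCompactSupport_lineAverage ξ hψc)
    rw [hFψ ψ hψ hψc] at h1
    linarith
  have hz₁ : m₁ Bᶜ = 0 := map_sub_smul_apply_eq_zero ξ hB
    ((withDensity_absolutelyContinuous κ _).ae_le hκB)
  have hz₂ : m₂ Bᶜ = 0 := map_sub_smul_apply_eq_zero ξ hB
    ((withDensity_absolutelyContinuous κ _).ae_le hκB)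
  -- The spread measures live on `B`. Off `B` only the densities of the positive and negative parts
  -- of `F` remain, and their equality forces `F = 0`.
  have hres := congrArg (fun ν : Measure (Euc d) => ν.restrict Bᶜ) heq
  simp only [Measure.restrict_add, Measure.restrict_eq_zero.2 hz₁, Measure.restrict_eq_zero.2 hz₂,
    add_zero, restrict_withDensity hB.compl] at hres
  have hFn : AEMeasurable (fun x => ENNReal.ofReal (-F x)) := hFi.aemeasurable.neg.ennreal_ofReal
  rw [withDensity_eq_iff_of_sigmaFinite hFi.aemeasurable.ennreal_ofReal.restrict hFn.restrict,
    Filter.EventuallyEq,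
    ae_restrict_iff' hB.compl] at hres
  filter_upwards [hres] with x hx hxB
  have h0 := hpos (F x)
  rw [hx hxB, sub_self] at h0
  exact sub_eq_zero.1 h0.symm

end Difference

/-! ### Finite differences of displacements of finite fracture energy -/

section Fracture

variable {d : ℕ}

/-- Finite Borel measures are carried by `σ`-compact sets. -/
theorem exists_compact_exhaustion {κ : Measure (Euc d)} [IsFiniteMeasure κ] {K : Set (Euc d)}
    (hK : MeasurableSet K) :
    ∃ C : ℕ → Set (Euc d), (∀ n, IsCompact (C n)) ∧ (⋃ n, C n) ⊆ K ∧ κ (K \ ⋃ n, C n) = 0 := by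
  choose C hCK hC hCm using fun n : ℕ =>
    hK.exists_isCompact_sdiff_lt (measure_ne_top κ K) (ε := ((n : ℝ≥0∞) + 1)⁻¹) (by simp)
  refine ⟨C, hC, iUnion_subset hCK, ?_⟩
  have hle : ∀ n : ℕ, κ (K \ ⋃ n, C n) ≤ ((n : ℝ≥0∞) + 1)⁻¹ := fun n =>
    (measure_mono (sdiff_subset_sdiff_right (subset_iUnion C n))).trans (hCm n).le
  have hlim : Tendsto (fun n : ℕ => ((n : ℝ≥0∞) + 1)⁻¹) atTop (𝓝 0) := by
    have h1 := ENNReal.tendsto_inv_nat_nhds_zero.comp (tendsto_add_atTop_nat 1)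
    refine h1.congr fun n => ?_
    simp
  exact le_antisymm (ge_of_tendsto' hlim hle) zero_le

/-- The region swept by a `σ`-compact set depends measurably on the displacement vector. -/
theorem measurableSet_sweep_prod {C : ℕ → Set (Euc d)} (hC : ∀ n, IsCompact (C n)) :
    MeasurableSet {z : Euc d × Euc d | z.2 ∈ sweep (⋃ n, C n) z.1} := by
  have h1 : {z : Euc d × Euc d | z.2 ∈ sweep (⋃ n, C n) z.1} = ⋃ n, Prod.snd ''
      {y : Icc (0 : ℝ) 1 × (Euc d × Euc d) | y.2.2 + y.1.1 • y.2.1 ∈ C n} := by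
    ext z
    simp only [sweep_iUnion, mem_iUnion, mem_ofPred_eq, mem_image, Prod.exists]
    refine exists_congr fun n => ⟨fun ⟨s, hs, hz⟩ => ⟨⟨s, hs⟩, z.1, z.2, hz, rfl⟩, ?_⟩
    rintro ⟨s, ξ, x, hz, rfl⟩
    exact ⟨s.1, s.2, hz⟩
  rw [h1]
  refine MeasurableSet.iUnion fun n => IsClosed.measurableSet ?_
  refine isClosedMap_snd_of_compactSpace _ ?_
  exact (hC n).isClosed.preimage (by fun_prop)

theorem measurableSet_sweep {C : ℕ → Set (Euc d)} (hC : ∀ n, IsCompact (C n)) (ξ : Euc d) :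
    MeasurableSet (sweep (⋃ n, C n) ξ) :=
  measurable_prodMk_left (x := ξ) (measurableSet_sweep_prod hC)

theorem measurableSet_constraintSet {D : Set (Euc d)} (hD : IsOpen D) (a : ℝ) :
    MeasurableSet (constraintSet D a) :=
  hD.measurableSet.inter
    (isClosed_le (Metric.continuous_infDist_pt _) continuous_const).measurableSet

theorem ae_eq_zero_of_mem_L20 {D : Set (Euc d)} (hD : IsOpen D) {a : ℝ} {u : L2 D}
    (hu : u ∈ L20 D a) :
    ∀ᵐ x ∂(volume.restrict D), x ∈ constraintSet D a → u x = 0 := by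
  have h1 : ∀ᵐ x ∂(volume.restrict (constraintSet D a)), u x = 0 := hu
  rw [ae_restrict_iff' (measurableSet_constraintSet hD a)] at h1
  exact ae_restrict_of_ae h1

theorem isFiniteMeasure_restrict_of_isBounded {D : Set (Euc d)} (hDb : Bornology.IsBounded D) :
    IsFiniteMeasure (volume.restrict D) :=
  ⟨by simpa using hDb.measure_lt_top⟩

theorem integrable_zeroExt {D : Set (Euc d)} (hD : IsOpen D) (hDb : Bornology.IsBounded D)
    (u : L2 D) : Integrable (zeroExt u) := by
  have := isFiniteMeasure_restrict_of_isBounded hDb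
  exact (integrable_indicator_iff hD.measurableSet).2 ((Lp.memLp u).integrable one_le_two)

theorem measurable_zeroExt {D : Set (Euc d)} (hD : IsOpen D) (u : L2 D) :
    Measurable (zeroExt u) :=
  (Lp.stronglyMeasurable u).measurable.indicator hD.measurableSet

theorem quadForm_mul_eq {A : Matrix (Fin d) (Fin d) ℝ} {ξ : Euc d} {c : ℝ} :
    quadForm A ξ * c = ∑ i, ∑ j, (ξ i * ξ j) * (A i j * c) := by
  simp only [quadForm, Finset.sum_mul]
  exact Finset.sum_congr rfl fun i _ => Finset.sum_congr rfl fun j _ => by ring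

/-- The symmetrized distributional gradient of `u₀`, tested along a fixed vector `ξ`. -/
theorem integral_inner_mul_fderiv {D : Set (Euc d)} (hDb : Bornology.IsBounded D)
    {u₀ : L2 D} {E : Euc d → Matrix (Fin d) (Fin d) ℝ}
    (hE : ∀ i j, MemLp (fun x => E x i j) 2 (volume.restrict D))
    {κ : Measure (Euc d)} {G : Euc d → Matrix (Fin d) (Fin d) ℝ}
    (hG : ∀ i j, Integrable (fun x => G x i j) κ)
    {φ : Euc d → ℝ} (hφ : ContDiff ℝ ∞ φ) (hφc : HasCompactSupport φ)
    (h : ∀ i j, -∫ x in D, (u₀ x i * fderiv ℝ φ x (EuclideanSpace.single j 1)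
          + u₀ x j * fderiv ℝ φ x (EuclideanSpace.single i 1)) / 2
        = (∫ x in D, E x i j * φ x) + ∫ x, G x i j * φ x ∂κ) (ξ : Euc d) :
    -∫ x in D, inner ℝ (u₀ x) ξ * fderiv ℝ φ x ξ =
      (∫ x in D, quadForm (E x) ξ * φ x) + ∫ x, quadForm (G x) ξ * φ x ∂κ := by
  have := isFiniteMeasure_restrict_of_isBounded hDb
  obtain ⟨M, hM⟩ := hφc.exists_bound_of_continuous hφ.continuous
  have hdc : ∀ v : Euc d, Continuous fun x => fderiv ℝ φ x v := fun v =>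
    (hφ.continuous_fderiv (by simp)).clm_apply continuous_const
  have hu : ∀ i v, Integrable (fun x => u₀ x i * fderiv ℝ φ x v) (volume.restrict D) := by
    intro i v
    obtain ⟨M', hM'⟩ := (hφc.fderiv_apply (𝕜 := ℝ) v).exists_bound_of_continuous (hdc v)
    have h1 : Integrable (fun x => u₀ x i) (volume.restrict D) :=
      (EuclideanSpace.proj (𝕜 := ℝ) i).integrable_comp ((Lp.memLp u₀).integrable one_le_two)
    exact h1.mul_bdd (c := M') (hdc v).aestronglyMeasurable (Eventually.of_forall hM')
  have hEφ : ∀ i j, Integrable (fun x => E x i j * φ x) (volume.restrict D) := fun i j =>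
    ((hE i j).integrable one_le_two).mul_bdd (c := M) hφ.continuous.aestronglyMeasurable
      (Eventually.of_forall hM)
  have hGφ : ∀ i j, Integrable (fun x => G x i j * φ x) κ := fun i j =>
    (hG i j).mul_bdd (c := M) hφ.continuous.aestronglyMeasurable (Eventually.of_forall hM)
  have hsum : ∀ {ν : Measure (Euc d)} {q : Fin d → Fin d → Euc d → ℝ},
      (∀ i j, Integrable (q i j) ν) → ∫ x, ∑ i, ∑ j, (ξ i * ξ j) * q i j x ∂ν =
        ∑ i, ∑ j, (ξ i * ξ j) * ∫ x, q i j x ∂ν := by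
    intro ν q hq
    rw [integral_finsetSum _ fun i _ => integrable_finsetSum _ fun j _ => (hq i j).const_mul _]
    refine Finset.sum_congr rfl fun i _ => ?_
    rw [integral_finsetSum _ fun j _ => (hq i j).const_mul _]
    exact Finset.sum_congr rfl fun j _ => integral_const_mul _ _
  have hξ : ∀ x, fderiv ℝ φ x ξ = ∑ j, ξ j * fderiv ℝ φ x (EuclideanSpace.single j 1) := by
    intro x
    conv_lhs => rw [← (EuclideanSpace.basisFun (Fin d) ℝ).sum_repr ξ]
    simp
  have hlhs : ∀ x, inner ℝ (u₀ x) ξ * fderiv ℝ φ x ξ = ∑ i, ∑ j, (ξ i * ξ j) *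
      ((u₀ x i * fderiv ℝ φ x (EuclideanSpace.single j 1)
          + u₀ x j * fderiv ℝ φ x (EuclideanSpace.single i 1)) / 2) := by
    intro x
    have h1 : ∑ i, ∑ j, (ξ i * ξ j) * (u₀ x i * fderiv ℝ φ x (EuclideanSpace.single j 1)) =
        inner ℝ (u₀ x) ξ * fderiv ℝ φ x ξ := by
      rw [hξ, PiLp.inner_apply, Finset.sum_mul_sum]
      refine Finset.sum_congr rfl fun i _ => Finset.sum_congr rfl fun j _ => ?_
      simp only [RCLike.inner_apply, conj_trivial]
      ring
    have h2 : ∑ i, ∑ j, (ξ i * ξ j) * (u₀ x j * fderiv ℝ φ x (EuclideanSpace.single i 1)) =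
        inner ℝ (u₀ x) ξ * fderiv ℝ φ x ξ := by
      rw [Finset.sum_comm, ← h1]
      exact Finset.sum_congr rfl fun i _ => Finset.sum_congr rfl fun j _ => by ring
    simp only [mul_div_assoc', mul_add, add_div, Finset.sum_add_distrib, ← Finset.sum_div, h1, h2]
    ring
  simp only [hlhs, quadForm_mul_eq]
  have hq : ∀ i j, Integrable (fun x => (u₀ x i * fderiv ℝ φ x (EuclideanSpace.single j 1)
      + u₀ x j * fderiv ℝ φ x (EuclideanSpace.single i 1)) / 2) (volume.restrict D) :=
    fun i j => ((hu i _).add (hu j _)).div_const 2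
  rw [hsum hq, hsum hEφ, hsum hGφ,
    ← Finset.sum_neg_distrib, ← Finset.sum_add_distrib]
  refine Finset.sum_congr rfl fun i _ => ?_
  rw [← Finset.sum_neg_distrib, ← Finset.sum_add_distrib]
  refine Finset.sum_congr rfl fun j _ => ?_
  rw [← mul_neg, h i j, mul_add]

theorem integrable_quadForm {κ : Measure (Euc d)} {G : Euc d → Matrix (Fin d) (Fin d) ℝ}
    (hG : ∀ i j, Integrable (fun x => G x i j) κ) (ξ : Euc d) :
    Integrable (fun x => quadForm (G x) ξ) κ :=
  integrable_finsetSum _ fun i _ => integrable_finsetSum _ fun j _ => (hG i j).mul_const _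

/-- Off the region swept by the crack set, the difference of a displacement of finite fracture
energy is the line integral of its bulk strain. -/
theorem exists_bulk_strain {D : Set (Euc d)} (hD : IsOpen D) (hDb : Bornology.IsBounded D)
    {a : ℝ} (ha : 0 < a) {u₀ : L2 D} (hu₀ : u₀ ∈ L20 D a)
    {E : Euc d → Matrix (Fin d) (Fin d) ℝ} {K : Set (Euc d)}
    (hK : IsLEFMDisplacement D u₀ E K) :
    ∃ χ : Euc d → ℝ, Continuous χ ∧ (∀ x, 0 ≤ χ x ∧ χ x ≤ 1) ∧
      ∃ C : ℕ → Set (Euc d), (∀ n, IsCompact (C n)) ∧ (⋃ n, C n) ⊆ K ∧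
        ∀ ξ : Euc d, ∀ᵐ x, x ∉ sweep (⋃ n, C n) ξ →
          inner ℝ (zeroExt u₀ (x + ξ) - zeroExt u₀ x) ξ =
            ∫ s in (0 : ℝ)..1, χ (x + s • ξ) *
              D.indicator (fun y => quadForm (E y) ξ) (x + s • ξ) := by
  have hfin := isFiniteMeasure_restrict_of_isBounded hDb
  have hκfin : IsFiniteMeasure ((μHE[d - 1] : Measure (Euc d)).restrict K) :=
    ⟨by simpa using hK.crack_finite⟩
  -- Since `u₀` vanishes on the boundary layer, it is carried by this compact subset of `D`. A
  -- cutoff equal to one near it and supported in `D` admits arbitrary test functions on the whole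
  -- space.
  set C₁ : Set (Euc d) := {x | a ≤ Metric.infDist x Dᶜ} with hC₁
  have hC₁D : C₁ ⊆ D := by
    intro x hx
    by_contra hxD
    have h1 : Metric.infDist x Dᶜ = 0 := Metric.infDist_zero_of_mem hxD
    have h2 : a ≤ Metric.infDist x Dᶜ := hx
    linarith
  have hC₁c : IsCompact C₁ := Metric.isCompact_of_isClosed_isBounded
    (isClosed_le continuous_const (Metric.continuous_infDist_pt _)) (hDb.subset hC₁D)
  obtain ⟨χ, hχ, hχc, hχD, hχ01, hχ1⟩ := exists_cutoff hC₁c hD hC₁D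
  -- The crack is replaced by a `σ`-compact part of full measure, because the region swept by that
  -- part is Borel, jointly in `ξ` and `x`.
  obtain ⟨C, hC, hCK, hC0⟩ := exists_compact_exhaustion
    (κ := (μHE[d - 1] : Measure (Euc d)).restrict K) hK.crack_measurable
  refine ⟨χ, hχ.continuous, hχ01, C, hC, hCK, fun ξ => ?_⟩
  obtain ⟨G, hG, hdist⟩ := hK.strain_eq
  have hu₀D := ae_eq_zero_of_mem_L20 hD hu₀
  obtain ⟨M, hM⟩ := hχc.exists_bound_of_continuous hχ.continuous
  have hEi : Integrable (D.indicator fun y => quadForm (E y) ξ) :=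
    (integrable_indicator_iff hD.measurableSet).2
      (integrable_quadForm (fun i j => (hK.strain_memLp i j).integrable one_le_two) ξ)
  have hw : Integrable fun x => inner ℝ (zeroExt u₀ x) ξ :=
    (integrable_zeroExt hD hDb u₀).inner_const ξ
  have key := ae_difference_eq ξ (w := fun x => inner ℝ (zeroExt u₀ x) ξ)
    (h := fun x => χ x * D.indicator (fun y => quadForm (E y) ξ) x) hw
    (hEi.bdd_mul (c := M) hχ.continuous.aestronglyMeasurable (Eventually.of_forall hM))
    (κ := (μHE[d - 1] : Measure (Euc d)).restrict K) (g := fun x => χ x * quadForm (G x) ξ)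
    ((integrable_quadForm hG ξ).bdd_mul (c := M) hχ.continuous.aestronglyMeasurable
      (Eventually.of_forall hM))
    (measurableSet_sweep hC ξ) ?_ ?_
  · filter_upwards [key] with x hx hxK
    rw [inner_sub_left]
    exact hx hxK
  · have h1 : ∀ᵐ p ∂(μHE[d - 1] : Measure (Euc d)).restrict K, p ∉ K \ ⋃ n, C n :=
      measure_eq_zero_iff_ae_notMem.1 hC0
    filter_upwards [h1, ae_restrict_mem hK.crack_measurable] with p hp hpK s hs
    refine ⟨s, hs, ?_⟩
    rw [sub_add_cancel]
    by_contra hpC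
    exact hp ⟨hpK, hpC⟩
  · intro φ hφ hφc
    have hχφ : ContDiff ℝ ∞ fun x => χ x * φ x := hχ.mul hφ
    have hχφc : HasCompactSupport fun x => χ x * φ x := hχc.mul_right
    have h1 := integral_inner_mul_fderiv hDb hK.strain_memLp hG hχφ hχφc
      (hdist _ hχφ hχφc ((tsupport_mul_subset_left).trans hχD)) ξ
    -- Where `u₀` does not vanish, `χ` is one in a neighborhood, so the product with `χ` has the
    -- same gradient as `φ`.
    have h2 : ∫ x in D, inner ℝ (u₀ x) ξ * fderiv ℝ (fun x => χ x * φ x) x ξ =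
        ∫ x, inner ℝ (zeroExt u₀ x) ξ * fderiv ℝ φ x ξ := by
      rw [← integral_indicator hD.measurableSet]
      refine integral_congr_ae ?_
      rw [Filter.EventuallyEq]
      filter_upwards [(ae_restrict_iff' hD.measurableSet).1 hu₀D] with x hx
      by_cases hxD : x ∈ D
      · rw [indicator_of_mem hxD, zeroExt, indicator_of_mem hxD]
        by_cases hxc : x ∈ constraintSet D a
        · rw [hx hxD hxc]
          simp
        · have hx1 : x ∈ C₁ := by
            by_contra h
            exact hxc ⟨hxD, (not_le.1 h).le⟩
          have h3 : (fun x => χ x * φ x) =ᶠ[𝓝 x] φ := by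
            filter_upwards [hχ1 x hx1] with y hy
            rw [hy, one_mul]
          rw [h3.fderiv_eq]
      · rw [indicator_of_notMem hxD, zeroExt, indicator_of_notMem hxD]
        simp
    rw [← h2, h1]
    congr 1
    · rw [← integral_indicator hD.measurableSet]
      refine integral_congr_ae (Eventually.of_forall fun x => ?_)
      by_cases hxD : x ∈ D
      · simp only [indicator_of_mem hxD]
        ring
      · simp only [indicator_of_notMem hxD]
        ring
    · refine integral_congr_ae (Eventually.of_forall fun x => ?_)
      ring

end Fracture

/-! ### The peridynamic energy of a displacement of finite fracture energy -/

section InitialEnergy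

variable {d : ℕ}

/-- The difference of `v` across the bond `ξ`, scaled so that its square is `|ξ| S²`. -/
def bondDifference (v : Euc d → Euc d) (ξ x : Euc d) : ℝ :=
  inner ℝ (v (x + ξ) - v x) ξ / (‖ξ‖ * √‖ξ‖)

theorem bondDifference_sq (v : Euc d → Euc d) (ξ x : Euc d) :
    bondDifference v ξ x ^ 2 = inner ℝ (v (x + ξ) - v x) ξ ^ 2 / ‖ξ‖ ^ 3 := by
  rw [bondDifference, div_pow, mul_pow, Real.sq_sqrt (norm_nonneg ξ), ← pow_succ]

theorem measurable_bondDifference {v : Euc d → Euc d} (hv : Measurable v) :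
    Measurable fun z : Euc d × Euc d => bondDifference v z.1 z.2 := by
  unfold bondDifference
  fun_prop

/-- The peridynamic energy without its normalizing constant. -/
def rawEnergy (ε : ℝ) (J f : ℝ → ℝ) (v : Euc d → Euc d) : ℝ≥0∞ :=
  ∫⁻ ξ, ENNReal.ofReal (J (‖ξ‖ / ε)) * ∫⁻ x, ENNReal.ofReal (f (bondDifference v ξ x ^ 2))

/-- Jensen's inequality for the square, through monotonicity of `L^p` norms on a probability space;
no integrability is needed, as the right side may be infinite. -/
theorem ofReal_integral_sq_le {α : Type*} [MeasurableSpace α] {κ : Measure α}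
    [IsProbabilityMeasure κ] {g : α → ℝ} (hg : AEStronglyMeasurable g κ) :
    ENNReal.ofReal ((∫ s, g s ∂κ) ^ 2) ≤ ∫⁻ s, ENNReal.ofReal (g s ^ 2) ∂κ := by
  have h1 : ∀ y : ℝ, ENNReal.ofReal (y ^ 2) = ‖y‖ₑ ^ 2 := fun y => by
    rw [← sq_abs, ENNReal.ofReal_pow (abs_nonneg y), Real.enorm_eq_ofReal_abs]
  simp only [h1]
  have h2 : eLpNorm g 1 κ ≤ eLpNorm g 2 κ := eLpNorm_le_eLpNorm_of_exponent_le one_le_two hg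
  have h3 : eLpNorm g 2 κ ^ 2 = ∫⁻ s, ‖g s‖ₑ ^ 2 ∂κ := by
    have := eLpNorm_nnreal_pow_eq_lintegral (f := g) (μ := κ) (p := 2) (by simp)
    simpa using this
  calc ‖∫ s, g s ∂κ‖ₑ ^ 2 ≤ (eLpNorm g 1 κ) ^ 2 := by
        gcongr
        rw [eLpNorm_one_eq_lintegral_enorm]
        exact enorm_integral_le_lintegral_enorm g
    _ ≤ (eLpNorm g 2 κ) ^ 2 := by gcongr
    _ = _ := h3

/-- The integrand of the fracture energy only involves the strain up to null sets. -/
theorem IsLEFMDisplacement.exists_measurable {D : Set (Euc d)} {u₀ : Euc d → Euc d}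
    {E : Euc d → Matrix (Fin d) (Fin d) ℝ} {K : Set (Euc d)} (h : IsLEFMDisplacement D u₀ E K)
    (f : ℝ → ℝ) (finf : ℝ) (J : ℝ → ℝ) :
    ∃ E' : Euc d → Matrix (Fin d) (Fin d) ℝ, (∀ i j, Measurable fun x => E' x i j) ∧
      IsLEFMDisplacement D u₀ E' K ∧ LEFM f finf J D E' K = LEFM f finf J D E K := by
  set E' : Euc d → Matrix (Fin d) (Fin d) ℝ := fun x i j =>
    (h.strain_memLp i j).aestronglyMeasurable.mk _ x with hE'
  have hae : ∀ᵐ x ∂(volume.restrict D), E x = E' x := by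
    have h1 : ∀ᵐ x ∂(volume.restrict D), ∀ i j, E x i j = E' x i j :=
      ae_all_iff.2 fun i => ae_all_iff.2 fun j =>
        (h.strain_memLp i j).aestronglyMeasurable.ae_eq_mk
    filter_upwards [h1] with x hx
    ext i j
    exact hx i j
  refine ⟨E', fun i j => (h.strain_memLp i j).aestronglyMeasurable.stronglyMeasurable_mk.measurable,
    ⟨h.crack_subset, h.crack_measurable, h.crack_finite, h.crack_rectifiable, fun i j => ?_, ?_⟩,
    ?_⟩
  · refine (h.strain_memLp i j).ae_eq ?_
    filter_upwards [hae] with x hx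
    rw [hx]
  · obtain ⟨G, hG, hd⟩ := h.strain_eq
    refine ⟨G, hG, fun φ hφ hφc hφD i j => ?_⟩
    rw [hd φ hφ hφc hφD i j]
    congr 1
    refine integral_congr_ae ?_
    filter_upwards [hae] with x hx
    rw [hx]
  · unfold LEFM
    congr 1
    refine integral_congr_ae ?_
    filter_upwards [hae] with x hx
    rw [hx]

theorem measurable_quadForm {E : Euc d → Matrix (Fin d) (Fin d) ℝ}
    (hE : ∀ i j, Measurable fun x => E x i j) :
    Measurable fun z : Euc d × Euc d => quadForm (E z.2) z.1 := by
  unfold quadForm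
  refine Finset.measurable_sum _ fun i _ => Finset.measurable_sum _ fun j _ => ?_
  exact ((hE i j).comp measurable_snd).mul (by fun_prop)

/-- The energy of the bonds along a fixed vector. -/
theorem lintegral_bond_le {f : ℝ → ℝ} {finf : ℝ} (hf : IsCohesivePotential f finf)
    {v : Euc d → Euc d} {χ g : Euc d → ℝ} (hχ : Continuous χ) (hχ01 : ∀ x, 0 ≤ χ x ∧ χ x ≤ 1)
    (hg : Measurable g) {B : Set (Euc d)} (hB : MeasurableSet B) {ξ : Euc d}
    (h : ∀ᵐ x, x ∉ B →
      inner ℝ (v (x + ξ) - v x) ξ = ∫ s in (0 : ℝ)..1, χ (x + s • ξ) * g (x + s • ξ)) :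
    ∫⁻ x, ENNReal.ofReal (f (bondDifference v ξ x ^ 2)) ≤
      ENNReal.ofReal (derivWithin f (Ici 0) 0 / ‖ξ‖ ^ 3) * (∫⁻ x, ENNReal.ofReal (g x ^ 2))
        + ENNReal.ofReal finf * volume B := by
  have hprob : IsProbabilityMeasure (volume.restrict (Ioc (0 : ℝ) 1)) := ⟨by simp⟩
  set c : ℝ := derivWithin f (Ici 0) 0 / ‖ξ‖ ^ 3 with hc
  have hc0 : 0 ≤ c := by have := hf.slope_pos; positivity
  have hgm : Measurable fun z : Euc d × ℝ => ENNReal.ofReal (g (z.1 + z.2 • ξ) ^ 2) := by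
    fun_prop
  have hpt : ∀ᵐ x, ENNReal.ofReal (f (bondDifference v ξ x ^ 2)) ≤
      ENNReal.ofReal c * (∫⁻ s in Ioc (0 : ℝ) 1, ENNReal.ofReal (g (x + s • ξ) ^ 2))
        + B.indicator (fun _ => ENNReal.ofReal finf) x := by
    filter_upwards [h] with x hx
    -- A bond that may cross the crack costs at most `finf`. For any other bond the linear bound on
    -- `f` is quadratic in the strain, and Jensen moves the square inside the average along the
    -- bond.
    by_cases hxB : x ∈ B
    · rw [indicator_of_mem hxB]
      exact (ENNReal.ofReal_le_ofReal (hf.le_finf (sq_nonneg _))).trans le_add_self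
    · rw [indicator_of_notMem hxB, add_zero]
      have h1 : f (bondDifference v ξ x ^ 2) ≤ c * inner ℝ (v (x + ξ) - v x) ξ ^ 2 := by
        refine (hf.le_mul (sq_nonneg _)).trans (le_of_eq ?_)
        rw [bondDifference_sq, hc]
        ring
      refine (ENNReal.ofReal_le_ofReal h1).trans ?_
      rw [ENNReal.ofReal_mul hc0]
      gcongr
      rw [hx hxB, intervalIntegral.integral_of_le zero_le_one]
      refine (ofReal_integral_sq_le ?_).trans (lintegral_mono fun s => ?_)
      · exact Measurable.aestronglyMeasurable (by fun_prop)
      · refine ENNReal.ofReal_le_ofReal ?_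
        rw [mul_pow]
        have h2 := hχ01 (x + s • ξ)
        exact mul_le_of_le_one_left (sq_nonneg _) (pow_le_one₀ h2.1 h2.2)
  refine (lintegral_mono_ae hpt).trans ?_
  rw [lintegral_add_right _ (measurable_const.indicator hB), lintegral_indicator_const hB,
    lintegral_const_mul _ hgm.lintegral_prod_right']
  -- By translation invariance, averaging along the bond disappears after integration over the whole
  -- space.
  refine add_le_add (mul_le_mul_right (le_of_eq ?_) _) le_rfl
  rw [lintegral_lintegral_swap hgm.aemeasurable]
  have h3 : ∀ s : ℝ, ∫⁻ x, ENNReal.ofReal (g (x + s • ξ) ^ 2) = ∫⁻ x, ENNReal.ofReal (g x ^ 2) :=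
    fun s => lintegral_add_right_eq_self (fun x => ENNReal.ofReal (g x ^ 2)) (s • ξ)
  simp [h3]

theorem lameModulus_nonneg {f : ℝ → ℝ} {finf : ℝ} (hf : IsCohesivePotential f finf) {J : ℝ → ℝ}
    (hJ : IsInfluenceFunction J) : 0 ≤ lameModulus d f J := by
  have h1 := hf.slope_pos
  have h2 := hJ.moment_nonneg d
  rw [lameModulus]
  positivity

theorem bulkEnergy_nonneg {f : ℝ → ℝ} {finf : ℝ} (hf : IsCohesivePotential f finf) {J : ℝ → ℝ}
    (hJ : IsInfluenceFunction J) (A : Matrix (Fin d) (Fin d) ℝ) :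
    0 ≤ 2 * lameModulus d f J * (∑ i, ∑ j, A i j ^ 2) + lameModulus d f J * A.trace ^ 2 := by
  have := lameModulus_nonneg (d := d) hf hJ
  positivity

theorem energyReleaseRate_nonneg {f : ℝ → ℝ} {finf : ℝ} (hf : IsCohesivePotential f finf)
    {J : ℝ → ℝ} (hJ : IsInfluenceFunction J) : 0 ≤ energyReleaseRate d finf J := by
  have h1 := hf.finf_nonneg
  have h2 := hJ.moment_nonneg d
  have h3 := unitBallVolume_pos d
  have h4 := unitBallVolume_pos (d - 1)
  rw [energyReleaseRate]
  positivity

theorem LEFM_nonneg {f : ℝ → ℝ} {finf : ℝ} (hf : IsCohesivePotential f finf) {J : ℝ → ℝ}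
    (hJ : IsInfluenceFunction J) (D : Set (Euc d)) (E : Euc d → Matrix (Fin d) (Fin d) ℝ)
    (K : Set (Euc d)) : 0 ≤ LEFM f finf J D E K :=
  add_nonneg (integral_nonneg fun _ => bulkEnergy_nonneg hf hJ _)
    (mul_nonneg (energyReleaseRate_nonneg hf hJ) measureReal_nonneg)

/-- The peridynamic energy is bounded by the fracture energy, uniformly in the horizon. -/
theorem rawEnergy_le_LEFM (hd : d = 2 ∨ d = 3) {f : ℝ → ℝ} {finf : ℝ}
    (hf : IsCohesivePotential f finf) {J : ℝ → ℝ} (hJ : IsInfluenceFunction J) {ε : ℝ} (hε : 0 < ε)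
    {D : Set (Euc d)} (hD : IsOpen D) (hDb : Bornology.IsBounded D)
    {a : ℝ} (ha : 0 < a) {u₀ : L2 D} (hu₀ : u₀ ∈ L20 D a)
    {E : Euc d → Matrix (Fin d) (Fin d) ℝ} {K : Set (Euc d)}
    (hK : IsLEFMDisplacement D u₀ E K) :
    rawEnergy ε J f (zeroExt u₀) ≤
      ENNReal.ofReal (ε ^ (d + 1) * unitBallVolume d * LEFM f finf J D E K) := by
  -- The strain is only almost everywhere measurable; a Borel representative makes the integrands
  -- jointly measurable for Tonelli.
  obtain ⟨E', hE', hK', hEE'⟩ := hK.exists_measurable f finf J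
  rw [← hEE']
  clear hK hEE' E
  obtain ⟨χ, hχ, hχ01, C, hC, hCK, hξ⟩ := exists_bulk_strain hD hDb ha hu₀ hK'
  have hJm := hJ.measurable
  have hωd : 0 < unitBallVolume d := unitBallVolume_pos d
  set I : ℝ := ∫ r in (0 : ℝ)..1, r ^ d * J r with hI
  have hI0 : 0 ≤ I := hJ.moment_nonneg d
  have hf0 := hf.slope_pos
  have hfinf := hf.finf_nonneg
  have hqm := measurable_quadForm hE'
  have hwm : Measurable fun ξ : Euc d => ENNReal.ofReal (J (‖ξ‖ / ε)) := by fun_prop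
  have hsm : Measurable fun ξ : Euc d => volume (sweep (⋃ n, C n) ξ) :=
    measurable_measure_prodMk_left (measurableSet_sweep_prod hC)
  -- the bulk part
  have hbulk : ∫⁻ ξ : Euc d, ENNReal.ofReal (J (‖ξ‖ / ε)) *
      (ENNReal.ofReal (derivWithin f (Ici 0) 0 / ‖ξ‖ ^ 3) *
        ∫⁻ x, ENNReal.ofReal (D.indicator (fun y => quadForm (E' y) ξ) x ^ 2)) ≤
      ENNReal.ofReal (ε ^ (d + 1) * unitBallVolume d *
        ∫ x in D, (2 * lameModulus d f J * (∑ i, ∑ j, E' x i j ^ 2)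
          + lameModulus d f J * (E' x).trace ^ 2)) := by
    have h1 : ∀ ξ : Euc d, ENNReal.ofReal (J (‖ξ‖ / ε)) *
        (ENNReal.ofReal (derivWithin f (Ici 0) 0 / ‖ξ‖ ^ 3) *
          ∫⁻ x, ENNReal.ofReal (D.indicator (fun y => quadForm (E' y) ξ) x ^ 2)) =
        ∫⁻ x in D, ENNReal.ofReal (derivWithin f (Ici 0) 0) *
          (ENNReal.ofReal (J (‖ξ‖ / ε) / ‖ξ‖ ^ 3) * ENNReal.ofReal (quadForm (E' x) ξ ^ 2)) := by
      intro ξ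
      have hJ0 : 0 ≤ J (‖ξ‖ / ε) := hJ.nonneg _ (by positivity)
      have h2 : ∫⁻ x, ENNReal.ofReal (D.indicator (fun y => quadForm (E' y) ξ) x ^ 2) =
          ∫⁻ x in D, ENNReal.ofReal (quadForm (E' x) ξ ^ 2) := by
        rw [← lintegral_indicator hD.measurableSet]
        refine lintegral_congr fun x => ?_
        by_cases hx : x ∈ D <;> simp [hx]
      have hm : Measurable fun x => ENNReal.ofReal (quadForm (E' x) ξ ^ 2) :=
        ((hqm.comp measurable_prodMk_left).pow_const 2).ennreal_ofReal
      rw [h2, lintegral_const_mul _ (hm.const_mul _), lintegral_const_mul _ hm, ← mul_assoc,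
        ← mul_assoc, ← ENNReal.ofReal_mul hJ0, ← ENNReal.ofReal_mul hf0.le]
      congr 2
      ring
    simp only [h1]
    have hm2 : Measurable fun z : Euc d × Euc d => ENNReal.ofReal (derivWithin f (Ici 0) 0) *
        (ENNReal.ofReal (J (‖z.1‖ / ε) / ‖z.1‖ ^ 3) *
          ENNReal.ofReal (quadForm (E' z.2) z.1 ^ 2)) := by
      refine (Measurable.mul ?_ (hqm.pow_const 2).ennreal_ofReal).const_mul _
      fun_prop
    rw [lintegral_lintegral_swap hm2.aemeasurable]
    have h3 : ∀ x, ∫⁻ ξ : Euc d, ENNReal.ofReal (derivWithin f (Ici 0) 0) *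
        (ENNReal.ofReal (J (‖ξ‖ / ε) / ‖ξ‖ ^ 3) * ENNReal.ofReal (quadForm (E' x) ξ ^ 2)) ≤
        ENNReal.ofReal (ε ^ (d + 1) * unitBallVolume d *
          (2 * lameModulus d f J * (∑ i, ∑ j, E' x i j ^ 2)
          + lameModulus d f J * (E' x).trace ^ 2)) := by
      intro x
      have hm3 : Measurable fun ξ : Euc d =>
          ENNReal.ofReal (J (‖ξ‖ / ε) / ‖ξ‖ ^ 3) * ENNReal.ofReal (quadForm (E' x) ξ ^ 2) := by
        refine Measurable.mul (f := fun ξ : Euc d => ENNReal.ofReal (J (‖ξ‖ / ε) / ‖ξ‖ ^ 3))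
          (by fun_prop) ?_
        exact ((hqm.comp measurable_prodMk_right).pow_const 2).ennreal_ofReal
      rw [lintegral_const_mul _ hm3, IsInfluenceFunction.lintegral_mul_quadForm_sq hJ hε hd,
        ← ENNReal.ofReal_mul hf0.le]
      refine ENNReal.ofReal_le_ofReal ?_
      have h4 := isotropicForm_le (E' x)
      have h5 : 0 ≤ derivWithin f (Ici 0) 0 * (unitBallVolume d / (d + 2)) * (ε ^ (d + 1) * I) := by
        positivity
      calc _ = derivWithin f (Ici 0) 0 * (unitBallVolume d / (d + 2)) * (ε ^ (d + 1) * I) *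
            isotropicForm (E' x) := by ring
        _ ≤ _ := mul_le_mul_of_nonneg_left h4 h5
        _ = _ := by rw [lameModulus]; ring
    refine (lintegral_mono h3).trans ?_
    rw [← integral_const_mul, ofReal_integral_eq_lintegral_ofReal]
    · refine Integrable.const_mul (Integrable.add (Integrable.const_mul ?_ _)
        (Integrable.const_mul ?_ _)) _
      · exact integrable_finsetSum _ fun i _ => integrable_finsetSum _ fun j _ =>
          (hK'.strain_memLp i j).integrable_sq
      · have : MemLp (fun x => ∑ i, E' x i i) 2 (volume.restrict D) :=
          memLp_finsetSum _ fun i _ => hK'.strain_memLp i i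
        exact this.integrable_sq
    · exact Eventually.of_forall fun x =>
        mul_nonneg (by positivity) (bulkEnergy_nonneg hf hJ (E' x))
  -- the surface part
  have hsurf : ∫⁻ ξ : Euc d, ENNReal.ofReal (J (‖ξ‖ / ε)) *
      (ENNReal.ofReal finf * volume (sweep (⋃ n, C n) ξ)) ≤
      ENNReal.ofReal (ε ^ (d + 1) * unitBallVolume d *
        (energyReleaseRate d finf J * μHE[d - 1].real K)) := by
    obtain ⟨n, rfl⟩ : ∃ n, d = n + 1 := ⟨d - 1, by omega⟩
    obtain ⟨φ, hφ, hKφ⟩ := hK'.crack_rectifiable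
    have h1 := lintegral_volume_sweep_le hwm
      (c := ENNReal.ofReal (2 * unitBallVolume n * (ε ^ (n + 2) * I)))
      (fun N => by
        rw [IsInfluenceFunction.lintegral_mul_abs_inner hJ hε, ← ENNReal.ofReal_mul]
        · exact ENNReal.ofReal_le_ofReal (le_of_eq (by ring))
        · have := unitBallVolume_pos n
          positivity)
      (MeasurableSet.iUnion fun m => (hC m).measurableSet) hφ
      (measure_mono_null (sdiff_subset_sdiff_left hCK) hKφ)
    calc _ = ENNReal.ofReal finf * ∫⁻ ξ : Euc (n + 1), ENNReal.ofReal (J (‖ξ‖ / ε)) *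
          volume (sweep (⋃ n, C n) ξ) := by
          refine Eq.trans (lintegral_congr fun ξ => ?_) (lintegral_const_mul _ (hwm.mul hsm))
          ring
      _ ≤ ENNReal.ofReal finf * (ENNReal.ofReal (2 * unitBallVolume n * (ε ^ (n + 2) * I)) *
          μHE[n] K) := by
          gcongr
          exact h1.trans (by gcongr)
      _ = _ := by
          have h2 : (μHE[n] : Measure (Euc (n + 1))) K = ENNReal.ofReal (μHE[n].real K) :=
            (ofReal_measureReal hK'.crack_finite.ne).symm
          rw [h2, ← ENNReal.ofReal_mul, ← ENNReal.ofReal_mul hfinf]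
          · congr 1
            rw [energyReleaseRate, ← hI]
            simp only [Nat.add_sub_cancel]
            field_simp
          · have := unitBallVolume_pos n
            positivity
  calc rawEnergy ε J f (zeroExt u₀)
      ≤ ∫⁻ ξ : Euc d, (ENNReal.ofReal (J (‖ξ‖ / ε)) *
        (ENNReal.ofReal (derivWithin f (Ici 0) 0 / ‖ξ‖ ^ 3) *
          ∫⁻ x, ENNReal.ofReal (D.indicator (fun y => quadForm (E' y) ξ) x ^ 2)) +
        ENNReal.ofReal (J (‖ξ‖ / ε)) *
          (ENNReal.ofReal finf * volume (sweep (⋃ n, C n) ξ))) := by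
        refine lintegral_mono fun ξ => ?_
        rw [← mul_add]
        gcongr
        exact lintegral_bond_le hf hχ hχ01
          ((hqm.comp measurable_prodMk_left).indicator hD.measurableSet)
          (measurableSet_sweep hC ξ) (hξ ξ)
    _ = _ := lintegral_add_right _ (hwm.mul (hsm.const_mul _))
    _ ≤ _ := add_le_add hbulk hsurf
    _ = _ := by
        rw [← ENNReal.ofReal_add, LEFM, mul_add]
        · exact mul_nonneg (by positivity) (integral_nonneg fun x => bulkEnergy_nonneg hf hJ _)
        · exact mul_nonneg (by positivity)
            (mul_nonneg (energyReleaseRate_nonneg hf hJ) measureReal_nonneg)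

end InitialEnergy

/-! ### The measure on bonds -/

section BondMeasure

variable {d : ℕ} {ε : ℝ} {J : ℝ → ℝ}

/-- The influence function as a measure on bond vectors. -/
def influenceMeasure (d : ℕ) (ε : ℝ) (J : ℝ → ℝ) : Measure (Euc d) :=
  volume.withDensity fun ξ => ENNReal.ofReal (J (‖ξ‖ / ε))

instance : SFinite (influenceMeasure d ε J) := by
  unfold influenceMeasure
  infer_instance

/-- The influence function as a measure on pairs of a bond vector and its base point. -/
def bondMeasure (d : ℕ) (ε : ℝ) (J : ℝ → ℝ) : Measure (Euc d × Euc d) :=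
  (influenceMeasure d ε J).prod volume

/-- Interchanges the end points of a bond. -/
def bondReversal (z : Euc d × Euc d) : Euc d × Euc d := (-z.1, z.1 + z.2)

theorem measurePreserving_neg_influenceMeasure (hJ : IsInfluenceFunction J) :
    MeasurePreserving (fun ξ : Euc d => -ξ) (influenceMeasure d ε J) (influenceMeasure d ε J) := by
  have hJm := hJ.measurable
  refine ⟨measurable_neg, Measure.ext fun s hs => ?_⟩
  rw [Measure.map_apply measurable_neg hs, influenceMeasure, withDensity_apply _ hs,
    withDensity_apply _ (measurable_neg hs), ← lintegral_indicator hs,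
    ← lintegral_indicator (measurable_neg hs), ← lintegral_neg_eq_self]
  refine lintegral_congr fun ξ => ?_
  by_cases h : ξ ∈ s <;> simp [h, norm_neg]

/-- The influence function is radial, and for fixed `ξ` the base point is merely translated. -/
theorem measurePreserving_bondReversal (hJ : IsInfluenceFunction J) :
    MeasurePreserving bondReversal (bondMeasure d ε J) (bondMeasure d ε J) := by
  refine MeasurePreserving.skew_product (f := fun ξ : Euc d => -ξ) (g := fun ξ x => ξ + x)
    (measurePreserving_neg_influenceMeasure hJ) (by fun_prop) (Eventually.of_forall fun ξ => ?_)
  exact map_add_left_eq_self volume ξ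

theorem integral_bondReversal (hJ : IsInfluenceFunction J) {g : Euc d × Euc d → ℝ}
    (hg : AEStronglyMeasurable g (bondMeasure d ε J)) :
    ∫ z, g (bondReversal z) ∂(bondMeasure d ε J) = ∫ z, g z ∂(bondMeasure d ε J) := by
  have h := measurePreserving_bondReversal (d := d) (ε := ε) hJ
  conv_rhs => rw [← h.map_eq]
  rw [integral_map h.measurable.aemeasurable (by rwa [h.map_eq])]

theorem integrable_inv_norm (hJ : IsInfluenceFunction J) (hε : 0 < ε) (hd : 2 ≤ d) :
    Integrable (fun ξ : Euc d => ‖ξ‖⁻¹) (influenceMeasure d ε J) := by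
  have hJm := hJ.measurable
  rw [influenceMeasure, integrable_withDensity_iff (by fun_prop)
    (Eventually.of_forall fun _ => ENNReal.ofReal_lt_top)]
  refine ⟨Measurable.aestronglyMeasurable (by fun_prop), ?_⟩
  refine lt_of_le_of_lt (lintegral_mono fun ξ => ?_)
    (IsInfluenceFunction.lintegral_div_norm_lt_top hJ hε hd)
  have hJ0 : 0 ≤ J (‖ξ‖ / ε) := hJ.nonneg _ (by positivity)
  simp only [ENNReal.toReal_ofReal hJ0]
  rw [Real.enorm_eq_ofReal (by positivity)]
  exact ENNReal.ofReal_le_ofReal (le_of_eq (by ring))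

theorem ae_norm_lt_influenceMeasure (hJ : IsInfluenceFunction J) (hε : 0 < ε) :
    ∀ᵐ ξ ∂(influenceMeasure d ε J), ‖ξ‖ < ε := by
  have hJm := hJ.measurable
  rw [influenceMeasure, ae_withDensity_iff (by fun_prop)]
  refine Eventually.of_forall fun ξ hξ => ?_
  by_contra h
  have h1 : 1 ≤ ‖ξ‖ / ε := (one_le_div hε).2 (not_lt.1 h)
  simp [hJ.eq_zero _ h1] at hξ

/-- On bonds shorter than `ε`, `‖ξ‖ ^ (-1/2)` is at most `√ε ‖ξ‖⁻¹`. -/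
theorem integrable_inv_sqrt_norm (hJ : IsInfluenceFunction J) (hε : 0 < ε) (hd : 2 ≤ d) :
    Integrable (fun ξ : Euc d => (√‖ξ‖)⁻¹) (influenceMeasure d ε J) := by
  refine ((integrable_inv_norm hJ hε hd).const_mul √ε).mono'
    (Measurable.aestronglyMeasurable (by fun_prop)) ?_
  filter_upwards [ae_norm_lt_influenceMeasure hJ hε] with ξ hξ
  rw [Real.norm_of_nonneg (by positivity)]
  rcases (norm_nonneg ξ).eq_or_lt with h | h
  · simp [← h]
  · have h1 : √‖ξ‖ ≤ √ε := Real.sqrt_le_sqrt hξ.le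
    have h2 : 0 < √‖ξ‖ := Real.sqrt_pos.2 h
    calc (√‖ξ‖)⁻¹ = √‖ξ‖ * ‖ξ‖⁻¹ := by
          field_simp
          exact (Real.sq_sqrt h.le).symm
      _ ≤ _ := by gcongr

theorem bondDifference_bondReversal (v : Euc d → Euc d) (z : Euc d × Euc d) :
    bondDifference v (bondReversal z).1 (bondReversal z).2 = bondDifference v z.1 z.2 := by
  simp only [bondDifference, bondReversal, norm_neg]
  rw [show z.1 + z.2 + -z.1 = z.2 by abel, add_comm z.1 z.2, inner_neg_right, ← inner_neg_left,
    neg_sub]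

/-- Both end point maps pull null sets back to null sets, the far one because it is the near one
after reversal. Hence bond differences are well defined on `L²` classes. -/
theorem bondDifference_congr_ae (hJ : IsInfluenceFunction J) {v v' : Euc d → Euc d}
    (h : v =ᵐ[volume] v') :
    ∀ᵐ z ∂(bondMeasure d ε J), bondDifference v z.1 z.2 = bondDifference v' z.1 z.2 := by
  have h1 : Measure.QuasiMeasurePreserving Prod.snd (bondMeasure d ε J) volume :=
    Measure.quasiMeasurePreserving_snd
  have h2 := (measurePreserving_bondReversal (d := d) (ε := ε) hJ).quasiMeasurePreserving
  filter_upwards [h1.ae h, (h1.comp h2).ae h] with z hz hz'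
  have h3 : v (z.2 + z.1) = v' (z.2 + z.1) := by
    simpa [bondReversal, add_comm] using hz'
  rw [bondDifference, bondDifference, hz, h3]

/-- The second term is written through `bondReversal` so that both terms have the same integral. -/
theorem abs_bondDifference_le (v : Euc d → Euc d) (z : Euc d × Euc d) :
    |bondDifference v z.1 z.2| ≤ (√‖z.1‖)⁻¹ * ‖v z.2‖ +
      (√‖(bondReversal z).1‖)⁻¹ * ‖v (bondReversal z).2‖ := by
  simp only [bondReversal, norm_neg]
  rw [← mul_add, bondDifference, abs_div, abs_of_nonneg (by positivity : 0 ≤ ‖z.1‖ * √‖z.1‖)]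
  rcases (norm_nonneg z.1).eq_or_lt with h | h
  · simp [← h]
  · have h2 : 0 < √‖z.1‖ := Real.sqrt_pos.2 h
    rw [div_le_iff₀ (by positivity)]
    calc |inner ℝ (v (z.2 + z.1) - v z.2) z.1| ≤ ‖v (z.2 + z.1) - v z.2‖ * ‖z.1‖ :=
          abs_real_inner_le_norm _ _
      _ ≤ (‖v (z.2 + z.1)‖ + ‖v z.2‖) * ‖z.1‖ := by gcongr; exact norm_sub_le _ _
      _ = _ := by
        rw [add_comm z.1 z.2]
        field_simp
        ring

variable {D : Set (Euc d)}

theorem zeroExt_add_ae (hD : IsOpen D) (w z : L2 D) :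
    zeroExt (w + z) =ᵐ[volume] zeroExt w + zeroExt z := by
  filter_upwards [(ae_restrict_iff' hD.measurableSet).1 (Lp.coeFn_add w z)] with x hx
  by_cases h : x ∈ D
  · simpa only [zeroExt, h, indicator_of_mem, Pi.add_apply] using hx h
  · simp [zeroExt, h]

theorem zeroExt_smul_ae (hD : IsOpen D) (c : ℝ) (w : L2 D) :
    zeroExt (c • w) =ᵐ[volume] c • zeroExt w := by
  filter_upwards [(ae_restrict_iff' hD.measurableSet).1 (Lp.coeFn_smul c w)] with x hx
  by_cases h : x ∈ D
  · simpa only [zeroExt, h, indicator_of_mem, Pi.smul_apply] using hx h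
  · simp [zeroExt, h]

theorem bondDifference_add_ae (hJ : IsInfluenceFunction J) (hD : IsOpen D) (w z : L2 D) :
    ∀ᵐ p ∂(bondMeasure d ε J), bondDifference (zeroExt (w + z)) p.1 p.2 =
      bondDifference (zeroExt w) p.1 p.2 + bondDifference (zeroExt z) p.1 p.2 := by
  filter_upwards [bondDifference_congr_ae hJ (zeroExt_add_ae hD w z)] with p hp
  rw [hp]
  simp only [bondDifference, Pi.add_apply, inner_sub_left, inner_add_left]
  ring

theorem bondDifference_smul_ae (hJ : IsInfluenceFunction J) (hD : IsOpen D) (c : ℝ) (w : L2 D) :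
    ∀ᵐ p ∂(bondMeasure d ε J), bondDifference (zeroExt (c • w)) p.1 p.2 =
      c * bondDifference (zeroExt w) p.1 p.2 := by
  filter_upwards [bondDifference_congr_ae hJ (zeroExt_smul_ae hD c w)] with p hp
  rw [hp]
  simp only [bondDifference, Pi.smul_apply, inner_sub_left, real_inner_smul_left]
  ring

theorem norm_sq_eq_integral_zeroExt (hD : IsOpen D) (w : L2 D) :
    Integrable (fun x => ‖zeroExt w x‖ ^ 2) ∧ ∫ x, ‖zeroExt w x‖ ^ 2 = ‖w‖ ^ 2 := by
  have h1 : (fun x => ‖zeroExt w x‖ ^ 2) = D.indicator fun x => ‖w x‖ ^ 2 := by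
    ext x
    by_cases h : x ∈ D <;> simp [zeroExt, h]
  rw [h1]
  refine ⟨(integrable_indicator_iff hD.measurableSet).2 
    ((memLp_two_iff_integrable_sq_norm (Lp.aestronglyMeasurable w)).1 (Lp.memLp w)), ?_⟩
  rw [integral_indicator hD.measurableSet, ← real_inner_self_eq_norm_sq, L2.inner_def]
  simp

theorem exists_integral_norm_zeroExt_le (hD : IsOpen D) (hDb : Bornology.IsBounded D) :
    ∃ c : ℝ, 0 ≤ c ∧ ∀ w : L2 D, ∫ x, ‖zeroExt w x‖ ≤ c * ‖w‖ := by
  have hfin := isFiniteMeasure_restrict_of_isBounded hDb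
  refine ⟨√(volume.real D), Real.sqrt_nonneg _, fun w => ?_⟩
  have h1 : (fun x => ‖zeroExt w x‖) = D.indicator fun x => ‖w x‖ := by
    ext x
    by_cases h : x ∈ D <;> simp [zeroExt, h]
  rw [h1, integral_indicator hD.measurableSet]
  have h2 := eLpNorm_le_eLpNorm_mul_rpow_measure_univ (p := 1) (q := 2) one_le_two
    (Lp.aestronglyMeasurable w)
  have h3 : eLpNorm w 2 (volume.restrict D) ≠ ⊤ := (Lp.memLp w).2.ne
  have h4 : (volume.restrict D) univ ^ ((1 : ℝ) / (1 : ℝ≥0∞).toReal - 1 / (2 : ℝ≥0∞).toReal) ≠ ⊤ :=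
    ENNReal.rpow_ne_top_of_nonneg (by norm_num) (measure_ne_top _ _)
  have h5 := ENNReal.toReal_mono (ENNReal.mul_ne_top h3 h4) h2
  rw [eLpNorm_one_eq_lintegral_enorm, ← integral_norm_eq_lintegral_enorm
    (Lp.aestronglyMeasurable w), ENNReal.toReal_mul, ← ENNReal.toReal_rpow] at h5
  refine h5.trans (le_of_eq ?_)
  rw [mul_comm, Lp.norm_def, Real.sqrt_eq_rpow]
  congr 2
  · simp [Measure.real]
  · norm_num

/-- Square integrability and integrability of the bond differences, with bounds. -/
theorem exists_bondDifference_bound (hJ : IsInfluenceFunction J) (hε : 0 < ε) (hd : 2 ≤ d)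
    (hD : IsOpen D) (hDb : Bornology.IsBounded D) :
    ∃ A : ℝ, 0 ≤ A ∧ ∀ w : L2 D,
      Integrable (fun z => bondDifference (zeroExt w) z.1 z.2) (bondMeasure d ε J) ∧
      Integrable (fun z => bondDifference (zeroExt w) z.1 z.2 ^ 2) (bondMeasure d ε J) ∧
      ∫ z, |bondDifference (zeroExt w) z.1 z.2| ∂(bondMeasure d ε J) ≤ A * ‖w‖ ∧
      ∫ z, bondDifference (zeroExt w) z.1 z.2 ^ 2 ∂(bondMeasure d ε J) ≤ A * ‖w‖ ^ 2 := by
  obtain ⟨c, hc, hcw⟩ := exists_integral_norm_zeroExt_le hD hDb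
  have hrev := measurePreserving_bondReversal (d := d) (ε := ε) hJ
  set c₁ : ℝ := ∫ ξ, (√‖ξ‖)⁻¹ ∂(influenceMeasure d ε J) with hc₁
  set c₂ : ℝ := ∫ ξ, ‖ξ‖⁻¹ ∂(influenceMeasure d ε J) with hc₂
  have hc₁0 : 0 ≤ c₁ := integral_nonneg fun ξ => by positivity
  have hc₂0 : 0 ≤ c₂ := integral_nonneg fun ξ => by positivity
  -- One constant serves both estimates: `2 c₁ c` is needed for the integral of the absolute value,
  -- `4 c₂` for that of the square.
  refine ⟨2 * c₁ * c + 4 * c₂, by positivity, fun w => ?_⟩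
  set q : Euc d × Euc d → ℝ := fun z => bondDifference (zeroExt w) z.1 z.2 with hq
  set g : Euc d × Euc d → ℝ := fun z => (√‖z.1‖)⁻¹ * ‖zeroExt w z.2‖ with hg
  have hqm : AEStronglyMeasurable q (bondMeasure d ε J) :=
    (measurable_bondDifference (measurable_zeroExt hD w)).aestronglyMeasurable
  have hgi : Integrable g (bondMeasure d ε J) :=
    (integrable_inv_sqrt_norm hJ hε hd).mul_prod (integrable_zeroExt hD hDb w).norm
  have hgI : ∫ z, g z ∂(bondMeasure d ε J) ≤ c₁ * (c * ‖w‖) := by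
    rw [hg, bondMeasure, integral_prod_mul (fun ξ : Euc d => (√‖ξ‖)⁻¹) fun x => ‖zeroExt w x‖]
    gcongr
    exact hcw w
  have hg2 : ∀ z, g z ^ 2 = ‖z.1‖⁻¹ * ‖zeroExt w z.2‖ ^ 2 := fun z => by
    rw [hg, mul_pow, inv_pow, Real.sq_sqrt (norm_nonneg _)]
  have hg2i : Integrable (fun z => g z ^ 2) (bondMeasure d ε J) := by
    simp only [hg2]
    exact (integrable_inv_norm hJ hε hd).mul_prod (norm_sq_eq_integral_zeroExt hD w).1
  have hg2I : ∫ z, g z ^ 2 ∂(bondMeasure d ε J) = c₂ * ‖w‖ ^ 2 := by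
    simp only [hg2]
    rw [bondMeasure, integral_prod_mul (fun ξ : Euc d => ‖ξ‖⁻¹) fun x => ‖zeroExt w x‖ ^ 2,
      (norm_sq_eq_integral_zeroExt hD w).2]
  have hri : Integrable (fun z => g (bondReversal z)) (bondMeasure d ε J) :=
    (hrev.integrable_comp hgi.aestronglyMeasurable).2 hgi
  have hr2i : Integrable (fun z => g (bondReversal z) ^ 2) (bondMeasure d ε J) :=
    (hrev.integrable_comp hg2i.aestronglyMeasurable).2 hg2i
  have hb : ∀ z, |q z| ≤ g z + g (bondReversal z) := abs_bondDifference_le _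
  have hb2 : ∀ z, q z ^ 2 ≤ 2 * g z ^ 2 + 2 * g (bondReversal z) ^ 2 := fun z => by
    have h1 := hb z
    have h2 := abs_nonneg (q z)
    rw [← sq_abs]
    nlinarith [sq_nonneg (g z - g (bondReversal z))]
  have hqi : Integrable q (bondMeasure d ε J) :=
    (hgi.add hri).mono' hqm (Eventually.of_forall hb)
  have hb2i : Integrable (fun z => 2 * g z ^ 2 + 2 * g (bondReversal z) ^ 2) (bondMeasure d ε J) :=
    (hg2i.const_mul 2).add (hr2i.const_mul 2)
  have hq2i : Integrable (fun z => q z ^ 2) (bondMeasure d ε J) := by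
    refine hb2i.mono' (hqm.pow 2) (Eventually.of_forall fun z => ?_)
    rw [Real.norm_of_nonneg (sq_nonneg _)]
    exact hb2 z
  refine ⟨hqi, hq2i, ?_, ?_⟩
  · calc ∫ z, |q z| ∂(bondMeasure d ε J) ≤ ∫ z, (g z + g (bondReversal z)) ∂(bondMeasure d ε J) :=
          integral_mono hqi.abs (hgi.add hri) hb
      _ = 2 * ∫ z, g z ∂(bondMeasure d ε J) := by
          rw [integral_add hgi hri, integral_bondReversal hJ hgi.aestronglyMeasurable]
          ring
      _ ≤ 2 * (c₁ * (c * ‖w‖)) := by gcongr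
      _ ≤ _ := by
          have : 0 ≤ 4 * c₂ * ‖w‖ := by positivity
          nlinarith
  · calc ∫ z, q z ^ 2 ∂(bondMeasure d ε J) ≤
          ∫ z, (2 * g z ^ 2 + 2 * g (bondReversal z) ^ 2) ∂(bondMeasure d ε J) :=
          integral_mono hq2i hb2i hb2
      _ = 4 * ∫ z, g z ^ 2 ∂(bondMeasure d ε J) := by
          rw [integral_add (hg2i.const_mul 2) (hr2i.const_mul 2), integral_const_mul,
            integral_const_mul, integral_bondReversal hJ (g := fun z => g z ^ 2)
              hg2i.aestronglyMeasurable]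
          ring
      _ = 4 * c₂ * ‖w‖ ^ 2 := by rw [hg2I]; ring
      _ ≤ _ := by
          have : 0 ≤ 2 * c₁ * c * ‖w‖ ^ 2 := by positivity
          nlinarith

end BondMeasure

/-! ### The peridynamic energy and its gradient -/

section BondEnergy

variable {d : ℕ} {ε : ℝ} {J f : ℝ → ℝ} {finf : ℝ} {D : Set (Euc d)}

/-- The peridynamic energy without its normalizing constant, as a real number. -/
def bondEnergy (ε : ℝ) (J f : ℝ → ℝ) (v : Euc d → Euc d) : ℝ :=
  ∫ z, f (bondDifference v z.1 z.2 ^ 2) ∂(bondMeasure d ε J)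

theorem bondEnergy_nonneg (hf : IsCohesivePotential f finf) (v : Euc d → Euc d) :
    0 ≤ bondEnergy ε J f v :=
  integral_nonneg fun _ => hf.nonneg (sq_nonneg _)

theorem integrable_bondEnergy (hf : IsCohesivePotential f finf) (hJ : IsInfluenceFunction J)
    (hε : 0 < ε) (hd : 2 ≤ d) (hD : IsOpen D) (hDb : Bornology.IsBounded D) (w : L2 D) :
    Integrable (fun z => f (bondDifference (zeroExt w) z.1 z.2 ^ 2)) (bondMeasure d ε J) := by
  obtain ⟨A, -, hA⟩ := exists_bondDifference_bound hJ hε hd hD hDb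
  refine ((hA w).2.1.const_mul (derivWithin f (Ici 0) 0)).mono'
    (hf.continuous_comp_sq.comp_aestronglyMeasurable (hA w).1.aestronglyMeasurable)
    (Eventually.of_forall fun z => ?_)
  rw [Real.norm_of_nonneg (hf.nonneg (sq_nonneg _))]
  exact hf.le_mul (sq_nonneg _)

theorem ofReal_bondEnergy (hf : IsCohesivePotential f finf) (hJ : IsInfluenceFunction J)
    (hε : 0 < ε) (hd : 2 ≤ d) (hD : IsOpen D) (hDb : Bornology.IsBounded D) (w : L2 D) :
    ENNReal.ofReal (bondEnergy ε J f (zeroExt w)) = rawEnergy ε J f (zeroExt w) := by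
  have hJm := hJ.measurable
  have hm : Measurable fun z : Euc d × Euc d =>
      ENNReal.ofReal (f (bondDifference (zeroExt w) z.1 z.2 ^ 2)) :=
    (hf.continuous_comp_sq.measurable.comp
      (measurable_bondDifference (measurable_zeroExt hD w))).ennreal_ofReal
  rw [bondEnergy, ofReal_integral_eq_lintegral_ofReal
    (integrable_bondEnergy hf hJ hε hd hD hDb w)
    (Eventually.of_forall fun z => hf.nonneg (sq_nonneg _)), bondMeasure,
    lintegral_prod _ hm.aemeasurable, influenceMeasure,
    lintegral_withDensity_eq_lintegral_mul _ (by fun_prop) hm.lintegral_prod_right', rawEnergy]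
  rfl

theorem integrable_bondForce_mul (hf : IsCohesivePotential f finf) {κ : Measure (Euc d × Euc d)}
    {q g : Euc d × Euc d → ℝ} (hq : AEStronglyMeasurable q κ) (hg : Integrable g κ) :
    Integrable (fun z => 2 * q z * derivWithin f (Ici 0) (q z ^ 2) * g z) κ := by
  obtain ⟨M, -, hM⟩ := hf.exists_deriv_comp_sq_le
  exact hg.bdd_mul (c := M) (hf.continuous_deriv_comp_sq.comp_aestronglyMeasurable hq)
    (Eventually.of_forall fun z => hM _)

/-- The peridynamic energy is differentiable on `L²`. -/
theorem exists_hasFDerivAt_bondEnergy (hf : IsCohesivePotential f finf)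
    (hJ : IsInfluenceFunction J) (hε : 0 < ε) (hd : 2 ≤ d) (hD : IsOpen D)
    (hDb : Bornology.IsBounded D) (w : L2 D) :
    ∃ L : L2 D →L[ℝ] ℝ,
      (∀ z : L2 D, L z = ∫ p, 2 * bondDifference (zeroExt w) p.1 p.2 *
        derivWithin f (Ici 0) (bondDifference (zeroExt w) p.1 p.2 ^ 2) *
          bondDifference (zeroExt z) p.1 p.2 ∂(bondMeasure d ε J)) ∧
      HasFDerivAt (fun z : L2 D => bondEnergy ε J f (zeroExt z)) L w := by
  obtain ⟨A, hA0, hA⟩ := exists_bondDifference_bound hJ hε hd hD hDb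
  obtain ⟨M, hM0, hM⟩ := hf.exists_deriv_comp_sq_le
  set q : L2 D → Euc d × Euc d → ℝ := fun z p => bondDifference (zeroExt z) p.1 p.2 with hq
  set G : Euc d × Euc d → ℝ := fun p => 2 * q w p * derivWithin f (Ici 0) (q w p ^ 2) with hG
  have hGi : ∀ z, Integrable (fun p => G p * q z p) (bondMeasure d ε J) := fun z =>
    integrable_bondForce_mul hf (hA w).1.aestronglyMeasurable (hA z).1
  let L₀ : L2 D →ₗ[ℝ] ℝ :=
    { toFun := fun z => ∫ p, G p * q z p ∂(bondMeasure d ε J)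
      map_add' := fun z z' => by
        rw [← integral_add (hGi z) (hGi z')]
        refine integral_congr_ae ?_
        filter_upwards [bondDifference_add_ae hJ hD z z'] with p hp
        rw [hq]
        simp only [hp]
        ring
      map_smul' := fun c z => by
        rw [RingHom.id_apply, smul_eq_mul, ← integral_const_mul]
        refine integral_congr_ae ?_
        filter_upwards [bondDifference_smul_ae hJ hD c z] with p hp
        rw [hq]
        simp only [hp]
        ring }
  have hL₀ : ∀ z, ‖L₀ z‖ ≤ M * A * ‖z‖ := by
    intro z
    refine (norm_integral_le_integral_norm _).trans ?_
    calc ∫ p, ‖G p * q z p‖ ∂(bondMeasure d ε J) ≤ ∫ p, M * |q z p| ∂(bondMeasure d ε J) := by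
          refine integral_mono (hGi z).norm ((hA z).1.abs.const_mul M) fun p => ?_
          rw [norm_mul]
          exact mul_le_mul_of_nonneg_right (hM _) (norm_nonneg _)
      _ = M * ∫ p, |q z p| ∂(bondMeasure d ε J) := integral_const_mul _ _
      _ ≤ M * (A * ‖z‖) := by gcongr; exact (hA z).2.2.1
      _ = _ := by ring
  refine ⟨L₀.mkContinuous (M * A) hL₀, fun z => rfl, ?_⟩
  rw [hasFDerivAt_iff_isLittleO_nhds_zero, Asymptotics.isLittleO_iff]
  intro c hc
  -- The constants are chosen so that the part of the remainder linear in the bond difference and,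
  -- for `h` in the small ball, the quadratic part each contribute at most `c/2 ‖h‖`.
  obtain ⟨C, hC0, hC⟩ := hf.exists_remainder_le (η := c / (2 * (A + 1))) (by positivity)
  have hball : ∀ᶠ h : L2 D in 𝓝 0, ‖h‖ < c / (2 * (C * A + 1)) := by
    have := Metric.ball_mem_nhds (0 : L2 D) (ε := c / (2 * (C * A + 1))) (by positivity)
    filter_upwards [this] with h hh
    simpa using hh
  filter_upwards [hball] with h hh
  have h1 : bondEnergy ε J f (zeroExt (w + h)) - bondEnergy ε J f (zeroExt w)
      - L₀.mkContinuous (M * A) hL₀ h = ∫ p, (f ((q w p + q h p) ^ 2) - f (q w p ^ 2)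
        - G p * q h p) ∂(bondMeasure d ε J) := by
    have h2 : (fun p => f ((q w p + q h p) ^ 2)) =ᵐ[bondMeasure d ε J]
        fun p => f (q (w + h) p ^ 2) := by
      filter_upwards [bondDifference_add_ae hJ hD w h] with p hp
      rw [hq]
      simp only [hp]
    have h3 : Integrable (fun p => f (q (w + h) p ^ 2)) (bondMeasure d ε J) :=
      integrable_bondEnergy hf hJ hε hd hD hDb (w + h)
    have h4 : Integrable (fun p => f ((q w p + q h p) ^ 2)) (bondMeasure d ε J) := h3.congr h2.symm
    have h5 : Integrable (fun p => f (q w p ^ 2)) (bondMeasure d ε J) :=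
      integrable_bondEnergy hf hJ hε hd hD hDb w
    have h6 : Integrable (fun p => f ((q w p + q h p) ^ 2) - f (q w p ^ 2)) (bondMeasure d ε J) :=
      h4.sub h5
    rw [integral_sub h6 (hGi h), integral_sub h4 h5, integral_congr_ae h2]
    rfl
  rw [h1]
  calc ‖∫ p, (f ((q w p + q h p) ^ 2) - f (q w p ^ 2) - G p * q h p) ∂(bondMeasure d ε J)‖
      ≤ ∫ p, (c / (2 * (A + 1)) * |q h p| + C * q h p ^ 2) ∂(bondMeasure d ε J) :=
        norm_integral_le_of_norm_le (((hA h).1.abs.const_mul _).add ((hA h).2.1.const_mul _))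
          (Eventually.of_forall fun p => hC _ _)
    _ = c / (2 * (A + 1)) * ∫ p, |q h p| ∂(bondMeasure d ε J)
        + C * ∫ p, q h p ^ 2 ∂(bondMeasure d ε J) := by
        rw [integral_add ((hA h).1.abs.const_mul _) ((hA h).2.1.const_mul _), integral_const_mul,
          integral_const_mul]
    _ ≤ c / (2 * (A + 1)) * (A * ‖h‖) + C * (A * ‖h‖ ^ 2) := by
        gcongr
        · exact (hA h).2.2.1
        · exact (hA h).2.2.2
    _ ≤ c / 2 * ‖h‖ + c / 2 * ‖h‖ := by
        refine add_le_add ?_ ?_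
        · rw [← mul_assoc]
          refine mul_le_mul_of_nonneg_right ?_ (norm_nonneg _)
          rw [div_mul_eq_mul_div, div_le_div_iff₀ (by positivity) two_pos]
          nlinarith
        · have h6 : (C * A) * ‖h‖ ≤ c / 2 := by
            have h7 := (lt_div_iff₀ (by positivity)).1 hh
            have := mul_nonneg hC0 hA0
            nlinarith [norm_nonneg h]
          nlinarith [norm_nonneg h]
    _ = c * ‖h‖ := by ring

/-- The force of a bond in terms of the scaled bond difference. -/
theorem bondForce_smul_eq (hf : IsCohesivePotential f finf) (v : Euc d → Euc d) (ξ x : Euc d) :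
    bondForce ε J f ‖x + ξ - x‖ (strain v (x + ξ) x) • (‖x + ξ - x‖⁻¹ • (x + ξ - x)) =
      (1 / ε) • (J (‖ξ‖ / ε) • ((2 * bondDifference v ξ x *
        derivWithin f (Ici 0) (bondDifference v ξ x ^ 2) * (‖ξ‖ * √‖ξ‖)⁻¹) • ξ)) := by
  rw [add_sub_cancel_left]
  rcases (norm_nonneg ξ).eq_or_lt with h | h
  · rw [← h]
    simp [norm_eq_zero.1 h.symm]
  have hs : 0 < √‖ξ‖ := Real.sqrt_pos.2 h
  have hss : √‖ξ‖ ^ 2 = ‖ξ‖ := Real.sq_sqrt h.le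
  have h1 : √‖ξ‖ * strain v (x + ξ) x = bondDifference v ξ x := by
    rw [strain, bondDifference, add_sub_cancel_left, real_inner_smul_left, real_inner_smul_right]
    field_simp
    rw [hss]
  have h2 : HasDerivAt (fun s => bondPotential ε J f ‖ξ‖ s)
      (1 / ε * J (‖ξ‖ / ε) * (1 / ‖ξ‖ * (2 * bondDifference v ξ x *
        derivWithin f (Ici 0) (bondDifference v ξ x ^ 2) * √‖ξ‖))) (strain v (x + ξ) x) := by
    have h3 : HasDerivAt (fun s : ℝ => √‖ξ‖ * s) √‖ξ‖ (strain v (x + ξ) x) := by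
      simpa using (hasDerivAt_id (strain v (x + ξ) x)).const_mul √‖ξ‖
    have h4 := (hf.hasDerivAt_comp_sq (√‖ξ‖ * strain v (x + ξ) x)).comp _ h3
    rw [h1] at h4
    -- Writing `‖ξ‖ s²` as `(√‖ξ‖ s)²` reduces the force to the derivative of `p ↦ f(p²)`.
    have h5 : (fun s => bondPotential ε J f ‖ξ‖ s) =
        fun s => 1 / ε * J (‖ξ‖ / ε) * (1 / ‖ξ‖ * ((fun p => f (p ^ 2)) ∘ fun s => √‖ξ‖ * s) s) := by
      ext s
      simp only [bondPotential, Function.comp_apply, mul_pow, hss]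
    rw [h5]
    exact (h4.const_mul _).const_mul _
  rw [bondForce, h2.deriv, smul_smul, smul_smul, smul_smul]
  congr 1
  field_simp
  rw [hss]
  ring

/-- The gradient of the peridynamic energy as an integral over bond vectors. -/
theorem gradPD_eq (hf : IsCohesivePotential f finf) (hJ : IsInfluenceFunction J) (hε : 0 < ε)
    (v : Euc d → Euc d) (x : Euc d) :
    gradPD ε J f v x = -((2 / (ε ^ (d + 1) * unitBallVolume d)) •
      ∫ ξ, (2 * bondDifference v ξ x * derivWithin f (Ici 0) (bondDifference v ξ x ^ 2) *
        (‖ξ‖ * √‖ξ‖)⁻¹) • ξ ∂(influenceMeasure d ε J)) := by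
  have hJm := hJ.measurable
  set F : Euc d → Euc d := fun ξ => (2 * bondDifference v ξ x *
    derivWithin f (Ici 0) (bondDifference v ξ x ^ 2) * (‖ξ‖ * √‖ξ‖)⁻¹) • ξ with hF
  have h1 : ∫ y in Metric.ball x ε,
      bondForce ε J f ‖y - x‖ (strain v y x) • (‖y - x‖⁻¹ • (y - x)) =
      (1 / ε) • ∫ ξ, F ξ ∂(influenceMeasure d ε J) := by
    rw [← integral_indicator measurableSet_ball, ← integral_add_left_eq_self _ x,
      influenceMeasure, integral_withDensity_eq_integral_toReal_smul (by fun_prop)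
        (Eventually.of_forall fun _ => ENNReal.ofReal_lt_top), ← integral_smul]
    refine integral_congr_ae (Eventually.of_forall fun ξ => ?_)
    have hJ0 : 0 ≤ J (‖ξ‖ / ε) := hJ.nonneg _ (by positivity)
    simp only [ENNReal.toReal_ofReal hJ0]
    by_cases h : x + ξ ∈ Metric.ball x ε
    · rw [indicator_of_mem h, bondForce_smul_eq hf]
    · rw [indicator_of_notMem h]
      have h2 : 1 ≤ ‖ξ‖ / ε := by
        rw [one_le_div hε]
        simpa using h
      rw [hJ.eq_zero _ h2]
      simp
  rw [gradPD, h1, smul_smul]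
  congr 2
  rw [pow_succ]
  field_simp

/-- The derivative of the peridynamic energy is represented by `gradPD`. -/
theorem integral_inner_gradPD (hf : IsCohesivePotential f finf) (hJ : IsInfluenceFunction J)
    (hε : 0 < ε) (hd : 2 ≤ d) (hD : IsOpen D) (hDb : Bornology.IsBounded D) (w z : L2 D) :
    Integrable (fun x => (inner ℝ (gradPD ε J f (zeroExt w) x) (zeroExt z x) : ℝ)) ∧
    ∫ x, inner ℝ (gradPD ε J f (zeroExt w) x) (zeroExt z x) =
      1 / (ε ^ (d + 1) * unitBallVolume d) *
        ∫ p, 2 * bondDifference (zeroExt w) p.1 p.2 *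
          derivWithin f (Ici 0) (bondDifference (zeroExt w) p.1 p.2 ^ 2) *
            bondDifference (zeroExt z) p.1 p.2 ∂(bondMeasure d ε J) := by
  have hrev := measurePreserving_bondReversal (d := d) (ε := ε) hJ
  set q : Euc d × Euc d → ℝ := fun p => bondDifference (zeroExt w) p.1 p.2 with hq
  set G : Euc d × Euc d → ℝ := fun p => 2 * q p * derivWithin f (Ici 0) (q p ^ 2) with hG
  set H : Euc d × Euc d → ℝ := fun p =>
    G p * ((‖p.1‖ * √‖p.1‖)⁻¹ * inner ℝ p.1 (zeroExt z p.2)) with hH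
  have hwm := measurable_zeroExt hD w
  have hzm := measurable_zeroExt hD z
  have hqm : Measurable q := measurable_bondDifference hwm
  have hgi : Integrable (fun p : Euc d × Euc d => (√‖p.1‖)⁻¹ * ‖zeroExt z p.2‖)
      (bondMeasure d ε J) :=
    (integrable_inv_sqrt_norm hJ hε hd).mul_prod (integrable_zeroExt hD hDb z).norm
  have hti : Integrable (fun p : Euc d × Euc d =>
      (‖p.1‖ * √‖p.1‖)⁻¹ * (inner ℝ p.1 (zeroExt z p.2) : ℝ)) (bondMeasure d ε J) := by
    refine hgi.mono' (Measurable.aestronglyMeasurable (by fun_prop)) (Eventually.of_forall fun p => ?_)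
    rw [norm_mul, Real.norm_of_nonneg (by positivity)]
    rcases (norm_nonneg p.1).eq_or_lt with h | h
    · simp [← h]
    · have hs : 0 < √‖p.1‖ := Real.sqrt_pos.2 h
      calc (‖p.1‖ * √‖p.1‖)⁻¹ * ‖(inner ℝ p.1 (zeroExt z p.2) : ℝ)‖
          ≤ (‖p.1‖ * √‖p.1‖)⁻¹ * (‖p.1‖ * ‖zeroExt z p.2‖) := by
            gcongr
            exact norm_inner_le_norm _ _
        _ = _ := by field_simp
  have hHi : Integrable H (bondMeasure d ε J) :=
    integrable_bondForce_mul hf hqm.aestronglyMeasurable hti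
  have hsym : ∫ p, G p * bondDifference (zeroExt z) p.1 p.2 ∂(bondMeasure d ε J) =
      -2 * ∫ p, H p ∂(bondMeasure d ε J) := by
    -- Discrete integration by parts: the two end points of the test function contribute equally
    -- after reversal, since the force is symmetric while `ξ` changes sign. This accounts for the
    -- factor `2` in `gradPD`.
    have h1 : ∀ p, G p * bondDifference (zeroExt z) p.1 p.2 = -H (bondReversal p) - H p := by
      intro p
      have h2 : G (bondReversal p) = G p := by
        simp only [hG, hq, bondDifference_bondReversal]
      rw [hH]
      simp only [h2]
      simp only [bondReversal, norm_neg, inner_neg_left, bondDifference, inner_sub_left,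
        real_inner_comm, add_comm p.1 p.2]
      ring
    have hrH : Integrable (fun p => H (bondReversal p)) (bondMeasure d ε J) :=
      (hrev.integrable_comp hHi.aestronglyMeasurable).2 hHi
    have hrH' : Integrable (fun p => -H (bondReversal p)) (bondMeasure d ε J) := hrH.neg
    simp only [h1]
    rw [integral_sub hrH' hHi, integral_neg, integral_bondReversal hJ hHi.aestronglyMeasurable]
    ring
  have hHs : Integrable (fun p : Euc d × Euc d => H p.swap)
      (volume.prod (influenceMeasure d ε J)) := hHi.swap
  have hgrad : ∀ x, (inner ℝ (gradPD ε J f (zeroExt w) x) (zeroExt z x) : ℝ) =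
      -(2 / (ε ^ (d + 1) * unitBallVolume d)) * ∫ ξ, H (ξ, x) ∂(influenceMeasure d ε J) := by
    intro x
    have hFi : Integrable (fun ξ : Euc d => (G (ξ, x) * (‖ξ‖ * √‖ξ‖)⁻¹) • ξ)
        (influenceMeasure d ε J) := by
      obtain ⟨M, hM0, hM⟩ := hf.exists_deriv_comp_sq_le
      have hGm : Measurable G := hf.continuous_deriv_comp_sq.measurable.comp hqm
      refine ((integrable_inv_sqrt_norm hJ hε hd).const_mul M).mono'
        (Measurable.aestronglyMeasurable (by fun_prop)) (Eventually.of_forall fun ξ => ?_)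
      rw [norm_smul, norm_mul, mul_assoc]
      refine mul_le_mul (hM _) ?_ (by positivity) hM0
      rw [Real.norm_of_nonneg (by positivity)]
      rcases (norm_nonneg ξ).eq_or_lt with h | h
      · simp [← h]
      · have hs : 0 < √‖ξ‖ := Real.sqrt_pos.2 h
        refine le_of_eq ?_
        field_simp
    rw [gradPD_eq hf hJ hε, inner_neg_left, real_inner_smul_left, neg_mul]
    congr 2
    rw [real_inner_comm, ← integral_inner hFi]
    refine integral_congr_ae (Eventually.of_forall fun ξ => ?_)
    simp only [hH, hG, hq, real_inner_smul_right]
    rw [real_inner_comm]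
    ring
  have hint : Integrable fun x => ∫ ξ, H (ξ, x) ∂(influenceMeasure d ε J) :=
    hHs.integral_prod_left
  simp only [hgrad]
  refine ⟨hint.const_mul _, ?_⟩
  rw [integral_const_mul, hsym, bondMeasure, integral_prod_symm _ hHi]
  ring

end BondEnergy

/-! ### Energy balance -/

/-- A Gronwall estimate for the square root of the energy of a forced conservative system. -/
theorem sqrt_energy_le {X : Type*} [NormedAddCommGroup X] [InnerProductSpace ℝ X] {ρ T : ℝ}
    (hρ : 0 < ρ) {V V' : ℝ → ℝ} {p p' b : ℝ → X} (hV0 : ∀ t, 0 ≤ V t)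
    (hV : ∀ t ∈ Icc 0 T, HasDerivWithinAt V (V' t) (Icc 0 T) t)
    (hp : ∀ t ∈ Icc 0 T, HasDerivWithinAt p (p' t) (Icc 0 T) t)
    (hb : ContinuousOn b (Icc 0 T))
    (hbal : ∀ t ∈ Icc 0 T, ρ * inner ℝ (p' t) (p t) + V' t = inner ℝ (b t) (p t)) :
    ∀ t ∈ Icc 0 T, √(ρ * ‖p t‖ ^ 2 + 2 * V t + 1) ≤
      √(ρ * ‖p 0‖ ^ 2 + 2 * V 0 + 1) + √(ρ⁻¹) * ∫ τ in (0 : ℝ)..t, ‖b τ‖ := by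
  intro t ht
  -- The summand `1` keeps the energy away from zero, so its square root is differentiable.
  set N : ℝ → ℝ := fun t => ρ * ‖p t‖ ^ 2 + 2 * V t + 1 with hN
  have hN1 : ∀ t, 1 ≤ N t := fun t => by
    have := hV0 t
    have : 0 ≤ ρ * ‖p t‖ ^ 2 := by positivity
    simp only [hN]
    linarith
  have hN' : ∀ t ∈ Icc 0 T, HasDerivWithinAt N (2 * inner ℝ (b t) (p t)) (Icc 0 T) t := by
    intro t ht
    have h1 := (((hp t ht).norm_sq.const_mul ρ).add ((hV t ht).const_mul 2)).add_const 1
    refine h1.congr_deriv ?_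
    rw [← hbal t ht, real_inner_comm]
    ring
  have hφ : ∀ t ∈ Icc 0 T, HasDerivWithinAt (fun t => √(N t))
      (2 * inner ℝ (b t) (p t) / (2 * √(N t))) (Icc 0 T) t := fun t ht =>
    (hN' t ht).sqrt (by have := hN1 t; positivity)
  have hbn : ContinuousOn (fun t => ‖b t‖) (Icc 0 T) := hb.norm
  have hT : (0 : ℝ) ≤ T := ht.1.trans ht.2
  have hbi : IntervalIntegrable (fun t => ‖b t‖) volume 0 T := by
    rw [← uIcc_of_le hT] at hbn
    exact hbn.intervalIntegrable
  have hanti : AntitoneOn (fun t => √(N t) - √(ρ⁻¹) * ∫ τ in (0 : ℝ)..t, ‖b τ‖) (Icc 0 T) := by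
    refine antitoneOn_of_hasDerivWithinAt_nonpos (convex_Icc 0 T)
      (f' := fun t => 2 * inner ℝ (b t) (p t) / (2 * √(N t)) - √(ρ⁻¹) * ‖b t‖) ?_ ?_ ?_
    · refine ContinuousOn.sub (fun t ht => (hφ t ht).continuousWithinAt)
        (continuousOn_const.mul ?_)
      have := intervalIntegral.continuousOn_primitive_interval (a := 0) (b := T)
        (f := fun t => ‖b t‖) (μ := volume) (by
          rw [uIcc_of_le hT]
          exact hbn.integrableOn_Icc)
      rwa [uIcc_of_le hT] at this
    · intro s hs
      rw [interior_Icc] at hs ⊢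
      have hs' := Ioo_subset_Icc_self hs
      refine HasDerivWithinAt.sub ((hφ s hs').mono Ioo_subset_Icc_self)
        (HasDerivWithinAt.const_mul _ (HasDerivAt.hasDerivWithinAt ?_))
      refine intervalIntegral.integral_hasDerivAt_right ?_ ?_ ?_
      · refine hbi.mono_set ?_
        rw [uIcc_of_le hT, uIcc_of_le hs.1.le]
        exact Icc_subset_Icc_right hs.2.le
      · exact (hbn.mono Ioo_subset_Icc_self).stronglyMeasurableAtFilter isOpen_Ioo s hs
      · exact (hbn.mono Ioo_subset_Icc_self).continuousAt (Ioo_mem_nhds hs.1 hs.2)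
    · intro s hs
      have hNs : 0 < √(N s) := Real.sqrt_pos.2 (lt_of_lt_of_le one_pos (hN1 s))
      have h1 : inner ℝ (b s) (p s) ≤ ‖b s‖ * ‖p s‖ := real_inner_le_norm _ _
      -- The kinetic part alone bounds the velocity by the square root of the energy, so `√N` grows
      -- at rate at most `√(ρ⁻¹) ‖b‖`.
      have h2 : ‖p s‖ ≤ √(ρ⁻¹) * √(N s) := by
        rw [← Real.sqrt_mul (by positivity), ← Real.sqrt_sq (norm_nonneg (p s))]
        refine Real.sqrt_le_sqrt ?_
        rw [inv_mul_eq_div, le_div_iff₀ hρ]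
        have := hV0 s
        simp only [hN]
        linarith
      rw [mul_div_mul_left _ _ two_ne_zero, sub_nonpos, div_le_iff₀ hNs]
      calc inner ℝ (b s) (p s) ≤ ‖b s‖ * (√(ρ⁻¹) * √(N s)) := h1.trans (by gcongr)
        _ = _ := by ring
  have h := hanti (left_mem_Icc.2 hT) ht ht.1
  simp only [intervalIntegral.integral_same, mul_zero, sub_zero] at h
  linarith

section EnergyBalance

variable {d : ℕ} {ε : ℝ} {J f : ℝ → ℝ} {finf : ℝ} {D : Set (Euc d)}

/-- Velocities of motions in `L²₀` vanish on the constraint set. -/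
theorem hasDerivWithinAt_mem_L20 (hD : IsOpen D) {a T : ℝ} (hT : 0 < T) {u : ℝ → L2 D}
    (hu : ∀ t ∈ Icc 0 T, u t ∈ L20 D a) {t : ℝ} (ht : t ∈ Icc 0 T) {p : L2 D}
    (hp : HasDerivWithinAt u p (Icc 0 T) t) : p ∈ L20 D a := by
  have hc := measurableSet_constraintSet hD a
  have hsub : constraintSet D a ⊆ D := fun x hx => hx.1
  -- The motion is tested against the truncation of `p` to the constraint set: the pairing vanishes
  -- identically in time, and its derivative is the squared norm of that truncation.
  have hmem : MemLp ((constraintSet D a).indicator p) 2 (volume.restrict D) :=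
    (Lp.memLp p).indicator hc
  set ζ : L2 D := hmem.toLp _ with hζ
  have hζp : ∀ w : L2 D, inner ℝ ζ w = ∫ x in constraintSet D a, inner ℝ (p x) (w x) := by
    intro w
    have h1 : (volume : Measure (Euc d)).restrict (constraintSet D a) =
        (volume.restrict D).restrict (constraintSet D a) := by
      rw [Measure.restrict_restrict hc, inter_eq_self_of_subset_left hsub]
    rw [L2.inner_def, h1, ← integral_indicator hc]
    refine integral_congr_ae ?_
    filter_upwards [hmem.coeFn_toLp] with x hx
    rw [hζ, hx]
    by_cases h : x ∈ constraintSet D a <;> simp [h]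
  have hzero : ∀ s ∈ Icc 0 T, inner ℝ ζ (u s) = 0 := by
    intro s hs
    rw [hζp]
    refine integral_eq_zero_of_ae ?_
    have h1 : ∀ᵐ x ∂(volume.restrict (constraintSet D a)), u s x = 0 := hu s hs
    filter_upwards [h1] with x hx
    simp [hx]
  have hder : HasDerivWithinAt (fun s => inner ℝ ζ (u s)) (inner ℝ ζ p) (Icc 0 T) t := by
    have := (hasDerivWithinAt_const t (Icc 0 T) ζ).inner ℝ hp
    simpa using this
  have h0 : inner ℝ ζ p = 0 :=
    (uniqueDiffOn_Icc hT t ht).eq_deriv _ hder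
      ((hasDerivWithinAt_const t (Icc 0 T) (0 : ℝ)).congr hzero (hzero t ht))
  rw [hζp] at h0
  have hint : Integrable (fun x => (inner ℝ (p x) (p x) : ℝ))
      (volume.restrict (constraintSet D a)) :=
    (L2.integrable_inner (𝕜 := ℝ) p p).mono_measure
      (Measure.restrict_mono hsub le_rfl)
  rw [integral_eq_zero_iff_of_nonneg (fun x => real_inner_self_nonneg) hint] at h0
  change ∀ᵐ x ∂(volume.restrict (constraintSet D a)), p x = 0
  filter_upwards [h0] with x hx
  exact inner_self_eq_zero.1 hx

/-- Power balance: the equation of motion tested with a velocity in `L²₀`. -/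
theorem inner_motion (hf : IsCohesivePotential f finf) (hJ : IsInfluenceFunction J)
    (hε : 0 < ε) (hd : 2 ≤ d) (hD : IsOpen D) (hDb : Bornology.IsBounded D) {a ρ : ℝ}
    {w z y b : L2 D} (hz : z ∈ L20 D a)
    (h : ∀ᵐ x ∂(volume.restrict (interiorSet D a)),
      ρ • y x = -gradPD ε J f (zeroExt w) x + b x) :
    ρ * inner ℝ y z + ∫ x, inner ℝ (gradPD ε J f (zeroExt w) x) (zeroExt z x) = inner ℝ b z := by
  have hc := measurableSet_constraintSet hD a
  have hgi := (integral_inner_gradPD hf hJ hε hd hD hDb w z).1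
  have h1 : ∫ x, inner ℝ (gradPD ε J f (zeroExt w) x) (zeroExt z x) =
      ∫ x in D, inner ℝ (gradPD ε J f (zeroExt w) x) (zeroExt z x) := by
    rw [← integral_indicator hD.measurableSet]
    refine integral_congr_ae (Eventually.of_forall fun x => ?_)
    by_cases hx : x ∈ D <;> simp [zeroExt, hx]
  rw [h1, L2.inner_def, L2.inner_def, ← integral_const_mul,
    ← integral_add ((L2.integrable_inner (𝕜 := ℝ) y z).const_mul ρ) hgi.integrableOn]
  refine integral_congr_ae ?_
  have h2 : ∀ᵐ x ∂(volume.restrict D), x ∈ interiorSet D a →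
      ρ • y x = -gradPD ε J f (zeroExt w) x + b x :=
    ae_restrict_of_ae ((ae_restrict_iff' (hD.measurableSet.diff hc)).1 h)
  filter_upwards [h2, ae_eq_zero_of_mem_L20 hD hz, ae_restrict_mem hD.measurableSet]
    with x hx hzx hxD
  have hzE : zeroExt z x = z x := indicator_of_mem hxD _
  rw [hzE]
  -- The equation is not available on the constraint set, but the test velocity vanishes there.
  by_cases hxc : x ∈ constraintSet D a
  · simp [hzx hxc]
  · rw [← real_inner_smul_left, hx ⟨hxD, hxc⟩, ← inner_add_left]
    simp

/-- The energy of a cohesive evolution is bounded by the energy of its data. -/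
theorem two_mul_bondEnergy_le_energyBound (hf : IsCohesivePotential f finf)
    (hJ : IsInfluenceFunction J) (hε : 0 < ε) (hd : 2 ≤ d) (hD : IsOpen D)
    (hDb : Bornology.IsBounded D) {a ρ T : ℝ} (hρ : 0 < ρ) (hT : 0 < T) {b : ℝ → L2 D}
    (hb : ContinuousOn b (Icc 0 T)) {u₀ v₀ : L2 D} {u : ℝ → L2 D}
    (hu : IsCohesiveEvolution ε J f D a ρ T b u₀ v₀ u) {lefm : ℝ}
    (hlefm : 1 / (ε ^ (d + 1) * unitBallVolume d) * bondEnergy ε J f (zeroExt u₀) ≤ lefm)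
    {t : ℝ} (ht : t ∈ Icc 0 T) :
    2 * (1 / (ε ^ (d + 1) * unitBallVolume d) * bondEnergy ε J f (zeroExt (u t))) ≤
      energyBound lefm ρ v₀ b t := by
  set c : ℝ := 1 / (ε ^ (d + 1) * unitBallVolume d) with hc
  have hc0 : 0 ≤ c := by have := unitBallVolume_pos d; positivity
  set p : ℝ → L2 D := derivWithin u (Icc 0 T) with hp
  have hud := uniqueDiffOn_Icc hT
  have hup : ∀ s ∈ Icc 0 T, HasDerivWithinAt u (p s) (Icc 0 T) s := fun s hs =>
    (hu.contDiff.differentiableOn (by norm_num) s hs).hasDerivWithinAt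
  have hpp : ∀ s ∈ Icc 0 T,
      HasDerivWithinAt p (iteratedDerivWithin 2 u (Icc 0 T) s) (Icc 0 T) s := by
    intro s hs
    have h1 : ContDiffOn ℝ 1 p (Icc 0 T) := hu.contDiff.derivWithin hud (by norm_num)
    have h2 := (h1.differentiableOn (by norm_num) s hs).hasDerivWithinAt
    have h3 : iteratedDerivWithin 2 u (Icc 0 T) s = derivWithin p (Icc 0 T) s := by
      rw [iteratedDerivWithin_succ]
      refine derivWithin_congr (fun r _ => ?_) ?_ <;> rw [iteratedDerivWithin_one]
    rwa [h3]
  have hpL : ∀ s ∈ Icc 0 T, p s ∈ L20 D a := fun s hs =>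
    hasDerivWithinAt_mem_L20 hD hT hu.mem hs (hup s hs)
  choose L hL hLd using fun w : L2 D => exists_hasFDerivAt_bondEnergy hf hJ hε hd hD hDb w
  have hV : ∀ s ∈ Icc 0 T, HasDerivWithinAt (fun s => c * bondEnergy ε J f (zeroExt (u s)))
      (c * L (u s) (p s)) (Icc 0 T) s := fun s hs =>
    ((hLd (u s)).comp_hasDerivWithinAt s (hup s hs)).const_mul c
  have key := sqrt_energy_le hρ (fun s => mul_nonneg hc0 (bondEnergy_nonneg hf _)) hV hpp hb
    (fun s hs => by
      rw [← inner_motion hf hJ hε hd hD hDb (hpL s hs) (hu.motion s hs), hL,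
        (integral_inner_gradPD hf hJ hε hd hD hDb (u s) (p s)).2]) t ht
  have hp0 : p 0 = v₀ := hu.initial_velocity
  rw [hp0, hu.initial] at key
  have h1 : √(ρ * ‖v₀‖ ^ 2 + 2 * (c * bondEnergy ε J f (zeroExt u₀)) + 1) ≤
      √(2 * lefm + ρ * ‖v₀‖ ^ 2 + 1) := Real.sqrt_le_sqrt (by linarith)
  have h2 := key.trans (add_le_add_left h1 _)
  have hpt : 0 ≤ ρ * ‖p t‖ ^ 2 := by positivity
  have hVt : 0 ≤ c * bondEnergy ε J f (zeroExt (u t)) := mul_nonneg hc0 (bondEnergy_nonneg hf _)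
  -- Squaring recovers `C(t) + 1`; the kinetic energy on the left is nonnegative and is dropped.
  have h3 := (Real.sqrt_le_left ((Real.sqrt_nonneg _).trans h2)).1 h2
  rw [energyBound]
  linarith

/-- The energy bound increases with time. -/
theorem energyBound_mono {lefm ρ T : ℝ} (v₀ : L2 D) {b : ℝ → L2 D}
    (hb : ContinuousOn b (Icc 0 T)) {t : ℝ} (ht : t ∈ Icc 0 T) :
    energyBound lefm ρ v₀ b t ≤ energyBound lefm ρ v₀ b T := by
  have hT : (0 : ℝ) ≤ T := ht.1.trans ht.2
  have hbi : IntervalIntegrable (fun t => ‖b t‖) volume 0 T := by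
    have hbn := hb.norm
    rw [← uIcc_of_le hT] at hbn
    exact hbn.intervalIntegrable
  have h0 : 0 ≤ ∫ τ in (0 : ℝ)..t, ‖b τ‖ :=
    intervalIntegral.integral_nonneg ht.1 fun _ _ => norm_nonneg _
  have h1 : ∫ τ in (0 : ℝ)..t, ‖b τ‖ ≤ ∫ τ in (0 : ℝ)..T, ‖b τ‖ :=
    intervalIntegral.integral_mono_interval le_rfl ht.1 ht.2
      (Eventually.of_forall fun _ => norm_nonneg _) hbi
  rw [energyBound, energyBound]
  gcongr

end EnergyBalance

/-! ### The volume of the process zone -/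

section ProcessZone

variable {d : ℕ} {ε : ℝ} {J f : ℝ → ℝ} {finf : ℝ}

theorem norm_mul_strain_sq (v : Euc d → Euc d) (y x : Euc d) :
    ‖y - x‖ * strain v y x ^ 2 = bondDifference v (y - x) x ^ 2 := by
  rw [bondDifference_sq, strain, real_inner_smul_left, real_inner_smul_right, add_sub_cancel]
  rcases (norm_nonneg (y - x)).eq_or_lt with h | h
  · simp [← h]
  · field_simp

/-- A bond whose strain exceeds the threshold stores a definite amount of energy. -/
theorem mul_potential_le_of_strain (hf : IsCohesivePotential f finf) (hε : 0 < ε) {k α : ℝ}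
    (hk : 0 < k) (hα : 1 / 2 ≤ α) (hα' : α < 1) {r S : ℝ} (hr : 0 ≤ r) (hrε : r < ε)
    (hS : k * r ^ (α - 1) < |S|) :
    r / ε * f (k ^ 2 * ε ^ (2 * α - 1)) ≤ f (r * S ^ 2) := by
  rcases hr.eq_or_lt with rfl | hr
  · simp [hf.map_zero]
  have hs0 : 0 ≤ k ^ 2 * r ^ (2 * α - 1) := by positivity
  have h1 : k ^ 2 * r ^ (2 * α - 1) ≤ r * S ^ 2 := by
    have h2 : (k * r ^ (α - 1)) ^ 2 ≤ S ^ 2 := by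
      rw [← sq_abs S]
      gcongr
    calc k ^ 2 * r ^ (2 * α - 1) = r * (k * r ^ (α - 1)) ^ 2 := by
          have h3 : r ^ (2 * α - 1) = r * (r ^ (α - 1)) ^ 2 := by
            rw [← Real.rpow_natCast, ← Real.rpow_mul hr.le, show 2 * α - 1 =
              1 + (α - 1) * ((2 : ℕ) : ℝ) by push_cast; ring, Real.rpow_add hr, Real.rpow_one]
          rw [h3]
          ring
      _ ≤ r * S ^ 2 := by gcongr
  have h4 : k ^ 2 * r ^ (2 * α - 1) ≤ k ^ 2 * ε ^ (2 * α - 1) := by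
    gcongr
    linarith
  have h5 := hf.mul_le_mul hs0 h4
  have h6 : 0 < k ^ 2 * ε ^ (2 * α - 1) := by positivity
  -- Here `r / ε ≤ 1` and the exponent is at most `1`. The loss is deliberate: it produces precisely
  -- the weight `r / ε` of the volume fraction.
  have h7 : r / ε ≤ (r / ε) ^ (2 * α - 1) := by
    have := Real.rpow_le_rpow_of_exponent_ge (by positivity : 0 < r / ε)
      ((div_le_one hε).2 hrε.le) (by linarith : 2 * α - 1 ≤ 1)
    rwa [Real.rpow_one] at this
  have h8 : 0 ≤ f (k ^ 2 * ε ^ (2 * α - 1)) := hf.nonneg h6.le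
  calc r / ε * f (k ^ 2 * ε ^ (2 * α - 1))
      ≤ (r / ε) ^ (2 * α - 1) * f (k ^ 2 * ε ^ (2 * α - 1)) := by gcongr
    _ = k ^ 2 * r ^ (2 * α - 1) * f (k ^ 2 * ε ^ (2 * α - 1)) / (k ^ 2 * ε ^ (2 * α - 1)) := by
        rw [Real.div_rpow hr.le hε.le]
        field_simp
    _ ≤ f (k ^ 2 * r ^ (2 * α - 1)) := by
        rw [div_le_iff₀ h6]
        linarith
    _ ≤ f (r * S ^ 2) := hf.monotoneOn (mem_Ici.2 hs0) (mem_Ici.2 (by positivity)) h1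

/-- A Chebyshev inequality for the process zone. -/
theorem mul_volume_processZone_le (hf : IsCohesivePotential f finf) (hJ : IsInfluenceFunction J)
    (hε : 0 < ε) {k α θ : ℝ} (hk : 0 < k) (hα : 1 / 2 ≤ α) (hα' : α < 1)
    (hm : 0 < influenceMoment d J) (D : Set (Euc d)) {v : Euc d → Euc d} (hv : Measurable v) :
    ENNReal.ofReal (f (k ^ 2 * ε ^ (2 * α - 1)) * (θ * (ε ^ d * influenceMoment d J))) *
      volume (processZone ε J D k α θ v) ≤ rawEnergy ε J f v := by
  have hJm := hJ.measurable
  have hfm := hf.continuous_comp_sq.measurable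
  have hqm : Measurable fun z : Euc d × Euc d =>
      ENNReal.ofReal (J (‖z.1‖ / ε)) * ENNReal.ofReal (f (bondDifference v z.1 z.2 ^ 2)) := by
    have h1 : Measurable fun z : Euc d × Euc d => ENNReal.ofReal (J (‖z.1‖ / ε)) := by fun_prop
    exact h1.mul (hfm.comp (measurable_bondDifference hv)).ennreal_ofReal
  set g : Euc d → ℝ≥0∞ := fun x => ∫⁻ ξ, ENNReal.ofReal (J (‖ξ‖ / ε)) *
    ENNReal.ofReal (f (bondDifference v ξ x ^ 2)) with hg
  have hgm : Measurable g := hqm.lintegral_prod_left'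
  have hraw : rawEnergy ε J f v = ∫⁻ x, g x := by
    rw [hg, ← lintegral_lintegral_swap hqm.aemeasurable, rawEnergy]
    refine lintegral_congr fun ξ => (lintegral_const_mul _ ?_).symm
    exact (hfm.comp ((measurable_bondDifference hv).comp measurable_prodMk_left)).ennreal_ofReal
  rw [hraw]
  -- The process zone is contained in a superlevel set of the measurable density `g`, so its own
  -- measurability is not needed.
  refine le_trans (mul_le_mul_right (measure_mono fun x hx => ?_) _)
    (mul_meas_ge_le_lintegral hgm _)
  set c : ℝ := f (k ^ 2 * ε ^ (2 * α - 1)) with hc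
  have hc0 : 0 ≤ c := hf.nonneg (by positivity)
  set B : Set (Euc d) := {y ∈ Metric.ball x ε | k * ‖y - x‖ ^ (α - 1) < |strain v y x|} with hB
  have hBm : MeasurableSet B := by
    have h1 : Measurable fun y => |strain v y x| := by
      unfold strain
      fun_prop
    have h2 : Measurable fun y => k * ‖y - x‖ ^ (α - 1) := by fun_prop
    exact measurableSet_ball.inter (measurableSet_lt h2 h1)
  have hx2 : θ < volumeFraction ε J x B := hx.2
  have hθ : θ * (ε ^ d * influenceMoment d J) ≤
      ∫ y in B, ‖y - x‖ / ε * J (‖y - x‖ / ε) := by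
    rw [volumeFraction, one_div, inv_mul_eq_div, lt_div_iff₀ (by positivity)] at hx2
    exact hx2.le
  have hJ0 : ∀ y, 0 ≤ J (‖y - x‖ / ε) := fun y => hJ.nonneg _ (by positivity)
  have h1 : ENNReal.ofReal (∫ y in B, ‖y - x‖ / ε * J (‖y - x‖ / ε)) ≤
      ∫⁻ y in B, ENNReal.ofReal (‖y - x‖ / ε * J (‖y - x‖ / ε)) := by
    rw [integral_eq_lintegral_of_nonneg_ae
      (Eventually.of_forall fun y => mul_nonneg (by positivity) (hJ0 y))
      (Measurable.aestronglyMeasurable (by fun_prop))]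
    exact ENNReal.ofReal_toReal_le
  have h2 : g x = ∫⁻ y, ENNReal.ofReal (J (‖y - x‖ / ε)) *
      ENNReal.ofReal (f (bondDifference v (y - x) x ^ 2)) :=
    (lintegral_sub_right_eq_self (fun ξ => ENNReal.ofReal (J (‖ξ‖ / ε)) *
      ENNReal.ofReal (f (bondDifference v ξ x ^ 2))) x).symm
  change _ ≤ g x
  calc ENNReal.ofReal (c * (θ * (ε ^ d * influenceMoment d J)))
      ≤ ENNReal.ofReal c * ∫⁻ y in B, ENNReal.ofReal (‖y - x‖ / ε * J (‖y - x‖ / ε)) := by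
        rw [ENNReal.ofReal_mul hc0]
        gcongr
        exact (ENNReal.ofReal_le_ofReal hθ).trans h1
    _ = ∫⁻ y in B, ENNReal.ofReal c * ENNReal.ofReal (‖y - x‖ / ε * J (‖y - x‖ / ε)) :=
        (lintegral_const_mul _ (by fun_prop)).symm
    _ ≤ ∫⁻ y in B, ENNReal.ofReal (J (‖y - x‖ / ε)) *
          ENNReal.ofReal (f (bondDifference v (y - x) x ^ 2)) := by
        refine setLIntegral_mono' hBm fun y hy => ?_
        rw [← ENNReal.ofReal_mul hc0, ← ENNReal.ofReal_mul (hJ0 y), ← norm_mul_strain_sq]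
        refine ENNReal.ofReal_le_ofReal ?_
        have h3 := mul_potential_le_of_strain hf hε hk hα hα' (norm_nonneg (y - x))
          (mem_ball_iff_norm.1 hy.1) hy.2
        calc c * (‖y - x‖ / ε * J (‖y - x‖ / ε)) = J (‖y - x‖ / ε) * (‖y - x‖ / ε * c) := by ring
          _ ≤ _ := mul_le_mul_of_nonneg_left h3 (hJ0 y)
    _ ≤ ∫⁻ y, ENNReal.ofReal (J (‖y - x‖ / ε)) *
          ENNReal.ofReal (f (bondDifference v (y - x) x ^ 2)) := setLIntegral_le_lintegral _ _
    _ = g x := h2.symm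

end ProcessZone

end CohesiveDynamics

end

/-! ### The volume bound for the process zone -/

theorem mainTheorem4 (d : ℕ) (hd : d = 2 ∨ d = 3)
    (f : ℝ → ℝ) (finf : ℝ) (hf : CohesiveDynamics.IsCohesivePotential f finf)
    (k α β : ℝ) (hk : 0 < k) (hα : 1 / 2 ≤ α) (hα' : α < 1) (hβ : β = 2 * α - 1) :
    ∃ r : ℝ → ℝ,
      (∀ ε, 0 < ε →
        f (k ^ 2 * ε ^ β) = k ^ 2 * ε ^ β * (derivWithin f (Ici 0) 0 + r ε) ∧
        0 < derivWithin f (Ici 0) 0 + r ε) ∧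
      r =O[𝓝[>] 0] (fun ε : ℝ => ε ^ β) ∧
      ∀ (J : ℝ → ℝ), CohesiveDynamics.IsInfluenceFunction J →
        0 < CohesiveDynamics.influenceMoment d J →
      ∀ (D : Set (CohesiveDynamics.Euc d)), IsOpen D → Bornology.IsBounded D →
      ∀ (a ρ T : ℝ), 0 < ρ → 0 < T →
      ∀ (b : ℝ → CohesiveDynamics.L2 D), ContinuousOn b (Icc 0 T) →
      ∀ (u₀ v₀ : CohesiveDynamics.L2 D),
        u₀ ∈ CohesiveDynamics.L20 D a → v₀ ∈ CohesiveDynamics.L20 D a →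
      ∀ (E : CohesiveDynamics.Euc d → Matrix (Fin d) (Fin d) ℝ)
        (K : Set (CohesiveDynamics.Euc d)),
        CohesiveDynamics.IsLEFMDisplacement D u₀ E K →
      ∀ (ε : ℝ), 0 < ε → 2 * ε < a →
      ∀ (u : ℝ → CohesiveDynamics.L2 D),
        CohesiveDynamics.IsCohesiveEvolution ε J f D a ρ T b u₀ v₀ u →
      ∀ (θ : ℝ), 0 < θ → θ ≤ 1 →
      ∀ t ∈ Icc (0 : ℝ) T,
        volume (CohesiveDynamics.processZone ε J D k α θ (CohesiveDynamics.zeroExt (u t))) ≤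
          ENNReal.ofReal
            (ε ^ (1 - β) / (θ * k ^ 2 * (derivWithin f (Ici 0) 0 + r ε)) *
              (CohesiveDynamics.unitBallVolume d *
                CohesiveDynamics.energyBound
                  (CohesiveDynamics.LEFM f finf J D E K) ρ v₀ b t /
                (2 * CohesiveDynamics.influenceMoment d J))) ∧
        CohesiveDynamics.energyBound (CohesiveDynamics.LEFM f finf J D E K) ρ v₀ b t ≤
          CohesiveDynamics.energyBound (CohesiveDynamics.LEFM f finf J D E K) ρ v₀ b T := by
  obtain ⟨r, hr, hrO⟩ :=
    CohesiveDynamics.exists_slope_deviation hf hk (show 0 ≤ β by rw [hβ]; linarith)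
  refine ⟨r, hr, hrO, ?_⟩
  intro J hJ hm D hD hDb a ρ T hρ hT b hb u₀ v₀ hu₀ _ E K hK ε hε hεa u hu θ hθ _ t ht
  refine ⟨?_, CohesiveDynamics.energyBound_mono v₀ hb ht⟩
  have hd2 : 2 ≤ d := by omega
  have hω : 0 < CohesiveDynamics.unitBallVolume d := CohesiveDynamics.unitBallVolume_pos d
  obtain ⟨hfr, hrpos⟩ := hr ε hε
  set lefm := CohesiveDynamics.LEFM f finf J D E K with hlefm
  have hE0 : 1 / (ε ^ (d + 1) * CohesiveDynamics.unitBallVolume d) *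
      CohesiveDynamics.bondEnergy ε J f (CohesiveDynamics.zeroExt u₀) ≤ lefm := by
    have h1 := CohesiveDynamics.rawEnergy_le_LEFM hd hf hJ hε hD hDb (by linarith) hu₀ hK
    rw [← CohesiveDynamics.ofReal_bondEnergy hf hJ hε hd2 hD hDb] at h1
    have hlefm0 : 0 ≤ lefm := CohesiveDynamics.LEFM_nonneg hf hJ D E K
    have h2 := (ENNReal.ofReal_le_ofReal_iff (by positivity)).1 h1
    rw [one_div, inv_mul_le_iff₀ (by positivity)]
    exact h2
  have hEt := CohesiveDynamics.two_mul_bondEnergy_le_energyBound hf hJ hε hd2 hD hDb hρ hT hb hu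
    hE0 ht
  have hPZ := CohesiveDynamics.mul_volume_processZone_le hf hJ hε (θ := θ) hk hα hα' hm D
    (CohesiveDynamics.measurable_zeroExt hD (u t))
  rw [← CohesiveDynamics.ofReal_bondEnergy hf hJ hε hd2 hD hDb, ← hβ, hfr] at hPZ
  set C := CohesiveDynamics.energyBound lefm ρ v₀ b t with hC
  set W := CohesiveDynamics.bondEnergy ε J f (CohesiveDynamics.zeroExt (u t)) with hW
  set c := derivWithin f (Ici 0) 0 + r ε with hc
  set m := CohesiveDynamics.influenceMoment d J with hmdef
  have hκ : 0 < k ^ 2 * ε ^ β * c * (θ * (ε ^ d * m)) := by positivity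
  rw [mul_comm, ← ENNReal.le_div_iff_mul_le (Or.inl (ENNReal.ofReal_pos.2 hκ).ne')
    (Or.inl ENNReal.ofReal_ne_top), ← ENNReal.ofReal_div_of_pos hκ] at hPZ
  refine hPZ.trans (ENNReal.ofReal_le_ofReal ?_)
  have hWC : W ≤ ε ^ (d + 1) * CohesiveDynamics.unitBallVolume d * C / 2 := by
    rw [← mul_assoc, mul_one_div, div_mul_eq_mul_div, div_le_iff₀ (by positivity)] at hEt
    linarith
  -- The energy normalization carries `ε ^ (d + 1)` and the Chebyshev threshold `ε ^ d * ε ^ β`,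
  -- which leaves `ε ^ (1 - β)`.
  rw [Real.rpow_sub hε, Real.rpow_one]
  have hεβ : 0 < ε ^ β := by positivity
  calc W / (k ^ 2 * ε ^ β * c * (θ * (ε ^ d * m)))
      ≤ (ε ^ (d + 1) * CohesiveDynamics.unitBallVolume d * C / 2) /
        (k ^ 2 * ε ^ β * c * (θ * (ε ^ d * m))) := by gcongr
    _ = _ := by
      rw [pow_succ]
      field_simp
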